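/- **Conventions.** A grid diagram of size $n$ is an $n\times n$ array of squares (columns $0,\dots,n-1$ from left to right, rows $0,\dots,n-1$ from bottom to top) with exactly one $X$ and one $O$ in each row and column and never both in one square. Its braid $B(G)$ is obtained as follows. In each row draw the horizontal segment from the $O$ to the $X$. In each column whose $O$ lies above its $X$, draw the vertical segment from the $X$ up to the $O$; in each column whose $O$ lies below its $X$, draw a vertical segment from the bottom of the diagram up to the $O$ and one from the $X$ up to the top. Horizontal segments pass over vertical ones. All vertical segments are oriented upwards, and $B(G)$ is read from bottom to top. The generators $\sigma_i$ of the braid group are positive (right-handed) crossings. Let $\xi_{\mathrm{rot}}=\ker\alpha$, $\alpha=dz-y\,dx+x\,dy$, on $\mathbb R^3$. A transverse knot is a smoothly embedded closed curve with $\alpha>0$ along its orientation; two transverse knots are the same if they are joined by a smooth family of transverse knots. A braid $B$ represents the transverse knot $T(B)$ obtained by placing the closure of $B$, traversed in the direction of increasing angle, in a sufficiently thin tubular neighbourhood of $\{(\cos\theta,\sin\theta,0)\}$, so that the trivial braid gives the parallel circles $(\cos\theta,\sin\theta,k\varepsilon)$ (for all the braids below the closure is a knot). For integers $a,b\ge 0$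 let $$B_1(a,b)=\sigma_3\sigma_2^{-2}\sigma_3^{2a+2}\sigma_2\sigma_3^{-1}\sigma_1^{-1}\sigma_2\sigma_1^{2b+2},\qquad B_2(a,b)=\sigma_3\sigma_2^{-2}\sigma_3^{2a+2}\sigma_2\sigma_3^{-1}\sigma_1^{2b+2}\sigma_2\sigma_1^{-1}.$$ Let $G_1(a,b)$ be the grid diagram of size $2a+2b+9$ whose column $c$ has its $X$ in row $x(c)$ and its $O$ in row $o(c)$, where - $x(0)=4$, $x(1)=3$, $x(c)=c+3$ for $2\le c\le 2b+2$, $x(2b+3)=1$, $x(2b+4)=0$, $x(2b+5)=2$, $x(c)=c$ for $c\ge 2b+6$; - $o(0)=0$, $o(1)=2a+2b+7$, $o(2)=2$, $o(c)=c+1$ for $3\le c\le 2b+3$, $o(2b+4)=3$, $o(2b+5)=2a+2b+8$, $o(2b+6)=1$, $o(2b+7)=2b+5$, $o(c)=c-2$ for $c\ge 2b+8$. Let $G_2(a,b)$ be the grid diagram of size $2a+2b+10$ with - $x(c)=3-c$ for $0\le c\le 3$, $x(c)=c$ for $c\ge 4$; - $o(0)=2a+2b+8$, $o(1)=2b+6$,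 $o(2)=3$, $o(3)=2b+5$, $o(4)=2a+2b+9$, $o(5)=2$, $o(c)=c-2$ for $6\le c\le 2b+5$, $o(2b+6)=1$, $o(2b+7)=0$, $o(2b+8)=2b+4$, $o(c)=c-2$ for $c\ge 2b+9$. **Proposition.** For all integers $a,b\ge 0$, the braids $B(G_1(a,b))$ and $B_1(a,b)$ represent the same transverse knot, and the braids $B(G_2(a,b))$ and $B_2(a,b)$ represent the same transverse knot. -/

import Mathlib

open scoped ContDiff

/-! ## Transverse knots in the rotationally symmetric contact structure -/

/-- The contact form `dz - y dx + x dy` on `ℝ³`, evaluated at the point `p` on the vector `v`.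
Its kernel is the contact structure `ξ_rot`. -/
def rotForm (p v : ℝ × ℝ × ℝ) : ℝ := v.2.2 - p.2.1 * v.1 + p.1 * v.2.1

/-- `γ` is a `1`-periodic smooth parametrization of an embedded oriented closed curve that is
positively transverse to `ξ_rot` (positivity of the form forces `γ` to be an immersion). -/
structure IsTransverseParam (γ : ℝ → ℝ × ℝ × ℝ) : Prop where
  smooth : ContDiff ℝ ∞ γ
  periodic : Function.Periodic γ 1
  injOn : Set.InjOn γ (Set.Ico 0 1)
  transverse : ∀ t, 0 < rotForm (γ t) (deriv γ t)

/-- Transverse isotopy of two transverse knots, each given as a subset of `ℝ³` (its orientation is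
determined by positive transversality): a smooth one-parameter family of transverse knots
joins `K₀` to `K₁`. In particular `K₀` and `K₁` themselves have to be transverse knots. -/
def TransverselyIsotopic (K₀ K₁ : Set (ℝ × ℝ × ℝ)) : Prop :=
  ∃ H : ℝ → ℝ → ℝ × ℝ × ℝ,
    ContDiff ℝ ∞ (fun p : ℝ × ℝ => H p.1 p.2) ∧
    (∀ s ∈ Set.Icc (0 : ℝ) 1, IsTransverseParam (H s)) ∧
    Set.range (H 0) = K₀ ∧ Set.range (H 1) = K₁

/-! ## Braid words and their transverse closures -/

/-- A word in the standard generators of the braid group on `strands` strands. The letter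
`(i, true)` is `σ_i`, the letter `(i, false)` is `σ_i⁻¹`, where `1 ≤ i < strands`. -/
structure BraidWord where
  strands : ℕ
  letters : List (ℕ × Bool)
  valid : ∀ l ∈ letters, 1 ≤ l.1 ∧ l.1 < strands

/-- The word `σ_i ^ e`. -/
def sigmaPow (i : ℕ) (e : ℤ) : List (ℕ × Bool) := List.replicate e.natAbs (i, decide (0 < e))

theorem sigmaPow_fst {i : ℕ} {e : ℤ} {l : ℕ × Bool} (h : l ∈ sigmaPow i e) : l.1 = i := by
  rw [List.eq_of_mem_replicate h]

/-- The geometric letter: the position in the `(u, v)`-plane at time `τ ∈ [0, 1]` of the strand that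
starts at `(0, k)`. For `σ_i` the strands starting at `(0, i)` and `(0, i + 1)` exchange their
places by a half turn, the one that moves up using the side `u < 0` and the one that moves
down the side `u > 0`; for `σ_i⁻¹` the sides are exchanged. With `u` the radial, `v` the
vertical coordinate and the time the angular coordinate in `ℝ³`, the crossing of `σ_i` is positive.
`none` stands for a trivial piece of braid. -/
noncomputable def letterPath (l : Option (ℕ × Bool)) (k : ℕ) (τ : ℝ) : ℝ × ℝ :=
  match l with
  | none => (0, k)
  | some (i, pos) =>
    let φ : ℝ := Real.pi * Real.smoothTransition τ
    let sgn : ℝ := if pos then 1 else -1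
    if k = i then (-(sgn * Real.sin φ / 2), i + 1 / 2 - Real.cos φ / 2)
    else if k = i + 1 then (sgn * Real.sin φ / 2, i + 1 / 2 + Real.cos φ / 2)
    else (0, k)

/-- The point of `ℝ³` with cylindrical coordinates `r = 1 + ε u`, angle `θ`, `z = ε v`. -/
noncomputable def nearCircle (ε θ : ℝ) (q : ℝ × ℝ) : ℝ × ℝ × ℝ :=
  ((1 + ε * q.1) * Real.cos θ, (1 + ε * q.1) * Real.sin θ, ε * q.2)

/-- The closure of the braid word `B`, embedded in a neighbourhood of size `O(ε)` of the
transverse unknot `(cos θ, sin θ, 0)`: the circle of angles is divided into `m + 1` equal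
sectors, `m` the length of `B`; the letters are performed in the first `m` sectors, in the
order in which they are read and in the direction of increasing angle, and nothing happens in the
last sector. The trivial braid gives the parallel circles `(cos θ, sin θ, ε k)`. -/
noncomputable def BraidWord.closure (B : BraidWord) (ε : ℝ) : Set (ℝ × ℝ × ℝ) :=
  {p | ∃ j : ℕ, j ≤ B.letters.length ∧ ∃ k : ℕ, 1 ≤ k ∧ k ≤ B.strands ∧
    ∃ τ ∈ Set.Icc (0 : ℝ) 1,
      p = nearCircle ε (2 * Real.pi * ((j + τ) / (B.letters.length + 1)))
        (letterPath (B.letters[j]?) k τ)}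

/-- `B` and `B'` represent the same transverse knot: all sufficiently thin closures of `B` and
of `B'` are transverse knots, and they are transversely isotopic. -/
def RepresentSameTransverseKnot (B B' : BraidWord) : Prop :=
  ∃ ε₀ : ℝ, 0 < ε₀ ∧ ∀ ε ε' : ℝ, 0 < ε → ε < ε₀ → 0 < ε' → ε' < ε₀ →
    TransverselyIsotopic (B.closure ε) (B'.closure ε')

/-- `σ₃ σ₂⁻² σ₃^(2a+2) σ₂ σ₃⁻¹ σ₁⁻¹ σ₂ σ₁^(2b+2)` -/
def braidOne (a b : ℕ) : BraidWord where
  strands := 4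
  letters := sigmaPow 3 1 ++ sigmaPow 2 (-2) ++ sigmaPow 3 (2 * a + 2) ++ sigmaPow 2 1 ++
    sigmaPow 3 (-1) ++ sigmaPow 1 (-1) ++ sigmaPow 2 1 ++ sigmaPow 1 (2 * b + 2)
  valid := by
    intro l hl
    simp only [List.mem_append] at hl
    rcases hl with ((((((h | h) | h) | h) | h) | h) | h) | h <;> rw [sigmaPow_fst h] <;> decide

/-- `σ₃ σ₂⁻² σ₃^(2a+2) σ₂ σ₃⁻¹ σ₁^(2b+2) σ₂ σ₁⁻¹` -/
def braidTwo (a b : ℕ) : BraidWord where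
  strands := 4
  letters := sigmaPow 3 1 ++ sigmaPow 2 (-2) ++ sigmaPow 3 (2 * a + 2) ++ sigmaPow 2 1 ++
    sigmaPow 3 (-1) ++ sigmaPow 1 (2 * b + 2) ++ sigmaPow 2 1 ++ sigmaPow 1 (-1)
  valid := by
    intro l hl
    simp only [List.mem_append] at hl
    rcases hl with ((((((h | h) | h) | h) | h) | h) | h) | h <;> rw [sigmaPow_fst h] <;> decide

/-! ## Grid diagrams and their braids -/

/-- An `n × n` grid diagram. Columns are numbered `0, …, n-1` from left to right and rows
`0, …, n-1` from bottom to top; `X c` and `O c` are the rows of the `X` and of the `O` in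
column `c`. -/
structure GridDiagram (n : ℕ) where
  X : Fin n → Fin n
  O : Fin n → Fin n
  X_bij : Function.Bijective X
  O_bij : Function.Bijective O
  ne : ∀ c, X c ≠ O c

namespace GridDiagram

variable {n : ℕ} (G : GridDiagram n)

/-- The column of the `X` in row `j`. -/
def colX (j : Fin n) : Fin n := Fintype.bijInv G.X_bij j

/-- The column of the `O` in row `j`. -/
def colO (j : Fin n) : Fin n := Fintype.bijInv G.O_bij j

theorem X_colX (j : Fin n) : G.X (G.colX j) = j := Fintype.rightInverse_bijInv G.X_bij j

theorem O_colO (j : Fin n) : G.O (G.colO j) = j := Fintype.rightInverse_bijInv G.O_bij j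

theorem colX_X (c : Fin n) : G.colX (G.X c) = c := Fintype.leftInverse_bijInv G.X_bij c

theorem colO_O (c : Fin n) : G.colO (G.O c) = c := Fintype.leftInverse_bijInv G.O_bij c

theorem colO_ne_colX (j : Fin n) : G.colO j ≠ G.colX j := by
  intro h
  apply G.ne (G.colX j)
  rw [G.X_colX, ← h, G.O_colO]

/-- The horizontal line at height `j` (the lower boundary of row `j`) meets a vertical segment
of the braid `B(G)` in column `c`. If the `O` lies above the `X`, there is one segment, from the
`X` up to the `O`; if it lies below, there are two, from the bottom of the diagram up to the
`O` and from the `X` up to the top. -/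
def Active (j : ℕ) (c : Fin n) : Prop :=
  (G.X c < G.O c ∧ (G.X c : ℕ) < j ∧ j ≤ (G.O c : ℕ)) ∨
  (G.O c < G.X c ∧ (j ≤ (G.O c : ℕ) ∨ (G.X c : ℕ) < j))

instance (j : ℕ) (c : Fin n) : Decidable (G.Active j c) := by
  unfold Active; infer_instance

/-- The columns in which a strand of `B(G)` crosses height `j`. -/
def activeSet (j : ℕ) : Finset (Fin n) := Finset.univ.filter (G.Active j)

/-- The number of strands at height `j` strictly to the left of column `e`. -/
def rank (j : ℕ) (e : Fin n) : ℕ := ((G.activeSet j).filter (· < e)).card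

/-- The crossings of `B(G)` in row `j`, in the order in which the strand that runs horizontally
from the `O` to the `X` of this row meets them. It passes over all vertical strands between the
two columns: to the right by positive, to the left by negative crossings. -/
def rowLetters (j : Fin n) : List (ℕ × Bool) :=
  if G.colO j < G.colX j then
    ((List.finRange n).filter
      (fun e => decide (G.colO j < e ∧ e < G.colX j ∧ G.Active j e))).map
        (fun e => (G.rank j e, true))
  else
    ((List.finRange n).reverse.filter
      (fun e => decide (G.colX j < e ∧ e < G.colO j ∧ G.Active j e))).map
        (fun e => (G.rank j e + 1, false))

theorem mem_activeSet {j : ℕ} {c : Fin n} : c ∈ G.activeSet j ↔ G.Active j c := by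
  simp [activeSet]

theorem active_colO (j : Fin n) : G.Active j (G.colO j) := by
  have h1 := G.O_colO j
  have h2 := G.ne (G.colO j)
  unfold Active
  rw [h1] at h2 ⊢
  rw [Fin.lt_def, Fin.lt_def]
  have : (G.X (G.colO j) : ℕ) ≠ j := fun h => h2 (Fin.ext h)
  omega

theorem not_active_colX (j : Fin n) : ¬ G.Active j (G.colX j) := by
  have h1 := G.X_colX j
  unfold Active
  rw [h1, Fin.lt_def, Fin.lt_def]
  omega

theorem activeSet_succ (j : Fin n) :
    G.activeSet (j + 1) = insert (G.colX j) ((G.activeSet j).erase (G.colO j)) := by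
  ext c
  simp only [Finset.mem_insert, Finset.mem_erase, mem_activeSet]
  have hX : c = G.colX j ↔ (G.X c : ℕ) = j := by
    constructor
    · rintro rfl; rw [G.X_colX]
    · intro h; rw [← G.colX_X c, Fin.ext h]
  have hO : c = G.colO j ↔ (G.O c : ℕ) = j := by
    constructor
    · rintro rfl; rw [G.O_colO]
    · intro h; rw [← G.colO_O c, Fin.ext h]
  have hne : (G.X c : ℕ) ≠ G.O c := fun h => G.ne c (Fin.ext h)
  rw [Ne, hX, hO]
  unfold Active
  rw [Fin.lt_def, Fin.lt_def]
  omega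

theorem card_activeSet (j : ℕ) (hj : j ≤ n) : (G.activeSet j).card = (G.activeSet 0).card := by
  induction j with
  | zero => rfl
  | succ j ih =>
    have hx : G.colX ⟨j, hj⟩ ∉ (G.activeSet j).erase (G.colO ⟨j, hj⟩) := fun h =>
      G.not_active_colX ⟨j, hj⟩ (G.mem_activeSet.1 (Finset.mem_of_mem_erase h))
    have ho : G.colO ⟨j, hj⟩ ∈ G.activeSet j := G.mem_activeSet.2 (G.active_colO ⟨j, hj⟩)
    have := G.activeSet_succ ⟨j, hj⟩
    simp only at this
    rw [this, Finset.card_insert_of_notMem hx, Finset.card_erase_add_one ho]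
    exact ih (by omega)

theorem rank_lt_rank {j : ℕ} {c e : Fin n} (hc : G.Active j c) (h : c < e) :
    G.rank j c < G.rank j e := by
  apply Finset.card_lt_card
  refine Finset.ssubset_iff_of_subset ?_ |>.2 ⟨c, ?_, ?_⟩
  · intro x hx
    simp only [Finset.mem_filter] at hx ⊢
    exact ⟨hx.1, hx.2.trans h⟩
  · simp [mem_activeSet, hc, h]
  · simp

theorem rank_lt_card {j : ℕ} {c : Fin n} (hc : G.Active j c) :
    G.rank j c < (G.activeSet j).card := by
  apply Finset.card_lt_card
  refine Finset.ssubset_iff_of_subset (Finset.filter_subset _ _) |>.2 ⟨c, ?_, ?_⟩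
  · simp [mem_activeSet, hc]
  · simp

/-- The braid `B(G)`, read from the bottom to the top of the diagram, with strands numbered from
left to right. -/
def toBraid : BraidWord where
  strands := (G.activeSet 0).card
  letters := (List.finRange n).flatMap G.rowLetters
  valid := by
    intro l hl
    obtain ⟨j, -, hl⟩ := List.mem_flatMap.1 hl
    have hcard := G.card_activeSet j j.2.le
    have hO := G.active_colO j
    unfold rowLetters at hl
    split_ifs at hl with h
    · simp only [List.mem_map, List.mem_filter, decide_eq_true_eq] at hl
      obtain ⟨e, ⟨-, h1, -, h3⟩, rfl⟩ := hl
      have h4 := G.rank_lt_rank hO h1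
      have h5 := G.rank_lt_card h3
      simp only
      omega
    · simp only [List.mem_map, List.mem_filter, decide_eq_true_eq] at hl
      obtain ⟨e, ⟨-, -, h2, h3⟩, rfl⟩ := hl
      have h4 := G.rank_lt_rank h3 h2
      have h5 := G.rank_lt_card hO
      simp only
      omega

end GridDiagram

/-! ## The two families of grid diagrams -/

/-- The row of the `X` in column `c` of the first diagram. -/
def oneX (b c : ℕ) : ℕ :=
  if c = 0 then 4
  else if c = 1 then 3
  else if c ≤ 2 * b + 2 then c + 3
  else if c = 2 * b + 3 then 1
  else if c = 2 * b + 4 then 0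
  else if c = 2 * b + 5 then 2
  else c

/-- The row of the `O` in column `c` of the first diagram. -/
def oneO (a b c : ℕ) : ℕ :=
  if c = 0 then 0
  else if c = 1 then 2 * a + 2 * b + 7
  else if c = 2 then 2
  else if c ≤ 2 * b + 3 then c + 1
  else if c = 2 * b + 4 then 3
  else if c = 2 * b + 5 then 2 * a + 2 * b + 8
  else if c = 2 * b + 6 then 1
  else if c = 2 * b + 7 then 2 * b + 5
  else c - 2

/-- The row of the `X` in column `c` of the second diagram. -/
def twoX (c : ℕ) : ℕ := if c ≤ 3 then 3 - c else c

/-- The row of the `O` in column `c` of the second diagram. -/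
def twoO (a b c : ℕ) : ℕ :=
  if c = 0 then 2 * a + 2 * b + 8
  else if c = 1 then 2 * b + 6
  else if c = 2 then 3
  else if c = 3 then 2 * b + 5
  else if c = 4 then 2 * a + 2 * b + 9
  else if c = 5 then 2
  else if c ≤ 2 * b + 5 then c - 2
  else if c = 2 * b + 6 then 1
  else if c = 2 * b + 7 then 0
  else if c = 2 * b + 8 then 2 * b + 4
  else c - 2

theorem bijective_of_nat {n : ℕ} (f : ℕ → ℕ) (h : ∀ c : Fin n, f c < n)
    (hinj : ∀ c d, c < n → d < n → f c = f d → c = d) :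
    Function.Bijective (fun c : Fin n => (⟨f c, h c⟩ : Fin n)) := by
  apply Finite.injective_iff_bijective.1
  intro c d hcd
  exact Fin.ext (hinj c d c.2 d.2 (Fin.ext_iff.1 hcd))

theorem oneX_lt (a b : ℕ) (c : Fin (2 * a + 2 * b + 9)) : oneX b c < 2 * a + 2 * b + 9 := by
  have := c.2
  unfold oneX; (repeat' split) <;> omega

theorem oneO_lt (a b : ℕ) (c : Fin (2 * a + 2 * b + 9)) : oneO a b c < 2 * a + 2 * b + 9 := by
  have := c.2
  unfold oneO; repeat' split
  all_goals omega

theorem twoX_lt (a b : ℕ) (c : Fin (2 * a + 2 * b + 10)) : twoX c < 2 * a + 2 * b + 10 := by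
  have := c.2
  unfold twoX; (repeat' split) <;> omega

theorem twoO_lt (a b : ℕ) (c : Fin (2 * a + 2 * b + 10)) : twoO a b c < 2 * a + 2 * b + 10 := by
  have := c.2
  unfold twoO; repeat' split
  all_goals omega

theorem oneO_cases (a b c : ℕ) :
    (c = 0 ∧ oneO a b c = 0) ∨
    (c = 1 ∧ oneO a b c = 2 * a + 2 * b + 7) ∨
    (c = 2 ∧ oneO a b c = 2) ∨
    ((3 ≤ c ∧ c ≤ 2 * b + 3) ∧ oneO a b c = c + 1) ∨
    (c = 2 * b + 4 ∧ oneO a b c = 3) ∨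
    (c = 2 * b + 5 ∧ oneO a b c = 2 * a + 2 * b + 8) ∨
    (c = 2 * b + 6 ∧ oneO a b c = 1) ∨
    (c = 2 * b + 7 ∧ oneO a b c = 2 * b + 5) ∨
    (2 * b + 8 ≤ c ∧ oneO a b c = c - 2) := by
  unfold oneO
  (repeat' split) <;>
    repeat first | exact Or.inl ⟨by omega, rfl⟩ | exact ⟨by omega, rfl⟩ | apply Or.inr

theorem oneO_inj {a b c d : ℕ} (hc : c < 2 * a + 2 * b + 9) (hd : d < 2 * a + 2 * b + 9)
    (h : oneO a b c = oneO a b d) : c = d := by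
  have hcs := oneO_cases a b c
  rcases oneO_cases a b d with ⟨h3, h4⟩ | ⟨h3, h4⟩ | ⟨h3, h4⟩ | ⟨h3, h4⟩ | ⟨h3, h4⟩ | ⟨h3, h4⟩ | ⟨h3, h4⟩ | ⟨h3, h4⟩ | ⟨h3, h4⟩ <;>
    rw [h, h4] at hcs <;> omega

theorem twoO_cases (a b c : ℕ) :
    (c = 0 ∧ twoO a b c = 2 * a + 2 * b + 8) ∨
    (c = 1 ∧ twoO a b c = 2 * b + 6) ∨
    (c = 2 ∧ twoO a b c = 3) ∨
    (c = 3 ∧ twoO a b c = 2 * b + 5) ∨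
    (c = 4 ∧ twoO a b c = 2 * a + 2 * b + 9) ∨
    (c = 5 ∧ twoO a b c = 2) ∨
    ((6 ≤ c ∧ c ≤ 2 * b + 5) ∧ twoO a b c = c - 2) ∨
    (c = 2 * b + 6 ∧ twoO a b c = 1) ∨
    (c = 2 * b + 7 ∧ twoO a b c = 0) ∨
    (c = 2 * b + 8 ∧ twoO a b c = 2 * b + 4) ∨
    (2 * b + 9 ≤ c ∧ twoO a b c = c - 2) := by
  unfold twoO
  (repeat' split) <;>
    repeat first | exact Or.inl ⟨by omega, rfl⟩ | exact ⟨by omega, rfl⟩ | apply Or.inr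

theorem twoO_inj {a b c d : ℕ} (hc : c < 2 * a + 2 * b + 10) (hd : d < 2 * a + 2 * b + 10)
    (h : twoO a b c = twoO a b d) : c = d := by
  have hcs := twoO_cases a b c
  rcases twoO_cases a b d with ⟨h3, h4⟩ | ⟨h3, h4⟩ | ⟨h3, h4⟩ | ⟨h3, h4⟩ | ⟨h3, h4⟩ | ⟨h3, h4⟩ | ⟨h3, h4⟩ | ⟨h3, h4⟩ | ⟨h3, h4⟩ | ⟨h3, h4⟩ | ⟨h3, h4⟩ <;>
    rw [h, h4] at hcs <;> omega

theorem oneX_ne_oneO (a b c : ℕ) : oneX b c ≠ oneO a b c := by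
  have := oneO_cases a b c
  unfold oneX; (repeat' split) <;> omega

theorem twoX_ne_twoO (a b c : ℕ) : twoX c ≠ twoO a b c := by
  have := twoO_cases a b c
  unfold twoX; (repeat' split) <;> omega

/-- The grid diagram `G₁(a,b)`. -/
def gridOne (a b : ℕ) : GridDiagram (2 * a + 2 * b + 9) where
  X c := ⟨oneX b c, oneX_lt a b c⟩
  O c := ⟨oneO a b c, oneO_lt a b c⟩
  X_bij := bijective_of_nat (oneX b) (oneX_lt a b) (by
    intro c d hc hd h
    unfold oneX at h; split_ifs at h <;> omega)
  O_bij := bijective_of_nat (oneO a b) (oneO_lt a b) (by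
    intro c d hc hd h
    exact oneO_inj hc hd h)
  ne c := by
    rw [Ne, Fin.ext_iff]
    exact oneX_ne_oneO a b c

/-- The grid diagram `G₂(a,b)`. -/
def gridTwo (a b : ℕ) : GridDiagram (2 * a + 2 * b + 10) where
  X c := ⟨twoX c, twoX_lt a b c⟩
  O c := ⟨twoO a b c, twoO_lt a b c⟩
  X_bij := bijective_of_nat twoX (twoX_lt a b) (by
    intro c d hc hd h
    unfold twoX at h; split_ifs at h <;> omega)
  O_bij := bijective_of_nat (twoO a b) (twoO_lt a b) (by
    intro c d hc hd h
    exact twoO_inj hc hd h)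
  ne c := by
    rw [Ne, Fin.ext_iff]
    exact twoX_ne_twoO a b c

/-!
Two braids whose closures are knots represent the same transverse knot if they are related by braid
isotopy, conjugation and positive stabilization. These moves are established for the thin closures, and
then the grid braids are reached from the given braids on four strands by such moves.

**Closed braids.** A closed braid whose closure is a knot is described by a single periodic function, the
position of the strand in the transverse plane as a function of the number of turns made (`IsLoop`). When
this plane is scaled by a small factor `ε`, the term `r² dθ` dominates the contact form, so a smooth family
of such loops gives a smooth family of transverse knots for all small `ε` (`ThinIso.of_loopIso`). Hence
isotopies of geometric braids do not change the transverse knot (`thinIso_of_arcIso`), and neither does the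
exchange of two factors, which rotates the closed braid about the axis (`SameKnot.mul_comm`).

**The braid group.** The geometric braids given by words, up to isotopy, form a group `Br`. It satisfies the
braid relations because a positive word in which no two strands cross twice is determined by its
permutation: its strands can be moved into concentric layers, in which they may be moved up and down
independently (`ArcIso.of_layered`, `WordIso.of_crossOnce`). No presentation of this group is needed, only
that the relations hold.

**Positive stabilization.** In `SameKnot.stabilize` the topmost strand is raised above the others, which
makes room in the `z`-direction, and a small part of it is pushed across the axis, so that the curve turns
around the axis once more. Close to the axis the form `r² dθ` is small, and `dz` is kept positive on this
part by its rise (`rotForm_spiral_pos`). After reparametrization by its angle the pushed curve is a loop on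
one more strand, and it differs from the closure of `σ_n g` by a linear interpolation
(`RestsOnTop.thinIso`).

**Consequences in `Br`.** Everything else is algebra. Two stabilizations give the exchange move
(`SameKnot.exchange`). Repeated stabilizations trade powers of the letter `σ₁` or of the highest letter for
additional strands, while two ascending products `σ_p ⋯ σ_q` grow longer (`SameKnot.inflate_bottom`,
`SameKnot.inflate_top`). Applied to the powers of `σ₁` and `σ₃` in the two braids on four strands, for the
first family after two exchange moves (`SameKnot.shortBraidOne`), this leads to braids on `2a + 2b + 5`
strands (`SameKnot.inflatedBraidOne`, `SameKnot.inflatedBraidTwo`).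

**Grid diagrams.** A row of a grid diagram contributes an ascending product or the inverse of one, between
indices that count the columns with a strand at its height. All but eight rows of the given diagrams
contain no crossing, and the others give exactly the words above (`mk_gridOne`, `mk_gridTwo`).
-/

open scoped Pointwise

/-! ### Smooth families of curves -/

/-- `f` and `g` are joined by a smooth one-parameter family of `ι`-indexed systems of curves, all of
whose members satisfy `P`. The parameter runs over all of `ℝ`, the ends being at `0` and `1`. -/
def SmoothlyJoined {ι V : Type*} [NormedAddCommGroup V] [NormedSpace ℝ V]
    (P : (ι → ℝ → V) → Prop) (f g : ι → ℝ → V) : Prop :=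
  ∃ F : ℝ → ι → ℝ → V, (∀ i, ContDiff ℝ ∞ fun p : ℝ × ℝ => F p.1 i p.2) ∧
    (∀ s, P (F s)) ∧ F 0 = f ∧ F 1 = g

namespace SmoothlyJoined

variable {ι V : Type*} [NormedAddCommGroup V] [NormedSpace ℝ V] {P : (ι → ℝ → V) → Prop}
  {f g h : ι → ℝ → V}

theorem smoothTransition_mem (s : ℝ) : Real.smoothTransition s ∈ Set.Icc (0 : ℝ) 1 :=
  ⟨Real.smoothTransition.nonneg s, Real.smoothTransition.le_one s⟩

theorem contDiff_smoothTransition : ContDiff ℝ ∞ Real.smoothTransition :=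
  Real.smoothTransition.contDiff

theorem of_Icc (F : ℝ → ι → ℝ → V) (hF : ∀ i, ContDiff ℝ ∞ fun p : ℝ × ℝ => F p.1 i p.2)
    (hP : ∀ s ∈ Set.Icc (0 : ℝ) 1, P (F s)) : SmoothlyJoined P (F 0) (F 1) := by
  refine ⟨fun s => F (Real.smoothTransition s), fun i => ?_, fun s => hP _ (smoothTransition_mem s),
    by simp, by simp⟩
  exact (hF i).comp ((contDiff_smoothTransition.comp contDiff_fst).prodMk contDiff_snd)

theorem refl (hf : ∀ i, ContDiff ℝ ∞ (f i)) (hP : P f) : SmoothlyJoined P f f :=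
  ⟨fun _ => f, fun i => (hf i).comp contDiff_snd, fun _ => hP, rfl, rfl⟩

theorem symm (H : SmoothlyJoined P f g) : SmoothlyJoined P g f := by
  obtain ⟨F, hF, hP, rfl, rfl⟩ := H
  refine ⟨fun s => F (1 - s), fun i => ?_, fun s => hP _, by simp, by simp⟩
  exact (hF i).comp ((contDiff_const.sub contDiff_fst).prodMk contDiff_snd)

theorem trans (H : SmoothlyJoined P f g) (H' : SmoothlyJoined P g h) : SmoothlyJoined P f h := by
  obtain ⟨F, hF, hP, rfl, hFg⟩ := H
  obtain ⟨F', hF', hP', rfl, rfl⟩ := H'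
  let E : ℝ → ι → ℝ → V := fun s => if s ≤ 1 / 2 then F (Real.smoothTransition (3 * s))
    else F' (Real.smoothTransition (3 * s - 2))
  have h1 : ∀ s < 2 / 3, E s = F (Real.smoothTransition (3 * s)) := by
    intro s hs
    by_cases h : s ≤ 1 / 2
    · simp only [E, h, if_true]
    · have h2 : 1 ≤ 3 * s := by linarith
      have h3 : 3 * s - 2 ≤ 0 := by linarith
      simp only [E, h, if_false, Real.smoothTransition.one_of_one_le h2,
        Real.smoothTransition.zero_of_nonpos h3, hFg]
  have h2 : ∀ s, 1 / 3 < s → E s = F' (Real.smoothTransition (3 * s - 2)) := by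
    intro s hs
    by_cases h : s ≤ 1 / 2
    · have h2 : 1 ≤ 3 * s := by linarith
      have h3 : 3 * s - 2 ≤ 0 := by linarith
      simp only [E, h, if_true, Real.smoothTransition.one_of_one_le h2,
        Real.smoothTransition.zero_of_nonpos h3, hFg]
    · simp only [E, h, if_false]
  refine ⟨E, fun i => ?_, fun s => ?_, ?_, ?_⟩
  · rw [contDiff_iff_contDiffAt]
    rintro ⟨s, t⟩
    rcases lt_or_ge s (1 / 2) with hs | hs
    · have hc : ContDiff ℝ ∞ fun p : ℝ × ℝ => F (Real.smoothTransition (3 * p.1)) i p.2 :=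
        (hF i).comp ((contDiff_smoothTransition.comp (contDiff_const.mul contDiff_fst)).prodMk
          contDiff_snd)
      refine hc.contDiffAt.congr_of_eventuallyEq ?_
      have : {p : ℝ × ℝ | p.1 < 2 / 3} ∈ nhds (s, t) :=
        (isOpen_lt continuous_fst continuous_const).mem_nhds (by simp; linarith)
      filter_upwards [this] with p hp
      rw [h1 _ hp]
    · have hc : ContDiff ℝ ∞ fun p : ℝ × ℝ => F' (Real.smoothTransition (3 * p.1 - 2)) i p.2 :=
        (hF' i).comp ((contDiff_smoothTransition.comp
          ((contDiff_const.mul contDiff_fst).sub contDiff_const)).prodMk contDiff_snd)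
      refine hc.contDiffAt.congr_of_eventuallyEq ?_
      have : {p : ℝ × ℝ | 1 / 3 < p.1} ∈ nhds (s, t) :=
        (isOpen_lt continuous_const continuous_fst).mem_nhds (by simp; linarith)
      filter_upwards [this] with p hp
      rw [h2 _ hp]
  · rcases lt_or_ge s (1 / 2) with hs | hs
    · rw [h1 s (by linarith)]; exact hP _
    · rw [h2 s (by linarith)]; exact hP' _
  · rw [h1 0 (by norm_num)]; simp
  · rw [h2 1 (by norm_num)]; norm_num

theorem mono {Q : (ι → ℝ → V) → Prop} (hPQ : ∀ f, P f → Q f) (H : SmoothlyJoined P f g) :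
    SmoothlyJoined Q f g := by
  obtain ⟨F, hF, hP, h0, h1⟩ := H
  exact ⟨F, hF, fun s => hPQ _ (hP s), h0, h1⟩

end SmoothlyJoined

/-- Two parametrized transverse knots joined by a smooth family of parametrized transverse knots. -/
def TransIso (γ γ' : ℝ → ℝ × ℝ × ℝ) : Prop :=
  SmoothlyJoined (ι := Unit) (fun c => IsTransverseParam (c ())) (fun _ => γ) (fun _ => γ')

namespace TransIso

theorem of_Icc (F : ℝ → ℝ → ℝ × ℝ × ℝ) (hF : ContDiff ℝ ∞ fun p : ℝ × ℝ => F p.1 p.2)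
    (hP : ∀ s ∈ Set.Icc (0 : ℝ) 1, IsTransverseParam (F s)) : TransIso (F 0) (F 1) :=
  SmoothlyJoined.of_Icc (P := fun c : Unit → ℝ → ℝ × ℝ × ℝ => IsTransverseParam (c ()))
    (fun s _ => F s) (fun _ => hF) hP

theorem symm {γ γ'} (h : TransIso γ γ') : TransIso γ' γ := SmoothlyJoined.symm h

theorem trans {γ γ' γ''} (h : TransIso γ γ') (h' : TransIso γ' γ'') : TransIso γ γ'' :=
  SmoothlyJoined.trans h h'

theorem transverselyIsotopic {γ γ'} (h : TransIso γ γ') :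
    TransverselyIsotopic (Set.range γ) (Set.range γ') := by
  obtain ⟨F, hF, hP, h0, h1⟩ := h
  refine ⟨fun s => F s (), hF (), fun s _ => hP s, ?_, ?_⟩
  · simp only [h0]
  · simp only [h1]

/-- Transverse knots may be reparametrized by lifts of orientation preserving diffeomorphisms of the
circle: the reparametrization is joined to the identity linearly. -/
theorem comp {γ : ℝ → ℝ × ℝ × ℝ} (h : IsTransverseParam γ) {φ φ' : ℝ → ℝ} (hφ : ContDiff ℝ ∞ φ)
    (hd : ∀ t, HasDerivAt φ (φ' t) t) (hpos : ∀ t, 0 < φ' t) (hper : ∀ t, φ (t + 1) = φ t + 1) :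
    TransIso γ (γ ∘ φ) := by
  have key := of_Icc (fun s t => γ ((1 - s) * t + s * φ t)) ?_ ?_
  · simpa [Function.comp_def] using key
  · refine h.smooth.comp (((contDiff_const.sub contDiff_fst).mul contDiff_snd).add
      (contDiff_fst.mul (hφ.comp contDiff_snd)))
  · rintro s ⟨hs0, hs1⟩
    have hψd : ∀ t, HasDerivAt (fun t => (1 - s) * t + s * φ t) ((1 - s) * 1 + s * φ' t) t := fun t =>
      ((hasDerivAt_id t).const_mul _).add ((hd t).const_mul _)
    have hψpos : ∀ t, 0 < (1 - s) * 1 + s * φ' t := by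
      intro t
      have := hpos t
      rcases eq_or_lt_of_le hs0 with rfl | hs
      · norm_num
      · nlinarith [mul_pos hs this]
    have hmono : StrictMono (fun t => (1 - s) * t + s * φ t) :=
      strictMono_of_deriv_pos fun t => by rw [(hψd t).deriv]; exact hψpos t
    have hper' : ∀ t, (1 - s) * (t + 1) + s * φ (t + 1) = ((1 - s) * t + s * φ t) + 1 := by
      intro t; rw [hper]; ring
    refine ⟨?_, ?_, ?_, ?_⟩
    · exact h.smooth.comp ((contDiff_const.mul contDiff_id).add (contDiff_const.mul hφ))
    · intro t
      simp only
      rw [hper']; exact h.periodic _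
    · -- two parameters with the same image differ by an integer after reparametrization
      have hinj : ∀ x y, x ≤ y → y < x + 1 → γ x = γ y → x = y := by
        intro x y hxy hyx e
        have e1 : γ (Int.fract x) = γ (Int.fract y) := by
          have ha : ∀ z, γ (Int.fract z) = γ z := fun z => by
            have := h.periodic.sub_int_mul_eq ⌊z⌋ (x := z)
            rw [mul_one] at this; exact this
          rw [ha, ha, e]
        have e2 := h.injOn ⟨Int.fract_nonneg x, Int.fract_lt_one x⟩
          ⟨Int.fract_nonneg y, Int.fract_lt_one y⟩ e1
        have e3 : y - x = ((⌊y⌋ - ⌊x⌋ : ℤ) : ℝ) := by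
          unfold Int.fract at e2; push_cast; linarith
        have e4 : ⌊y⌋ - ⌊x⌋ = 0 := by
          have h1 : (-1 : ℝ) < ((⌊y⌋ - ⌊x⌋ : ℤ) : ℝ) := by rw [← e3]; linarith
          have h2 : ((⌊y⌋ - ⌊x⌋ : ℤ) : ℝ) < 1 := by rw [← e3]; linarith
          have h1' : (-1 : ℤ) < ⌊y⌋ - ⌊x⌋ := by exact_mod_cast h1
          have h2' : ⌊y⌋ - ⌊x⌋ < (1 : ℤ) := by exact_mod_cast h2
          omega
        rw [e4] at e3; push_cast at e3; linarith
      have main : ∀ t ∈ Set.Ico (0 : ℝ) 1, ∀ t' ∈ Set.Ico (0 : ℝ) 1, t ≤ t' →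
          γ ((1 - s) * t + s * φ t) = γ ((1 - s) * t' + s * φ t') → t = t' := by
        intro t ht t' ht' htt e
        refine hmono.injective (hinj _ _ (hmono.monotone htt) ?_ e)
        have := hmono (show t' < t + 1 by have := ht.1; have := ht'.2; linarith)
        simp only at this
        rw [hper'] at this; exact this
      intro t ht t' ht' e
      rcases le_total t t' with htt | htt
      · exact main t ht t' ht' htt e
      · exact (main t' ht' t ht htt e.symm).symm
    · intro t
      have hγ : HasDerivAt γ (deriv γ ((1 - s) * t + s * φ t)) ((1 - s) * t + s * φ t) :=
        (h.smooth.differentiable (by simp)).differentiableAt.hasDerivAt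
      have := (HasDerivAt.scomp t hγ (hψd t)).deriv
      simp only [Function.comp_def] at this
      rw [this]
      have h3 := h.transverse ((1 - s) * t + s * φ t)
      have : rotForm (γ ((1 - s) * t + s * φ t))
          (((1 - s) * 1 + s * φ' t) • deriv γ ((1 - s) * t + s * φ t)) =
          ((1 - s) * 1 + s * φ' t) * rotForm (γ ((1 - s) * t + s * φ t))
            (deriv γ ((1 - s) * t + s * φ t)) := by
        simp [rotForm]; ring
      rw [this]
      exact mul_pos (hψpos t) h3

end TransIso

/-! ### Closed braids in one strand and their thin transverse closures -/

/-- A closed braid on `n` strands whose closure is a knot, described by the position `f y` in the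
transverse plane after `y` turns around the axis: the other points of the fibre over the same angle are
`f (y + 1)`, …, `f (y + n - 1)`. -/
structure IsLoop (n : ℕ) (f : ℝ → ℝ × ℝ) : Prop where
  smooth : ContDiff ℝ ∞ f
  periodic : ∀ y, f (y + n) = f y
  ne : ∀ y, ∀ j : ℕ, 0 < j → j < n → f (y + j) ≠ f y

/-- The closed curve in the `ε`-neighbourhood of the unit circle determined by a loop on `n` strands. -/
noncomputable def knotOf (ε : ℝ) (n : ℕ) (f : ℝ → ℝ × ℝ) (t : ℝ) : ℝ × ℝ × ℝ :=
  nearCircle ε (2 * Real.pi * (n * t)) (f (n * t))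

/-- Isotopy of closed braids on `n` strands. -/
def LoopIso (n : ℕ) (f g : ℝ → ℝ × ℝ) : Prop :=
  SmoothlyJoined (ι := Unit) (fun c => IsLoop n (c ())) (fun _ => f) (fun _ => g)

theorem IsLoop.periodic_int {n : ℕ} {f : ℝ → ℝ × ℝ} (h : IsLoop n f) (y : ℝ) (m : ℤ) :
    f (y + m * n) = f y := by
  have h1 : Function.Periodic f (n : ℝ) := h.periodic
  exact h1.int_mul m y

/-- Points of a loop over the same angle are distinct unless they differ by full periods. -/
theorem IsLoop.eq_of_int {n : ℕ} {f : ℝ → ℝ × ℝ} (h : IsLoop n f) {x y : ℝ} {j : ℤ}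
    (hj : y = x + j) (hlt : |y - x| < n) (e : f x = f y) : x = y := by
  rw [abs_lt] at hlt
  rcases lt_trichotomy j 0 with h0 | h0 | h0
  · exfalso
    have h1 : x = y + ((-j).toNat : ℕ) := by
      have : (((-j).toNat : ℕ) : ℝ) = ((-j : ℤ) : ℝ) := by
        exact_mod_cast Int.toNat_of_nonneg (by omega : 0 ≤ -j)
      rw [this, hj]; push_cast; ring
    refine h.ne y (-j).toNat (by omega) ?_ (by rw [← h1, e])
    have : (((-j).toNat : ℕ) : ℝ) < n := by linarith
    exact_mod_cast this
  · rw [hj, h0]; simp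
  · exfalso
    have h1 : y = x + (j.toNat : ℕ) := by
      have : ((j.toNat : ℕ) : ℝ) = (j : ℝ) := by
        exact_mod_cast Int.toNat_of_nonneg h0.le
      rw [this, hj]
    refine h.ne x j.toNat (by omega) ?_ (by rw [← h1, e])
    have : ((j.toNat : ℕ) : ℝ) < n := by linarith
    exact_mod_cast this

theorem nearCircle_inj {ε θ θ' : ℝ} {q q' : ℝ × ℝ} (hε : 0 < ε) (h1 : 0 < 1 + ε * q.1)
    (h2 : 0 < 1 + ε * q'.1) (e : nearCircle ε θ q = nearCircle ε θ' q') :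
    q = q' ∧ ∃ j : ℤ, θ' = θ + 2 * Real.pi * j := by
  simp only [nearCircle, Prod.mk.injEq] at e
  obtain ⟨e1, e2, e3⟩ := e
  have hsq : (1 + ε * q.1) ^ 2 = (1 + ε * q'.1) ^ 2 := by
    have a1 := Real.sin_sq_add_cos_sq θ
    have a2 := Real.sin_sq_add_cos_sq θ'
    calc (1 + ε * q.1) ^ 2 = ((1 + ε * q.1) * Real.cos θ) ^ 2 + ((1 + ε * q.1) * Real.sin θ) ^ 2 := by
          rw [mul_pow, mul_pow, ← mul_add, add_comm (Real.cos θ ^ 2), a1, mul_one]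
      _ = (1 + ε * q'.1) ^ 2 := by
          rw [e1, e2, mul_pow, mul_pow, ← mul_add, add_comm (Real.cos θ' ^ 2), a2, mul_one]
  have hr : 1 + ε * q.1 = 1 + ε * q'.1 := by
    nlinarith [sq_nonneg (1 + ε * q.1 - (1 + ε * q'.1))]
  refine ⟨Prod.ext ?_ (mul_left_cancel₀ hε.ne' e3), ?_⟩
  · have : ε * q.1 = ε * q'.1 := by linarith
    exact mul_left_cancel₀ hε.ne' this
  · rw [← hr] at e1 e2
    have c1 := mul_left_cancel₀ h1.ne' e1
    have s1 := mul_left_cancel₀ h1.ne' e2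
    have : (θ : Real.Angle) = θ' := Real.Angle.cos_sin_inj c1 s1
    rw [Real.Angle.angle_eq_iff_two_pi_dvd_sub] at this
    obtain ⟨k, hk⟩ := this
    exact ⟨-k, by push_cast; linarith⟩

theorem hasDerivAt_nearCircle {ε : ℝ} {θ u v : ℝ → ℝ} {θ' u' v' t : ℝ} (hθ : HasDerivAt θ θ' t)
    (hu : HasDerivAt u u' t) (hv : HasDerivAt v v' t) :
    HasDerivAt (fun t => nearCircle ε (θ t) (u t, v t))
      ((ε * u') * Real.cos (θ t) + (1 + ε * u t) * (-Real.sin (θ t) * θ'),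
        (ε * u') * Real.sin (θ t) + (1 + ε * u t) * (Real.cos (θ t) * θ'), ε * v') t := by
  have h1 : HasDerivAt (fun t => 1 + ε * u t) (ε * u') t := (hu.const_mul ε).const_add 1
  exact (h1.mul hθ.cos).prodMk ((h1.mul hθ.sin).prodMk (hv.const_mul ε))

theorem rotForm_nearCircle (ε θ θ' u v u' v' : ℝ) :
    rotForm (nearCircle ε θ (u, v))
      ((ε * u') * Real.cos θ + (1 + ε * u) * (-Real.sin θ * θ'),
        (ε * u') * Real.sin θ + (1 + ε * u) * (Real.cos θ * θ'), ε * v') =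
      (1 + ε * u) ^ 2 * θ' + ε * v' := by
  have := Real.sin_sq_add_cos_sq θ
  simp only [rotForm, nearCircle]
  linear_combination ((1 + ε * u) ^ 2 * θ') * this

theorem contDiff_nearCircle {E : Type*} [NormedAddCommGroup E] [NormedSpace ℝ E] {ε θ : E → ℝ}
    {q : E → ℝ × ℝ} (hε : ContDiff ℝ ∞ ε) (hθ : ContDiff ℝ ∞ θ) (hq : ContDiff ℝ ∞ q) :
    ContDiff ℝ ∞ fun x => nearCircle (ε x) (θ x) (q x) := by
  have h1 : ContDiff ℝ ∞ fun x => 1 + ε x * (q x).1 := contDiff_const.add (hε.mul hq.fst)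
  exact (h1.mul hθ.cos).prodMk ((h1.mul hθ.sin).prodMk (hε.mul hq.snd))

/-- The curve determined by a loop is a transverse knot as soon as its radial extent and its downward
slope are small enough. -/
theorem IsLoop.isTransverseParam {n : ℕ} (hn : 0 < n) {f : ℝ → ℝ × ℝ} (h : IsLoop n f) {ε : ℝ}
    (hε : 0 < ε) (hr : ∀ y, 0 < 1 + ε * (f y).1)
    (ht : ∀ y, 0 < (1 + ε * (f y).1) ^ 2 * (2 * Real.pi) + ε * (deriv f y).2) :
    IsTransverseParam (knotOf ε n f) := by
  have hn' : (0 : ℝ) < n := by exact_mod_cast hn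
  refine ⟨?_, ?_, ?_, ?_⟩
  · have : ContDiff ℝ ∞ fun t : ℝ => (n : ℝ) * t := contDiff_const.mul contDiff_id
    exact contDiff_nearCircle contDiff_const (contDiff_const.mul this) (h.smooth.comp this)
  · intro t
    have e1 : (n : ℝ) * (t + 1) = n * t + n := by ring
    have e2 : 2 * Real.pi * ((n : ℝ) * (t + 1)) = 2 * Real.pi * (n * t) + n * (2 * Real.pi) := by ring
    simp only [knotOf, nearCircle]
    rw [e2, Real.cos_add_nat_mul_two_pi, Real.sin_add_nat_mul_two_pi, e1, h.periodic]
  · intro t ht t' ht' e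
    obtain ⟨e1, j, hj⟩ := nearCircle_inj hε (hr _) (hr _) e
    have hpi := Real.pi_pos
    have hj' : (n : ℝ) * t' = n * t + j := by
      have : 2 * Real.pi * ((n : ℝ) * t') = 2 * Real.pi * (n * t + j) := by linarith
      exact mul_left_cancel₀ (by positivity) this
    have := h.eq_of_int hj' ?_ e1
    · exact mul_left_cancel₀ hn'.ne' this
    · rw [← mul_sub, abs_mul, abs_of_pos hn']
      have : |t' - t| < 1 := by rw [abs_lt]; constructor <;> linarith [ht.1, ht.2, ht'.1, ht'.2]
      nlinarith
  · intro t
    have hd : HasDerivAt f (deriv f (n * t)) (n * t) :=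
      (h.smooth.differentiable (by simp)).differentiableAt.hasDerivAt
    have hl : HasDerivAt (fun t : ℝ => (n : ℝ) * t) n t := by
      simpa using (hasDerivAt_id t).const_mul (n : ℝ)
    have hq := HasDerivAt.scomp t hd hl
    have hu : HasDerivAt (fun t : ℝ => (f (n * t)).1) (n * (deriv f (n * t)).1) t := by
      exact (ContinuousLinearMap.fst ℝ ℝ ℝ).hasFDerivAt.comp_hasDerivAt t hq
    have hv : HasDerivAt (fun t : ℝ => (f (n * t)).2) (n * (deriv f (n * t)).2) t := by
      exact (ContinuousLinearMap.snd ℝ ℝ ℝ).hasFDerivAt.comp_hasDerivAt t hq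
    have hK := hasDerivAt_nearCircle (ε := ε) (hl.const_mul (2 * Real.pi)) hu hv
    have e : knotOf ε n f = fun t => nearCircle ε (2 * Real.pi * (n * t)) ((f (n * t)).1, (f (n * t)).2) :=
      rfl
    rw [e, hK.deriv, rotForm_nearCircle]
    have := ht (n * t)
    have e3 : (1 + ε * (f (n * t)).1) ^ 2 * (2 * Real.pi * n) + ε * (n * (deriv f (n * t)).2) =
      n * ((1 + ε * (f (n * t)).1) ^ 2 * (2 * Real.pi) + ε * (deriv f (n * t)).2) := by ring
    rw [e3]; positivity

/-- All sufficiently thin closures of two loops are transversely isotopic. -/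
def ThinIso (n : ℕ) (f : ℝ → ℝ × ℝ) (n' : ℕ) (f' : ℝ → ℝ × ℝ) : Prop :=
  ∃ ε₀ : ℝ, 0 < ε₀ ∧ ∀ ε ε' : ℝ, 0 < ε → ε < ε₀ → 0 < ε' → ε' < ε₀ →
    TransIso (knotOf ε n f) (knotOf ε' n' f')

namespace ThinIso

theorem symm {n n' f f'} (h : ThinIso n f n' f') : ThinIso n' f' n f := by
  obtain ⟨ε₀, h0, H⟩ := h
  exact ⟨ε₀, h0, fun ε ε' a b c d => (H ε' ε c d a b).symm⟩

theorem trans {n n' n'' f f' f''} (h : ThinIso n f n' f') (h' : ThinIso n' f' n'' f'') :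
    ThinIso n f n'' f'' := by
  obtain ⟨ε₀, h0, H⟩ := h
  obtain ⟨ε₁, h1, H'⟩ := h'
  have hm : 0 < min ε₀ ε₁ := lt_min h0 h1
  refine ⟨min ε₀ ε₁, hm, fun ε ε' a b c d => ?_⟩
  have h2 : min ε₀ ε₁ / 2 < min ε₀ ε₁ := by linarith
  exact (H ε (min ε₀ ε₁ / 2) a (b.trans_le (min_le_left _ _)) (by linarith)
    (h2.trans_le (min_le_left _ _))).trans
    (H' _ ε' (by linarith) (h2.trans_le (min_le_right _ _)) c (d.trans_le (min_le_right _ _)))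

/-- A smooth family of loops has uniformly bounded radial extent and slope, so that thin closures of
its members are transverse. -/
theorem of_loopIso {n : ℕ} (hn : 0 < n) {f g : ℝ → ℝ × ℝ} (h : LoopIso n f g) : ThinIso n f n g := by
  obtain ⟨F, hF, hP, h0, h1⟩ := h
  replace hF := hF ()
  have hn' : (0 : ℝ) < n := by exact_mod_cast hn
  have hslice : ∀ s y, HasDerivAt (F s ())
      (fderiv ℝ (fun p : ℝ × ℝ => F p.1 () p.2) (s, y) (0, 1)) y := by
    intro s y
    have a : HasFDerivAt (fun p : ℝ × ℝ => F p.1 () p.2) _ (s, y) :=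
      (hF.differentiable (by simp)).differentiableAt.hasFDerivAt
    have b : HasDerivAt (fun y : ℝ => (s, y)) ((0, 1) : ℝ × ℝ) y :=
      (hasDerivAt_const y s).prodMk (hasDerivAt_id y)
    exact a.comp_hasDerivAt y b
  have hcont : Continuous fun p : ℝ × ℝ => fderiv ℝ (fun p : ℝ × ℝ => F p.1 () p.2) p (0, 1) :=
    (hF.continuous_fderiv (by simp)).clm_apply continuous_const
  have hK : IsCompact (Set.Icc (0 : ℝ) 1 ×ˢ Set.Icc (0 : ℝ) n) := isCompact_Icc.prod isCompact_Icc
  obtain ⟨M₁, hM₁⟩ := hK.exists_bound_of_continuousOn hF.continuous.continuousOn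
  obtain ⟨M₂, hM₂⟩ := hK.exists_bound_of_continuousOn hcont.continuousOn
  set M := max 1 (max M₁ M₂) with hM
  have hMpos : 1 ≤ M := le_max_left _ _
  have hred : ∀ y : ℝ, ∃ m : ℤ, y + m * n ∈ Set.Icc (0 : ℝ) n := by
    intro y
    refine ⟨-⌊y / n⌋, ?_⟩
    have a := Int.floor_le (y / n)
    have b := Int.lt_floor_add_one (y / n)
    rw [le_div_iff₀ hn'] at a
    rw [div_lt_iff₀ hn'] at b
    push_cast
    constructor <;> nlinarith
  have hb₁ : ∀ s ∈ Set.Icc (0 : ℝ) 1, ∀ y, |(F s () y).1| ≤ M := by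
    intro s hs y
    obtain ⟨m, hm⟩ := hred y
    rw [← (hP s).periodic_int y m]
    have := hM₁ (s, y + m * n) ⟨hs, hm⟩
    exact ((norm_fst_le _).trans this).trans ((le_max_left _ _).trans (le_max_right _ _))
  have hb₂ : ∀ s ∈ Set.Icc (0 : ℝ) 1, ∀ y, |(deriv (F s ()) y).2| ≤ M := by
    intro s hs y
    obtain ⟨m, hm⟩ := hred y
    have e : deriv (F s ()) y = deriv (F s ()) (y + m * n) := by
      have : F s () = fun y => F s () (y + m * n) := funext fun y => ((hP s).periodic_int y m).symm
      conv_lhs => rw [this]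
      exact deriv_comp_add_const (F s ()) (m * n) y
    rw [e, (hslice s _).deriv]
    have := hM₂ (s, y + m * n) ⟨hs, hm⟩
    exact ((norm_snd_le _).trans this).trans ((le_max_right _ _).trans (le_max_right _ _))
  have hgood : ∀ s ∈ Set.Icc (0 : ℝ) 1, ∀ ε, 0 < ε → ε < 1 / (2 * M) →
      IsTransverseParam (knotOf ε n (F s ())) := by
    intro s hs ε hε hεM
    rw [lt_div_iff₀ (by positivity)] at hεM
    have hu : ∀ y, 1 / 2 < 1 + ε * (F s () y).1 := by
      intro y
      have := (abs_le.1 (hb₁ s hs y)).1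
      nlinarith
    refine (hP s).isTransverseParam hn hε (fun y => by linarith [hu y]) fun y => ?_
    have h1 := hu y
    have h2 := (abs_le.1 (hb₂ s hs y)).1
    have h3 : (1 / 4 : ℝ) < (1 + ε * (F s () y).1) ^ 2 := by nlinarith
    have h4 : -(1 / 2) ≤ ε * (deriv (F s ()) y).2 := by nlinarith
    nlinarith [Real.pi_gt_three]
  refine ⟨1 / (2 * M), by positivity, fun ε ε' a b c d => ?_⟩
  have key := TransIso.of_Icc (fun s => knotOf ((1 - s) * ε + s * ε') n (F s ())) ?_ ?_
  · simp only [sub_zero, one_mul, zero_mul, add_zero, sub_self, zero_add, h0, h1] at key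
    exact key
  · have e : ContDiff ℝ ∞ fun p : ℝ × ℝ => (n : ℝ) * p.2 := contDiff_const.mul contDiff_snd
    refine contDiff_nearCircle ?_ (contDiff_const.mul e) (hF.comp (contDiff_fst.prodMk e))
    exact ((contDiff_const.sub contDiff_fst).mul contDiff_const).add (contDiff_fst.mul contDiff_const)
  · rintro s ⟨hs0, hs1⟩
    refine hgood s ⟨hs0, hs1⟩ _ ?_ ?_
    · rcases eq_or_lt_of_le hs0 with rfl | hs
      · simpa using a
      · have := mul_pos hs c; nlinarith [mul_nonneg (sub_nonneg.2 hs1) a.le]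
    · rcases eq_or_lt_of_le hs0 with rfl | hs
      · simpa using b
      · nlinarith [mul_lt_mul_of_pos_left d hs, mul_le_mul_of_nonneg_left b.le (sub_nonneg.2 hs1)]

end ThinIso

namespace LoopIso

theorem refl {n f} (h : IsLoop n f) : LoopIso n f f := SmoothlyJoined.refl (fun _ => h.smooth) h

/-- Shifting the parameter of a loop amounts to rotating the closed braid about its axis. -/
theorem shift {n f} (h : IsLoop n f) (c : ℝ) : LoopIso n f (fun y => f (y + c)) := by
  refine ⟨fun s _ y => f (y + s * c), fun _ => ?_, fun s => ⟨?_, ?_, ?_⟩, ?_, ?_⟩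
  · exact h.smooth.comp (contDiff_snd.add (contDiff_fst.mul contDiff_const))
  · exact h.smooth.comp (contDiff_id.add contDiff_const)
  · intro y
    simp only
    rw [add_right_comm, h.periodic]
  · intro y j hj hjn
    simp only
    rw [add_right_comm]; exact h.ne _ j hj hjn
  · simp
  · simp

end LoopIso

/-! ### Geometric braids and their closures -/

/-- A geometric braid with strands numbered by `ℕ`: strand `k` starts at `(0, k)`, where it rests up to
time `0`, and comes to rest at `(0, π k)` by time `T`. -/
structure IsArc (T : ℝ) (π : Equiv.Perm ℕ) (β : ℕ → ℝ → ℝ × ℝ) : Prop where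
  smooth : ∀ k, ContDiff ℝ ∞ (β k)
  start : ∀ k y, y ≤ 0 → β k y = (0, (k : ℝ))
  finish : ∀ k y, T ≤ y → β k y = (0, (π k : ℝ))
  inj : ∀ y k l, β k y = β l y → k = l

theorem IsArc.mono {T T' : ℝ} {π : Equiv.Perm ℕ} {β : ℕ → ℝ → ℝ × ℝ} (h : IsArc T π β) (hT : T ≤ T') :
    IsArc T' π β :=
  ⟨h.smooth, h.start, fun k y hy => h.finish k y (hT.trans hy), h.inj⟩

/-- Isotopy of geometric braids with fixed ends; the duration is not recorded. -/
def ArcIso (π : Equiv.Perm ℕ) (β β' : ℕ → ℝ → ℝ × ℝ) : Prop :=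
  ∃ T : ℝ, 0 ≤ T ∧ SmoothlyJoined (IsArc T π) β β'

namespace ArcIso

theorem refl {T π β} (hT : 0 ≤ T) (h : IsArc T π β) : ArcIso π β β :=
  ⟨T, hT, SmoothlyJoined.refl h.smooth h⟩

theorem symm {π β β'} (h : ArcIso π β β') : ArcIso π β' β := by
  obtain ⟨T, hT, H⟩ := h
  exact ⟨T, hT, H.symm⟩

theorem trans {π β β' β''} (h : ArcIso π β β') (h' : ArcIso π β' β'') : ArcIso π β β'' := by
  obtain ⟨T, hT, H⟩ := h
  obtain ⟨T', hT', H'⟩ := h'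
  exact ⟨max T T', hT.trans (le_max_left _ _), (H.mono fun f hf => hf.mono (le_max_left _ _)).trans
    (H'.mono fun f hf => hf.mono (le_max_right _ _))⟩

end ArcIso

/-- The strand starting at `k` is closed up after exactly `n` turns. -/
def ClosesAfter (n : ℕ) (π : Equiv.Perm ℕ) (k : ℕ) : Prop :=
  0 < n ∧ (π ^ n) k = k ∧ ∀ j, 0 < j → j < n → (π ^ j) k ≠ k

/-- The loop obtained by following strand `k` of the closure of the geometric braid `β`, one turn
having length `P`. -/
noncomputable def loopOf (π : Equiv.Perm ℕ) (P : ℝ) (β : ℕ → ℝ → ℝ × ℝ) (k : ℕ) (y : ℝ) : ℝ × ℝ :=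
  β ((π ^ ⌊y⌋) k) (P * Int.fract y)

/-- On the `j`-th turn, and also on the final idle part of the turn before it, the loop follows the
strand `π ^ j k`. -/
theorem IsArc.loopOf_eq {T P : ℝ} {π : Equiv.Perm ℕ} {β : ℕ → ℝ → ℝ × ℝ} (h : IsArc T π β) (hP : 0 < P)
    (hTP : T ≤ P) (k : ℕ) (j : ℤ) {y : ℝ} (h1 : (j : ℝ) - 1 ≤ y) (h2 : T - P ≤ P * (y - j))
    (h3 : y ≤ j + 1) : loopOf π P β k y = β ((π ^ j) k) (P * (y - j)) := by
  unfold loopOf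
  rcases lt_or_ge y j with hy | hy
  · have hf : ⌊y⌋ = j - 1 := by
      rw [Int.floor_eq_iff]; push_cast; constructor <;> linarith
    have hfr : Int.fract y = y - j + 1 := by
      unfold Int.fract; rw [hf]; push_cast; ring
    rw [hf, hfr, h.finish _ _ (by nlinarith), h.start _ (P * (y - j)) (by nlinarith)]
    congr 2
    rw [← Equiv.Perm.mul_apply, ← zpow_one_add]
    congr 2; ring
  rcases eq_or_lt_of_le h3 with hy' | hy'
  · have hf : ⌊y⌋ = j + 1 := by
      rw [Int.floor_eq_iff]; push_cast; constructor <;> linarith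
    have hfr : Int.fract y = 0 := by
      unfold Int.fract; rw [hf]; push_cast; linarith
    rw [hf, hfr, mul_zero, h.start _ _ le_rfl, h.finish _ (P * (y - j)) (by nlinarith)]
    congr 2
    rw [← Equiv.Perm.mul_apply, ← zpow_one_add]
    congr 2; ring
  · have hf : ⌊y⌋ = j := by
      rw [Int.floor_eq_iff]; constructor <;> linarith
    have hfr : Int.fract y = y - j := by
      unfold Int.fract; rw [hf]
    rw [hf, hfr]

theorem contDiff_loopOf {T : ℝ} (hT : 0 ≤ T) {π : Equiv.Perm ℕ} {F : ℝ → ℕ → ℝ → ℝ × ℝ}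
    (hF : ∀ k, ContDiff ℝ ∞ fun p : ℝ × ℝ => F p.1 k p.2) (hA : ∀ s, IsArc T π (F s)) {P : ℝ → ℝ}
    (hP : ContDiff ℝ ∞ P) (hTP : ∀ s, T < P s) (k : ℕ) :
    ContDiff ℝ ∞ fun p : ℝ × ℝ => loopOf π (P p.1) (F p.1) k p.2 := by
  rw [contDiff_iff_contDiffAt]
  rintro ⟨s, y⟩
  have hc : ContDiff ℝ ∞ fun p : ℝ × ℝ => F p.1 ((π ^ ⌊y⌋) k) (P p.1 * (p.2 - ⌊y⌋)) :=
    (hF _).comp (contDiff_fst.prodMk ((hP.comp contDiff_fst).mul (contDiff_snd.sub contDiff_const)))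
  refine hc.contDiffAt.congr_of_eventuallyEq ?_
  have hPc : Continuous fun p : ℝ × ℝ => P p.1 := hP.continuous.comp continuous_fst
  have h1 : {p : ℝ × ℝ | T - P p.1 < P p.1 * (p.2 - ⌊y⌋)} ∈ nhds (s, y) := by
    refine (isOpen_lt (continuous_const.sub hPc)
      (hPc.mul (continuous_snd.sub continuous_const))).mem_nhds ?_
    have := hTP s
    have := mul_nonneg (hT.trans this.le) (sub_nonneg.2 (Int.floor_le y))
    show T - P s < P s * (y - ⌊y⌋)
    linarith
  have h2 : {p : ℝ × ℝ | p.2 < ⌊y⌋ + 1} ∈ nhds (s, y) :=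
    (isOpen_lt continuous_snd continuous_const).mem_nhds (Int.lt_floor_add_one y)
  filter_upwards [h1, h2] with p hp1 hp2
  have hP0 : 0 < P p.1 := hT.trans_lt (hTP _)
  replace hp1 : T - P p.1 < P p.1 * (p.2 - ⌊y⌋) := hp1
  refine (hA p.1).loopOf_eq hP0 (hTP _).le k ⌊y⌋ ?_ hp1.le hp2.le
  nlinarith

theorem IsArc.isLoop {T P : ℝ} {π : Equiv.Perm ℕ} {β : ℕ → ℝ → ℝ × ℝ} (h : IsArc T π β) (hT : 0 ≤ T)
    (hTP : T < P) {n k : ℕ} (hk : ClosesAfter n π k) : IsLoop n (loopOf π P β k) := by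
  refine ⟨?_, fun y => ?_, fun y j hj hjn e => ?_⟩
  · have := contDiff_loopOf (F := fun _ => β) hT (fun k => (h.smooth k).comp contDiff_snd) (fun _ => h)
      (P := fun _ => P) contDiff_const (fun _ => hTP) k
    exact this.comp (contDiff_const.prodMk contDiff_id : ContDiff ℝ ∞ fun y : ℝ => ((0 : ℝ), y))
  · unfold loopOf
    rw [Int.floor_add_natCast, Int.fract_add_natCast, zpow_add, zpow_natCast, Equiv.Perm.mul_apply,
      hk.2.1]
  · unfold loopOf at e
    rw [Int.floor_add_natCast, Int.fract_add_natCast] at e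
    have := h.inj _ _ _ e
    rw [zpow_add, zpow_natCast, Equiv.Perm.mul_apply] at this
    exact hk.2.2 j hj hjn ((π ^ ⌊y⌋).injective this)

theorem loopIso_of_arcIso {T P : ℝ} (hT : 0 ≤ T) (hTP : T < P) {π : Equiv.Perm ℕ}
    {β β' : ℕ → ℝ → ℝ × ℝ} (h : SmoothlyJoined (IsArc T π) β β') {n k : ℕ} (hk : ClosesAfter n π k) :
    LoopIso n (loopOf π P β k) (loopOf π P β' k) := by
  obtain ⟨F, hF, hA, h0, h1⟩ := h
  refine ⟨fun s _ => loopOf π P (F s) k, fun _ => ?_, fun s => (hA s).isLoop hT hTP hk, ?_, ?_⟩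
  · exact contDiff_loopOf hT hF hA (P := fun _ => P) contDiff_const (fun _ => hTP) k
  · simp only [h0]
  · simp only [h1]

theorem IsArc.loopIso_turn {T P P' : ℝ} (hT : 0 ≤ T) (hTP : T < P) (hTP' : T < P')
    {π : Equiv.Perm ℕ} {β : ℕ → ℝ → ℝ × ℝ} (h : IsArc T π β) {n k : ℕ} (hk : ClosesAfter n π k) :
    LoopIso n (loopOf π P β k) (loopOf π P' β k) := by
  have hQ : ∀ s, T < (1 - Real.smoothTransition s) * P + Real.smoothTransition s * P' := by
    intro s
    have h0 := Real.smoothTransition.nonneg s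
    have h1 := Real.smoothTransition.le_one s
    rcases eq_or_lt_of_le h0 with h | h
    · rw [← h]; linarith
    · nlinarith [mul_lt_mul_of_pos_left hTP' h, mul_le_mul_of_nonneg_left hTP.le (sub_nonneg.2 h1)]
  refine ⟨fun s _ => loopOf π ((1 - Real.smoothTransition s) * P + Real.smoothTransition s * P') β k,
    fun _ => ?_, fun s => h.isLoop hT (hQ s) hk, ?_, ?_⟩
  · refine contDiff_loopOf hT (F := fun _ => β) (fun k => (h.smooth k).comp contDiff_snd) (fun _ => h)
      (P := fun s => (1 - Real.smoothTransition s) * P + Real.smoothTransition s * P') ?_ hQ k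
    exact ((contDiff_const.sub SmoothlyJoined.contDiff_smoothTransition).mul contDiff_const).add
      (SmoothlyJoined.contDiff_smoothTransition.mul contDiff_const)
  · simp
  · simp

/-- Isotopic geometric braids have isotopic closures, whatever the lengths of the turns. -/
theorem thinIso_of_arcIso {T T' P P' : ℝ} (hT : 0 ≤ T) (hT' : 0 ≤ T') (hTP : T < P) (hTP' : T' < P')
    {π : Equiv.Perm ℕ} {β β' : ℕ → ℝ → ℝ × ℝ} (hβ : IsArc T π β) (hβ' : IsArc T' π β')
    (h : ArcIso π β β') {n k : ℕ} (hk : ClosesAfter n π k) :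
    ThinIso n (loopOf π P β k) n (loopOf π P' β' k) := by
  obtain ⟨S, hS, H⟩ := h
  have a := hβ.mono (le_max_left T S)
  have a' := hβ'.mono (le_max_left T' S)
  set Q := max (max T T') S + 1 with hQ
  have q1 : T < Q := lt_of_le_of_lt ((le_max_left T T').trans (le_max_left _ S)) (lt_add_one _)
  have q2 : T' < Q := lt_of_le_of_lt ((le_max_right T T').trans (le_max_left _ S)) (lt_add_one _)
  have q3 : S < Q := lt_of_le_of_lt (le_max_right _ S) (lt_add_one _)
  exact ((ThinIso.of_loopIso hk.1 (hβ.loopIso_turn hT hTP q1 hk)).trans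
    (ThinIso.of_loopIso hk.1 (loopIso_of_arcIso hS q3 H hk))).trans
    (ThinIso.of_loopIso hk.1 (hβ'.loopIso_turn hT' q2 hTP' hk))

theorem loopOf_apply_pow (π : Equiv.Perm ℕ) (P : ℝ) (β : ℕ → ℝ → ℝ × ℝ) (k j : ℕ) (y : ℝ) :
    loopOf π P β ((π ^ j) k) y = loopOf π P β k (y + j) := by
  unfold loopOf
  rw [Int.floor_add_natCast, Int.fract_add_natCast, zpow_add, Equiv.Perm.mul_apply, zpow_natCast]

/-- First the geometric braid `α`, with permutation `π`, then from time `T` on the geometric braid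
`β`. As both are at rest outside their durations, the displacements may be added. -/
noncomputable def arcConcat (T : ℝ) (π : Equiv.Perm ℕ) (α β : ℕ → ℝ → ℝ × ℝ) (k : ℕ) (y : ℝ) : ℝ × ℝ :=
  α k y + (β (π k) (y - T) - (0, (π k : ℝ)))

section Concat

variable {Tα Tβ T : ℝ} {π ρ : Equiv.Perm ℕ} {α β : ℕ → ℝ → ℝ × ℝ}

theorem arcConcat_of_le (hβ : IsArc Tβ ρ β) (k : ℕ) {y : ℝ} (hy : y ≤ T) :
    arcConcat T π α β k y = α k y := by
  unfold arcConcat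
  rw [hβ.start _ _ (by linarith), sub_self, add_zero]

theorem arcConcat_of_ge (hα : IsArc Tα π α) (k : ℕ) {y : ℝ} (hy : Tα ≤ y) :
    arcConcat T π α β k y = β (π k) (y - T) := by
  unfold arcConcat
  rw [hα.finish _ _ hy, add_sub_cancel]

theorem IsArc.concat (hα : IsArc Tα π α) (hβ : IsArc Tβ ρ β) (h0 : 0 ≤ T) (hT : Tα ≤ T) (hTβ : 0 ≤ Tβ) :
    IsArc (T + Tβ) (ρ * π) (arcConcat T π α β) := by
  refine ⟨fun k => ?_, fun k y hy => ?_, fun k y hy => ?_, fun y k l e => ?_⟩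
  · exact (hα.smooth k).add (((hβ.smooth _).comp (contDiff_id.sub contDiff_const)).sub contDiff_const)
  · rw [arcConcat_of_le hβ k (by linarith), hα.start k y hy]
  · rw [arcConcat_of_ge hα k (by linarith), hβ.finish _ _ (by linarith), Equiv.Perm.mul_apply]
  · rcases le_total y T with hy | hy
    · rw [arcConcat_of_le hβ k hy, arcConcat_of_le hβ l hy] at e
      exact hα.inj _ _ _ e
    · rw [arcConcat_of_ge hα k (hT.trans hy), arcConcat_of_ge hα l (hT.trans hy)] at e
      exact π.injective (hβ.inj _ _ _ e)

theorem ArcIso.concat {α' β' : ℕ → ℝ → ℝ × ℝ} (h : ArcIso π α α') (h' : ArcIso ρ β β')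
    {T' : ℝ} {Tα' Tβ' : ℝ} (hT : 0 ≤ T) (hT' : 0 ≤ T') (hTβ : 0 ≤ Tβ) (hTβ' : 0 ≤ Tβ')
    (hα : IsArc Tα π α) (hβ : IsArc Tβ ρ β) (hα' : IsArc Tα' π α') (hβ' : IsArc Tβ' ρ β')
    (h1 : Tα ≤ T) (h2 : Tα' ≤ T') :
    ArcIso (ρ * π) (arcConcat T π α β) (arcConcat T' π α' β') := by
  obtain ⟨S, hS, F, hF, hFA, rfl, rfl⟩ := h
  obtain ⟨R, hR, G, hG, hGA, rfl, rfl⟩ := h'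
  -- delaying the second braid is an isotopy
  have delay : ∀ {α β : ℕ → ℝ → ℝ × ℝ} {Tα Tβ T T' : ℝ}, IsArc Tα π α → IsArc Tβ ρ β → 0 ≤ T → Tα ≤ T →
      T ≤ T' → 0 ≤ Tβ → ArcIso (ρ * π) (arcConcat T π α β) (arcConcat T' π α β) := by
    intro α β Tα Tβ T T' hα hβ h0 hT hTT hTβ
    refine ⟨T' + Tβ, by linarith, ?_⟩
    have key := SmoothlyJoined.of_Icc (P := IsArc (T' + Tβ) (ρ * π))
      (fun s => arcConcat ((1 - s) * T + s * T') π α β) ?_ ?_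
    · simpa using key
    · intro k
      have : ContDiff ℝ ∞ fun p : ℝ × ℝ => p.2 - ((1 - p.1) * T + p.1 * T') :=
        contDiff_snd.sub (((contDiff_const.sub contDiff_fst).mul contDiff_const).add
          (contDiff_fst.mul contDiff_const))
      exact ((hα.smooth k).comp contDiff_snd).add (((hβ.smooth _).comp this).sub contDiff_const)
    · rintro s ⟨hs0, hs1⟩
      have h3 : T ≤ (1 - s) * T + s * T' := by nlinarith
      have h4 : (1 - s) * T + s * T' ≤ T' := by nlinarith
      exact (hα.concat hβ (h0.trans h3) (hT.trans h3) hTβ).mono (by linarith)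
  set M := max (max T T') S with hM
  have m1 : T ≤ M := (le_max_left _ _).trans (le_max_left _ _)
  have m2 : T' ≤ M := (le_max_right _ _).trans (le_max_left _ _)
  have m3 : S ≤ M := le_max_right _ _
  have mid : ArcIso (ρ * π) (arcConcat M π (F 0) (G 0)) (arcConcat M π (F 1) (G 1)) := by
    refine ⟨M + R, by linarith, fun s => arcConcat M π (F s) (G s), fun k => ?_, fun s => ?_, rfl, rfl⟩
    · exact (hF k).add (((hG _).comp (contDiff_fst.prodMk (contDiff_snd.sub contDiff_const))).sub
        contDiff_const)
    · exact (hFA s).concat (hGA s) (by linarith) m3 hR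
  exact ((delay hα hβ hT h1 m1 hTβ).trans mid).trans (delay hα' hβ' hT' h2 m2 hTβ').symm

/-- The closures of `α β` and `β α` differ by a rotation about the axis. -/
theorem loopOf_concat_comm {T' : ℝ} (hα : IsArc Tα π α) (hβ : IsArc Tβ ρ β) (hTα : 0 ≤ Tα)
    (hTβ : 0 ≤ Tβ) (h1 : Tα < T) (h2 : Tβ < T') (k : ℕ) (y : ℝ) :
    loopOf (π * ρ) (T + T') (arcConcat T' ρ β α) (π k) y =
      loopOf (ρ * π) (T + T') (arcConcat T π α β) k (y + T / (T + T')) := by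
  have hP : 0 < T + T' := by linarith
  have A := hα.concat hβ (T := T) (by linarith) h1.le hTβ
  have B := hβ.concat hα (T := T') (by linarith) h2.le hTα
  have hfl := Int.floor_le y
  have hlt := Int.lt_floor_add_one y
  have hdiv : (T + T') * (T / (T + T')) = T := by field_simp
  have hd0 : 0 < T / (T + T') := by apply div_pos <;> linarith
  have hd1 : T / (T + T') < 1 := by rw [div_lt_one hP]; linarith
  have hmul : 0 ≤ (T + T') * (y - ⌊y⌋) := mul_nonneg hP.le (by linarith)
  have hmul' : (T + T') * (y - ⌊y⌋) < (T + T') * 1 := mul_lt_mul_of_pos_left (by linarith) hP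
  have hperm : ∀ j : ℤ, ((π * ρ) ^ j) (π k) = π (((ρ * π) ^ j) k) := by
    intro j
    have : (π * ρ) ^ j * π = π * (ρ * π) ^ j := by
      have e : π * ρ = π * (ρ * π) * π⁻¹ := by group
      rw [e, conj_zpow]; group
    exact congrArg (fun σ : Equiv.Perm ℕ => σ k) this
  rw [B.loopOf_eq hP (by linarith) (π k) ⌊y⌋ (by linarith) (by linarith) hlt.le, hperm]
  rcases le_total ((T + T') * (y - ⌊y⌋)) T' with hy | hy
  · have e1 : (T + T') * (y + T / (T + T') - ⌊y⌋) = (T + T') * (y - ⌊y⌋) + T := by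
      rw [add_sub_right_comm, mul_add, hdiv]
    rw [A.loopOf_eq hP (by linarith) k ⌊y⌋ (by linarith) (by rw [e1]; linarith) ?_, e1,
      arcConcat_of_le hα _ hy, arcConcat_of_ge hα _ (by linarith), add_sub_cancel_right]
    have : (T + T') * (y + T / (T + T') - ⌊y⌋) ≤ (T + T') * 1 := by rw [e1]; linarith
    have := le_of_mul_le_mul_left this hP
    linarith
  · have e1 : (T + T') * (y + T / (T + T') - (⌊y⌋ + 1 : ℤ)) = (T + T') * (y - ⌊y⌋) - T' := by
      push_cast
      have : y + T / (T + T') - (⌊y⌋ + 1) = (y - ⌊y⌋) + T / (T + T') - 1 := by ring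
      rw [this, mul_sub, mul_add, hdiv]; ring
    rw [A.loopOf_eq hP (by linarith) k (⌊y⌋ + 1) (by push_cast; linarith) (by rw [e1]; linarith)
      (by push_cast; linarith), e1, arcConcat_of_ge hβ _ (by linarith),
      arcConcat_of_le hβ _ (by linarith), zpow_add_one, ← Equiv.Perm.mul_apply, ← Equiv.Perm.mul_apply,
      ← zpow_one_add, ← zpow_add_one, add_comm]

end Concat

/-! ### Braid words as geometric braids -/

/-- The configuration in which the points `i` and `i + 1` have been turned by the angle `φ` about their
midpoint. -/
noncomputable def turnedPoint (i : ℕ) (φ : ℝ) (k : ℕ) : ℝ × ℝ :=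
  if k = i then (-(Real.sin φ / 2), i + 1 / 2 - Real.cos φ / 2)
  else if k = i + 1 then (Real.sin φ / 2, i + 1 / 2 + Real.cos φ / 2)
  else (0, k)

theorem turnedPoint_zero (i k : ℕ) : turnedPoint i 0 k = (0, (k : ℝ)) := by
  unfold turnedPoint
  split_ifs with h1 h2
  · simp [h1]
  · simp [h2]; ring
  · rfl

/-- Points at equal height are the two points that are turned. -/
theorem turnedPoint_tie {i : ℕ} {φ : ℝ} {k l : ℕ} (hkl : k ≠ l)
    (h : (turnedPoint i φ k).2 = (turnedPoint i φ l).2) :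
    (k = i ∧ l = i + 1 ∨ k = i + 1 ∧ l = i) ∧ Real.cos φ = 0 := by
  have c1 := Real.neg_one_le_cos φ
  have c2 := Real.cos_le_one φ
  have main : ∀ k l : ℕ, k ≠ l → (k = i ∨ k = i + 1) →
      (turnedPoint i φ k).2 = (turnedPoint i φ l).2 →
      (k = i ∧ l = i + 1 ∨ k = i + 1 ∧ l = i) ∧ Real.cos φ = 0 := by
    intro k l hkl hk h
    have hl : l = i ∨ l = i + 1 := by
      by_contra! hl
      have hl2 : (turnedPoint i φ l).2 = l := by simp [turnedPoint, hl]
      have hk2 : (i : ℝ) ≤ (turnedPoint i φ k).2 ∧ (turnedPoint i φ k).2 ≤ i + 1 := by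
        rcases hk with rfl | rfl
        · simp only [turnedPoint, if_true]; constructor <;> linarith
        · simp only [turnedPoint, Nat.succ_ne_self, if_false, if_true]; constructor <;> linarith
      rw [h, hl2] at hk2
      have h1 : i ≤ l := by exact_mod_cast hk2.1
      have h2 : l ≤ i + 1 := by exact_mod_cast hk2.2
      omega
    rcases hk with rfl | rfl <;> rcases hl with rfl | rfl
    · exact absurd rfl hkl
    · simp [turnedPoint] at h
      exact ⟨Or.inl ⟨rfl, rfl⟩, by linarith⟩
    · simp [turnedPoint] at h
      exact ⟨Or.inr ⟨rfl, rfl⟩, by linarith⟩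
    · exact absurd rfl hkl
  by_cases hk : k = i ∨ k = i + 1
  · exact main k l hkl hk h
  by_cases hl : l = i ∨ l = i + 1
  · have := main l k hkl.symm hl h.symm
    tauto
  · exfalso
    push Not at hk hl
    simp [turnedPoint, hk, hl] at h
    exact hkl h

theorem turnedPoint_inj {i : ℕ} {φ : ℝ} {k l : ℕ} (h : turnedPoint i φ k = turnedPoint i φ l) : k = l := by
  by_contra hkl
  obtain ⟨h1, h2⟩ := turnedPoint_tie hkl (congrArg Prod.snd h)
  have h3 := congrArg Prod.fst h
  have h4 := Real.sin_sq_add_cos_sq φ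
  rcases h1 with ⟨rfl, rfl⟩ | ⟨rfl, rfl⟩ <;> simp [turnedPoint] at h3 <;>
    · have : Real.sin φ = 0 := by linarith
      rw [this, h2] at h4; norm_num at h4

theorem contDiff_turnedPoint {E : Type*} [NormedAddCommGroup E] [NormedSpace ℝ E] (i k : ℕ) {φ : E → ℝ}
    (hφ : ContDiff ℝ ∞ φ) : ContDiff ℝ ∞ fun x => turnedPoint i (φ x) k := by
  unfold turnedPoint
  split_ifs
  · exact (hφ.sin.div_const _).neg.prodMk (contDiff_const.sub (hφ.cos.div_const _))
  · exact (hφ.sin.div_const _).prodMk (contDiff_const.add (hφ.cos.div_const _))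
  · exact contDiff_const

theorem letterPath_some (i : ℕ) (s : Bool) (k : ℕ) (y : ℝ) :
    letterPath (some (i, s)) k y =
      turnedPoint i ((if s then 1 else -1) * (Real.pi * Real.smoothTransition y)) k := by
  unfold letterPath turnedPoint
  cases s <;> simp

theorem turnedPoint_pi (i k : ℕ) (s : Bool) :
    turnedPoint i ((if s then 1 else -1) * Real.pi) k = (0, (Equiv.swap i (i + 1) k : ℝ)) := by
  unfold turnedPoint
  rw [Equiv.swap_apply_def]
  split_ifs with h1 h2 <;> simp <;> ring

theorem isArc_letterPath (l : ℕ × Bool) :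
    IsArc 1 (Equiv.swap l.1 (l.1 + 1)) (letterPath (some l)) := by
  obtain ⟨i, s⟩ := l
  refine ⟨fun k => ?_, fun k y hy => ?_, fun k y hy => ?_, fun y k l e => ?_⟩
  · rw [funext (letterPath_some i s k)]
    exact contDiff_turnedPoint i k
      (contDiff_const.mul (contDiff_const.mul SmoothlyJoined.contDiff_smoothTransition))
  · rw [letterPath_some, Real.smoothTransition.zero_of_nonpos hy, mul_zero, mul_zero, turnedPoint_zero]
  · rw [letterPath_some, Real.smoothTransition.one_of_one_le hy, mul_one, turnedPoint_pi]
  · rw [letterPath_some, letterPath_some] at e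
    exact turnedPoint_inj e

/-- The permutation of a braid word, taking the initial to the final positions of the strands. -/
def wordPerm : List (ℕ × Bool) → Equiv.Perm ℕ
  | [] => 1
  | l :: w => wordPerm w * Equiv.swap l.1 (l.1 + 1)

/-- The geometric braid of a word; each letter takes one unit of time. -/
noncomputable def wordArc : List (ℕ × Bool) → ℕ → ℝ → ℝ × ℝ
  | [] => fun k _ => (0, (k : ℝ))
  | l :: w => arcConcat 1 (Equiv.swap l.1 (l.1 + 1)) (letterPath (some l)) (wordArc w)

theorem isArc_wordArc (w : List (ℕ × Bool)) : IsArc w.length (wordPerm w) (wordArc w) := by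
  induction w with
  | nil =>
    refine ⟨fun k => contDiff_const, fun k y _ => rfl, fun k y _ => rfl, fun y k l e => ?_⟩
    simpa [wordArc] using e
  | cons l w ih =>
    have := (isArc_letterPath l).concat ih zero_le_one le_rfl (Nat.cast_nonneg _)
    rw [List.length_cons, Nat.cast_add_one, add_comm]
    exact this

theorem wordPerm_append (w w' : List (ℕ × Bool)) :
    wordPerm (w ++ w') = wordPerm w' * wordPerm w := by
  induction w with
  | nil => simp [wordPerm]
  | cons l w ih => simp only [List.cons_append, wordPerm, ih, mul_assoc]

theorem wordArc_append (w w' : List (ℕ × Bool)) :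
    wordArc (w ++ w') = arcConcat w.length (wordPerm w) (wordArc w) (wordArc w') := by
  induction w with
  | nil =>
    funext k y
    simp [wordPerm, arcConcat, wordArc]
  | cons l w ih =>
    funext k y
    simp only [List.cons_append, wordArc, ih, arcConcat, wordPerm, List.length_cons, Nat.cast_add_one,
      Equiv.Perm.mul_apply]
    rw [show y - ((w.length : ℝ) + 1) = y - 1 - w.length by ring]
    abel

/-- Two words give isotopic geometric braids. -/
def WordIso (w w' : List (ℕ × Bool)) : Prop :=
  wordPerm w = wordPerm w' ∧ ArcIso (wordPerm w) (wordArc w) (wordArc w')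

namespace WordIso

theorem refl (w) : WordIso w w := ⟨rfl, ArcIso.refl (Nat.cast_nonneg _) (isArc_wordArc w)⟩

theorem symm {w w'} (h : WordIso w w') : WordIso w' w := ⟨h.1.symm, h.1 ▸ h.2.symm⟩

theorem trans {w w' w''} (h : WordIso w w') (h' : WordIso w' w'') : WordIso w w'' :=
  ⟨h.1.trans h'.1, h.2.trans (h.1 ▸ h'.2)⟩

theorem append {w w' v v'} (h : WordIso w w') (h' : WordIso v v') : WordIso (w ++ v) (w' ++ v') := by
  refine ⟨by rw [wordPerm_append, wordPerm_append, h.1, h'.1], ?_⟩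
  rw [wordPerm_append, wordArc_append, wordArc_append, ← h.1]
  exact h.2.concat h'.2 (Nat.cast_nonneg _) (Nat.cast_nonneg _) (Nat.cast_nonneg _)
    (Nat.cast_nonneg _) (isArc_wordArc w) (isArc_wordArc v) (h.1 ▸ isArc_wordArc w')
    (h'.1 ▸ isArc_wordArc v') le_rfl le_rfl

/-- A crossing followed by its inverse can be undone: the angle by which the two strands are turned is
scaled down to zero. -/
theorem cancel (i : ℕ) (s : Bool) : WordIso [(i, s), (i, !s)] [] := by
  have hp : wordPerm [(i, s), (i, !s)] = 1 := by simp [wordPerm]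
  refine ⟨hp, ?_⟩
  rw [hp]
  refine ⟨2, by norm_num, SmoothlyJoined.symm ?_⟩
  let ψ : ℝ → ℝ := fun y => (if s then 1 else -1) *
    (Real.pi * (Real.smoothTransition y - Real.smoothTransition (y - 1)))
  have hψ : ContDiff ℝ ∞ ψ := contDiff_const.mul (contDiff_const.mul
    (SmoothlyJoined.contDiff_smoothTransition.sub
      (SmoothlyJoined.contDiff_smoothTransition.comp (contDiff_id.sub contDiff_const))))
  have key := SmoothlyJoined.of_Icc (P := IsArc 2 1) (fun r k y => turnedPoint i (r * ψ y) k) ?_ ?_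
  · have e0 : (fun (k : ℕ) (y : ℝ) => turnedPoint i (0 * ψ y) k) = wordArc [] := by
      funext k y
      rw [zero_mul, turnedPoint_zero]; rfl
    have e1 : (fun (k : ℕ) (y : ℝ) => turnedPoint i (1 * ψ y) k) = wordArc [(i, s), (i, !s)] := by
      funext k y
      simp only [one_mul]
      rcases le_total y 1 with hy | hy
      · rw [wordArc, arcConcat_of_le (isArc_wordArc [(i, !s)]) _ hy, letterPath_some]
        simp only [ψ, Real.smoothTransition.zero_of_nonpos (sub_nonpos.2 hy), sub_zero]
      · rw [wordArc, arcConcat_of_ge (isArc_letterPath (i, s)) _ hy]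
        simp only [wordArc, arcConcat, sub_self, add_zero, letterPath_some, ψ,
          Real.smoothTransition.one_of_one_le hy]
        set x := Real.pi * Real.smoothTransition (y - 1)
        have hx : ∀ c : ℝ, c * (Real.pi * (1 - Real.smoothTransition (y - 1))) = c * (Real.pi - x) := by
          intro c; simp only [x]; ring
        rw [hx]
        unfold turnedPoint
        rw [Equiv.swap_apply_def]
        by_cases h1 : k = i
        · subst h1
          cases s <;> simp <;> constructor <;> ring
        · by_cases h2 : k = i + 1
          · subst h2
            cases s <;> simp <;> constructor <;> ring
          · simp [h1, h2]
    rw [e0, e1] at key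
    exact key
  · intro k
    exact contDiff_turnedPoint i k (contDiff_fst.mul (hψ.comp contDiff_snd))
  · intro r _
    refine ⟨fun k => contDiff_turnedPoint i k (contDiff_const.mul hψ), fun k y hy => ?_,
      fun k y hy => ?_, fun y k l => turnedPoint_inj⟩
    · have : ψ y = 0 := by
        simp only [ψ, Real.smoothTransition.zero_of_nonpos hy,
          Real.smoothTransition.zero_of_nonpos (show y - 1 ≤ 0 by linarith)]
        ring
      rw [this, mul_zero, turnedPoint_zero]
    · have : ψ y = 0 := by
        simp only [ψ, Real.smoothTransition.one_of_one_le (show 1 ≤ y by linarith),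
          Real.smoothTransition.one_of_one_le (show 1 ≤ y - 1 by linarith)]
        ring
      rw [this, mul_zero, turnedPoint_zero]; rfl

end WordIso

/-! ### Layered geometric braids -/

/-- Whenever two strands are at equal height, the one with the smaller label is nearer to the axis. -/
def Layered (r : ℕ → ℕ) (β : ℕ → ℝ → ℝ × ℝ) : Prop :=
  ∀ y k l, r k < r l → (β k y).2 = (β l y).2 → (β k y).1 < (β l y).1

/-- Two geometric braids are isotopic if no collision occurs on the line segment between them; only
times strictly between the two ends have to be considered. -/
theorem arcIso_of_line {T : ℝ} {π : Equiv.Perm ℕ} {α β : ℕ → ℝ → ℝ × ℝ} (hT : 0 ≤ T)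
    (hα : ∀ k, ContDiff ℝ ∞ (α k)) (hβ : ∀ k, ContDiff ℝ ∞ (β k))
    (h0 : ∀ k y, y ≤ 0 → α k y = (0, (k : ℝ)) ∧ β k y = (0, (k : ℝ)))
    (h1 : ∀ k y, T ≤ y → α k y = (0, (π k : ℝ)) ∧ β k y = (0, (π k : ℝ)))
    (hne : ∀ s : ℝ, 0 ≤ s → s ≤ 1 → ∀ y, 0 < y → y < T → ∀ k l, k < l →
      (1 - s) • α k y + s • β k y ≠ (1 - s) • α l y + s • β l y) : ArcIso π α β := by
  refine ⟨T, hT, ?_⟩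
  have key := SmoothlyJoined.of_Icc (P := IsArc T π) (fun s k y => (1 - s) • α k y + s • β k y) ?_ ?_
  · simpa using key
  · intro k
    exact ((contDiff_const.sub contDiff_fst).smul ((hα k).comp contDiff_snd)).add
      (contDiff_fst.smul ((hβ k).comp contDiff_snd))
  · rintro s ⟨hs0, hs1⟩
    have st : ∀ k y, y ≤ 0 → (1 - s) • α k y + s • β k y = (0, (k : ℝ)) := fun k y hy => by
      rw [(h0 k y hy).1, (h0 k y hy).2, ← add_smul]; simp
    have fi : ∀ k y, T ≤ y → (1 - s) • α k y + s • β k y = (0, (π k : ℝ)) := fun k y hy => by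
      rw [(h1 k y hy).1, (h1 k y hy).2, ← add_smul]; simp
    refine ⟨fun k => ((hα k).const_smul (1 - s)).add ((hβ k).const_smul s), st, fi, ?_⟩
    intro y k l e
    rcases le_or_gt y 0 with hy | hy
    · rw [st k y hy, st l y hy] at e
      simpa using e
    rcases le_or_gt T y with hy' | hy'
    · rw [fi k y hy', fi l y hy'] at e
      simpa using e
    by_contra hkl
    rcases lt_or_gt_of_ne hkl with h | h
    · exact hne s hs0 hs1 y hy hy' k l h e
    · exact hne s hs0 hs1 y hy hy' l k h e.symm

/-- A layered geometric braid is determined up to isotopy by its permutation: after the strands have been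
moved into concentric layers, the heights may be changed freely. -/
theorem ArcIso.of_layered {T : ℝ} (hT : 0 ≤ T) {π : Equiv.Perm ℕ} {α β : ℕ → ℝ → ℝ × ℝ}
    (hα : IsArc T π α) (hβ : IsArc T π β) (lα : Layered id α) (lβ : Layered id β) : ArcIso π α β := by
  -- the distance of consecutive layers, positive strictly between the two ends
  let μ : ℝ → ℝ := fun y => Real.smoothTransition y * Real.smoothTransition (T - y)
  have hμ : ContDiff ℝ ∞ μ := SmoothlyJoined.contDiff_smoothTransition.mul
    (SmoothlyJoined.contDiff_smoothTransition.comp (contDiff_const.sub contDiff_id))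
  have μ0 : ∀ y ≤ 0, μ y = 0 := fun y hy => by
    simp only [μ, Real.smoothTransition.zero_of_nonpos hy, zero_mul]
  have μ1 : ∀ y, T ≤ y → μ y = 0 := fun y hy => by
    simp only [μ, Real.smoothTransition.zero_of_nonpos (sub_nonpos.2 hy), mul_zero]
  have μpos : ∀ y, 0 < y → y < T → 0 < μ y := fun y h h' =>
    mul_pos (Real.smoothTransition.pos_of_pos h) (Real.smoothTransition.pos_of_pos (sub_pos.2 h'))
  let L : (ℕ → ℝ → ℝ × ℝ) → ℕ → ℝ → ℝ × ℝ := fun γ k y => (μ y * k, (γ k y).2)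
  have sL : ∀ {γ}, IsArc T π γ → ∀ k, ContDiff ℝ ∞ (L γ k) := fun hγ k =>
    (hμ.mul contDiff_const).prodMk (hγ.smooth k).snd
  have L0 : ∀ {γ}, IsArc T π γ → ∀ k y, y ≤ 0 → L γ k y = (0, (k : ℝ)) := fun hγ k y hy => by
    simp only [L, μ0 y hy, hγ.start k y hy, zero_mul]
  have L1 : ∀ {γ}, IsArc T π γ → ∀ k y, T ≤ y → L γ k y = (0, (π k : ℝ)) := fun hγ k y hy => by
    simp only [L, μ1 y hy, hγ.finish k y hy, zero_mul]
  have spread : ∀ {γ}, IsArc T π γ → Layered id γ → ArcIso π γ (L γ) := by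
    intro γ hγ lγ
    refine arcIso_of_line hT hγ.smooth (sL hγ) (fun k y hy => ⟨hγ.start k y hy, L0 hγ k y hy⟩)
      (fun k y hy => ⟨hγ.finish k y hy, L1 hγ k y hy⟩) ?_
    intro s hs0 hs1 y hy hy' k l hkl e
    simp only [L, Prod.ext_iff, Prod.fst_add, Prod.smul_fst, Prod.snd_add, Prod.smul_snd,
      smul_eq_mul] at e
    have e2 : (γ k y).2 = (γ l y).2 := by linarith [e.2]
    have h1 := lγ y k l hkl e2
    have hkl' : (k : ℝ) < l := by exact_mod_cast hkl
    have h2 : μ y * k < μ y * l := mul_lt_mul_of_pos_left hkl' (μpos y hy hy')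
    rcases eq_or_lt_of_le hs0 with rfl | hs
    · linarith [e.1]
    · nlinarith [e.1, mul_lt_mul_of_pos_left h2 hs, mul_le_mul_of_nonneg_left h1.le (sub_nonneg.2 hs1)]
  have mid : ArcIso π (L α) (L β) := by
    refine arcIso_of_line hT (sL hα) (sL hβ) (fun k y hy => ⟨L0 hα k y hy, L0 hβ k y hy⟩)
      (fun k y hy => ⟨L1 hα k y hy, L1 hβ k y hy⟩) ?_
    intro s _ _ y hy hy' k l hkl e
    have e1 := congrArg Prod.fst e
    simp only [L, Prod.fst_add, Prod.smul_fst, smul_eq_mul] at e1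
    have hkl' : (k : ℝ) < l := by exact_mod_cast hkl
    have h2 : μ y * k < μ y * l := mul_lt_mul_of_pos_left hkl' (μpos y hy hy')
    linarith
  exact ((spread hα lα).trans mid).trans (spread hβ lβ).symm

/-- No two strands of the positive word cross twice, if the strand in position `k` has the label `r k`
and the labels increase at first where a crossing takes place. -/
def CrossOnce : (ℕ → ℕ) → List ℕ → Prop
  | _, [] => True
  | r, i :: w => r i < r (i + 1) ∧ CrossOnce (fun k => r (Equiv.swap i (i + 1) k)) w

/-- The strand with the smaller label passes on the inner side at each crossing, and this is the only
crossing of the two strands. -/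
theorem CrossOnce.layered {w : List ℕ} : ∀ {r : ℕ → ℕ}, CrossOnce r w →
    Layered r (wordArc (w.map fun i => (i, true))) := by
  induction w with
  | nil =>
    intro r _ y k l hkl e
    simp [wordArc] at e
    subst e
    exact absurd hkl (lt_irrefl _)
  | cons i w ih =>
    intro r hr y k l hkl e
    rw [List.map_cons, wordArc] at e ⊢
    rcases le_total y 1 with hy | hy
    · rw [arcConcat_of_le (isArc_wordArc _) _ hy, arcConcat_of_le (isArc_wordArc _) _ hy,
        letterPath_some, letterPath_some] at e ⊢
      simp only [if_true, one_mul] at e ⊢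
      set φ := Real.pi * Real.smoothTransition y with hφ
      have hkl' : k ≠ l := by rintro rfl; exact absurd hkl (lt_irrefl _)
      obtain ⟨h1, h2⟩ := turnedPoint_tie hkl' e
      have hs : 0 ≤ Real.sin φ := by
        apply Real.sin_nonneg_of_nonneg_of_le_pi
        · exact mul_nonneg Real.pi_pos.le (Real.smoothTransition.nonneg _)
        · exact mul_le_of_le_one_right Real.pi_pos.le (Real.smoothTransition.le_one _)
      have h3 := Real.sin_sq_add_cos_sq φ
      rw [h2] at h3
      have hs' : 0 < Real.sin φ := lt_of_le_of_ne hs fun h => by rw [← h] at h3; norm_num at h3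
      rcases h1 with ⟨rfl, rfl⟩ | ⟨rfl, rfl⟩
      · simp [turnedPoint]; linarith
      · exact absurd hkl (not_lt.2 hr.1.le)
    · rw [arcConcat_of_ge (isArc_letterPath (i, true)) _ hy,
        arcConcat_of_ge (isArc_letterPath (i, true)) _ hy] at e ⊢
      refine ih hr.2 _ _ _ ?_ e
      simpa using hkl

/-- Both braid relations between positive words are instances of this: a positive word in which no two
strands cross twice is determined up to isotopy by its permutation. -/
theorem WordIso.of_crossOnce {w w' : List ℕ} (hl : w.length = w'.length)
    (hp : wordPerm (w.map fun i => (i, true)) = wordPerm (w'.map fun i => (i, true)))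
    (h : CrossOnce id w) (h' : CrossOnce id w') :
    WordIso (w.map fun i => (i, true)) (w'.map fun i => (i, true)) := by
  refine ⟨hp, ArcIso.of_layered (Nat.cast_nonneg _) (isArc_wordArc _) ?_ h.layered h'.layered⟩
  have := isArc_wordArc (w'.map fun i => (i, true))
  rw [← hp] at this
  simpa [hl] using this

theorem WordIso.comm {i j : ℕ} (h : i + 2 ≤ j) :
    WordIso [(i, true), (j, true)] [(j, true), (i, true)] := by
  refine WordIso.of_crossOnce (w := [i, j]) (w' := [j, i]) rfl ?_ ?_ ?_
  · ext k
    simp only [List.map, wordPerm, one_mul, Equiv.Perm.mul_apply, Equiv.swap_apply_def]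
    split_ifs <;> omega
  all_goals
    simp only [CrossOnce, Equiv.swap_apply_def, id, and_true]
    constructor
    · omega
    · split_ifs <;> omega

theorem WordIso.braid (i : ℕ) :
    WordIso [(i, true), (i + 1, true), (i, true)] [(i + 1, true), (i, true), (i + 1, true)] := by
  refine WordIso.of_crossOnce (w := [i, i + 1, i]) (w' := [i + 1, i, i + 1]) rfl ?_ ?_ ?_
  · ext k
    simp only [List.map, wordPerm, one_mul, Equiv.Perm.mul_apply, Equiv.swap_apply_def]
    split_ifs <;> omega
  all_goals
    simp only [CrossOnce, Equiv.swap_apply_def, id, and_true]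
    refine ⟨?_, ?_, ?_⟩
    · omega
    · split_ifs <;> omega
    · split_ifs <;> omega

/-! ### The group of geometric braids -/

/-- Isotopy of geometric braids as a congruence on braid words. -/
def wordCon : Con (FreeMonoid (ℕ × Bool)) where
  r w w' := WordIso w.toList w'.toList
  iseqv := ⟨fun w => WordIso.refl _, WordIso.symm, WordIso.trans⟩
  mul' h h' := by
    simp only [FreeMonoid.toList_mul]
    exact h.append h'

/-- Isotopy classes of geometric braids in infinitely many strands. -/
def Br : Type := wordCon.Quotient

noncomputable instance : Monoid Br := inferInstanceAs (Monoid wordCon.Quotient)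

namespace Br

/-- The class of a braid word. -/
def mk (w : List (ℕ × Bool)) : Br := wordCon.mk' (FreeMonoid.ofList w)

theorem mk_append (w w' : List (ℕ × Bool)) : mk (w ++ w') = mk w * mk w' := rfl

theorem mk_nil : mk [] = 1 := rfl

theorem mk_cons (l : ℕ × Bool) (w : List (ℕ × Bool)) : mk (l :: w) = mk [l] * mk w := rfl

theorem mk_eq_mk {w w' : List (ℕ × Bool)} : mk w = mk w' ↔ WordIso w w' := wordCon.eq

theorem exists_mk (g : Br) : ∃ w, mk w = g := by
  obtain ⟨w, rfl⟩ := Quotient.exists_rep g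
  exact ⟨w.toList, rfl⟩

theorem mk_mul_mk_not (i : ℕ) (s : Bool) : mk [(i, s)] * mk [(i, !s)] = 1 :=
  mk_eq_mk.2 (WordIso.cancel i s)

theorem isUnit (g : Br) : IsUnit g := by
  obtain ⟨w, rfl⟩ := exists_mk g
  induction w with
  | nil => exact isUnit_one
  | cons l w ih =>
    obtain ⟨i, s⟩ := l
    refine IsUnit.mul ⟨⟨mk [(i, s)], mk [(i, !s)], mk_mul_mk_not i s, ?_⟩, rfl⟩ ih
    have := mk_mul_mk_not i (!s)
    rwa [Bool.not_not] at this

noncomputable instance : Group Br := groupOfIsUnit isUnit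

/-- The class of the generator `σ_i`. -/
noncomputable def σ (i : ℕ) : Br := mk [(i, true)]

theorem mk_true (i : ℕ) : mk [(i, true)] = σ i := rfl

theorem mk_false (i : ℕ) : mk [(i, false)] = (σ i)⁻¹ :=
  eq_inv_of_mul_eq_one_right (mk_mul_mk_not i true)

theorem σ_comm {i j : ℕ} (h : i + 2 ≤ j) : σ i * σ j = σ j * σ i := mk_eq_mk.2 (WordIso.comm h)

theorem σ_braid (i : ℕ) : σ i * σ (i + 1) * σ i = σ (i + 1) * σ i * σ (i + 1) :=
  mk_eq_mk.2 (WordIso.braid i)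

/-- The permutation of a braid. -/
def perm : Br → Equiv.Perm ℕ :=
  Quotient.lift (fun w => wordPerm w.toList) fun _ _ (h : WordIso _ _) => h.1

theorem perm_mk (w : List (ℕ × Bool)) : perm (mk w) = wordPerm w := rfl

theorem perm_mul (g h : Br) : perm (g * h) = perm h * perm g := by
  obtain ⟨w, rfl⟩ := exists_mk g
  obtain ⟨v, rfl⟩ := exists_mk h
  rw [← mk_append, perm_mk, perm_mk, perm_mk, wordPerm_append]

theorem perm_one : perm 1 = 1 := rfl

theorem perm_inv (g : Br) : perm g⁻¹ = (perm g)⁻¹ := by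
  rw [eq_inv_iff_mul_eq_one, ← perm_mul, mul_inv_cancel, perm_one]

theorem perm_σ (i : ℕ) : perm (σ i) = Equiv.swap i (i + 1) := by
  rw [σ, perm_mk]; simp [wordPerm]

/-- The braids involving only the strands `1, …, n`. -/
noncomputable def below (n : ℕ) : Subgroup Br := Subgroup.closure {g | ∃ i, 1 ≤ i ∧ i < n ∧ g = σ i}

theorem σ_mem_below {n i : ℕ} (h1 : 1 ≤ i) (h2 : i < n) : σ i ∈ below n :=
  Subgroup.subset_closure ⟨i, h1, h2, rfl⟩

theorem below_mono {n m : ℕ} (h : n ≤ m) : below n ≤ below m :=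
  Subgroup.closure_mono fun _ ⟨i, h1, h2, h3⟩ => ⟨i, h1, h2.trans_le h, h3⟩

theorem mk_mem_below {n : ℕ} {w : List (ℕ × Bool)} (hw : ∀ l ∈ w, 1 ≤ l.1 ∧ l.1 < n) :
    mk w ∈ below n := by
  induction w with
  | nil => exact one_mem _
  | cons l w ih =>
    rw [mk_cons]
    refine mul_mem ?_ (ih fun l hl => hw l (List.mem_cons_of_mem _ hl))
    obtain ⟨h1, h2⟩ := hw l List.mem_cons_self
    obtain ⟨i, s⟩ := l
    cases s
    · rw [mk_false]; exact inv_mem (σ_mem_below h1 h2)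
    · exact σ_mem_below h1 h2

theorem inv_mk (w : List (ℕ × Bool)) : (mk w)⁻¹ = mk (w.map fun l => (l.1, !l.2)).reverse := by
  induction w with
  | nil => rw [mk_nil, inv_one]; rfl
  | cons l w ih =>
    rw [mk_cons, mul_inv_rev, ih, List.map_cons, List.reverse_cons, mk_append]
    congr 1
    exact inv_eq_of_mul_eq_one_right (mk_mul_mk_not l.1 l.2)

theorem exists_word_of_mem_below {n : ℕ} {g : Br} (hg : g ∈ below n) :
    ∃ w : List (ℕ × Bool), (∀ l ∈ w, 1 ≤ l.1 ∧ l.1 < n) ∧ mk w = g := by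
  induction hg using Subgroup.closure_induction with
  | mem g hg =>
    obtain ⟨i, h1, h2, rfl⟩ := hg
    exact ⟨[(i, true)], by simp [h1, h2], rfl⟩
  | one => exact ⟨[], by simp, rfl⟩
  | mul g h _ _ ihg ihh =>
    obtain ⟨w, hw, rfl⟩ := ihg
    obtain ⟨v, hv, rfl⟩ := ihh
    refine ⟨w ++ v, fun l hl => ?_, mk_append w v⟩
    rcases List.mem_append.1 hl with h | h
    · exact hw l h
    · exact hv l h
  | inv g _ ih =>
    obtain ⟨w, hw, rfl⟩ := ih
    refine ⟨_, fun l hl => ?_, (inv_mk w).symm⟩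
    simp only [List.mem_reverse, List.mem_map] at hl
    obtain ⟨l', h', rfl⟩ := hl
    exact hw l' h'

theorem perm_mem_stabilizer {n : ℕ} {g : Br} (hg : g ∈ below n) :
    perm g ∈ MulAction.stabilizer (Equiv.Perm ℕ) (Set.Icc 1 n) := by
  induction hg using Subgroup.closure_induction with
  | mem g hg =>
    obtain ⟨i, h1, h2, rfl⟩ := hg
    rw [perm_σ, MulAction.mem_stabilizer_set]
    intro k
    rw [Equiv.Perm.smul_def, Equiv.swap_apply_def, Set.mem_Icc, Set.mem_Icc]
    split_ifs <;> omega
  | one => exact one_mem _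
  | mul g h _ _ ihg ihh => rw [perm_mul]; exact mul_mem ihh ihg
  | inv g _ ih => rw [perm_inv]; exact inv_mem ih

theorem perm_apply_of_gt {n : ℕ} {g : Br} (hg : g ∈ below n) {k : ℕ} (hk : n < k) : perm g k = k := by
  induction hg using Subgroup.closure_induction with
  | mem g hg =>
    obtain ⟨i, h1, h2, rfl⟩ := hg
    rw [perm_σ, Equiv.swap_apply_of_ne_of_ne] <;> omega
  | one => rfl
  | mul g h _ _ ihg ihh => rw [perm_mul, Equiv.Perm.mul_apply, ihg, ihh]
  | inv g _ ih => rw [perm_inv, Equiv.Perm.inv_eq_iff_eq, ih]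

end Br

/-! ### Closed braids -/

/-- The loop that starts at strand `n` of the closure of the word `w`. -/
noncomputable def closedLoop (n : ℕ) (w : List (ℕ × Bool)) : ℝ → ℝ × ℝ :=
  loopOf (wordPerm w) (w.length + 1) (wordArc w) n

/-- The braid `g` involves only the strands `1, …, n`, and its closure on these strands is a knot. -/
structure IsKnotBraid (n : ℕ) (g : Br) : Prop where
  mem : g ∈ Br.below n
  closes : ClosesAfter n (g.perm) n

/-- If strand `n` runs through `n` positions, then it runs through all of `1, …, n`. -/
theorem IsKnotBraid.exists_pow {n : ℕ} {g : Br} (h : IsKnotBraid n g) {k : ℕ} (h1 : 1 ≤ k) (h2 : k ≤ n) :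
    ∃ j : ℕ, (g.perm ^ j) n = k := by
  have hst := Br.perm_mem_stabilizer h.mem
  have hmaps : ∀ j : ℕ, (g.perm ^ j) n ∈ Set.Icc 1 n := fun j =>
    ((MulAction.mem_stabilizer_set.1 (pow_mem hst j)) n).2 ⟨h.closes.1, le_rfl⟩
  have hinj : Set.InjOn (fun j : ℕ => (g.perm ^ j) n) (Finset.range n) := by
    have main : ∀ i j : ℕ, i < j → j < n → (g.perm ^ i) n ≠ (g.perm ^ j) n := by
      intro i j hij hj e
      refine h.closes.2.2 (j - i) (by omega) (by omega) ?_
      rw [show j = i + (j - i) by omega, pow_add, Equiv.Perm.mul_apply] at e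
      exact ((g.perm ^ i).injective e).symm
    intro i hi j hj e
    simp only [Finset.coe_range, Set.mem_Iio] at hi hj
    rcases lt_trichotomy i j with hij | hij | hij
    · exact absurd e (main i j hij hj)
    · exact hij
    · exact absurd e.symm (main j i hij hi)
  have := Finset.surjOn_of_injOn_of_card_le (s := Finset.range n) (t := Finset.Icc 1 n)
    (fun j => (g.perm ^ j) n) (fun j _ => by simpa using hmaps j) hinj (by simp)
  obtain ⟨j, -, hj⟩ := this (show k ∈ (Finset.Icc 1 n : Set ℕ) by simpa using ⟨h1, h2⟩)
  exact ⟨j, hj⟩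

theorem IsKnotBraid.closesAfter {n : ℕ} {g : Br} (h : IsKnotBraid n g) {k : ℕ} (h1 : 1 ≤ k)
    (h2 : k ≤ n) : ClosesAfter n g.perm k := by
  obtain ⟨j, rfl⟩ := h.exists_pow h1 h2
  refine ⟨h.closes.1, ?_, fun i hi hin e => ?_⟩
  · rw [← Equiv.Perm.mul_apply, ← pow_add, add_comm, pow_add, Equiv.Perm.mul_apply, h.closes.2.1]
  · rw [← Equiv.Perm.mul_apply, ← pow_add, add_comm, pow_add, Equiv.Perm.mul_apply] at e
    exact h.closes.2.2 i hi hin ((g.perm ^ j).injective e)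

/-- The closure of a geometric braid does not depend on the strand at which it is entered. -/
theorem IsKnotBraid.thinIso_base {n : ℕ} {g : Br} (h : IsKnotBraid n g) {T P : ℝ} (hT : 0 ≤ T)
    (hTP : T < P) {β : ℕ → ℝ → ℝ × ℝ} (hβ : IsArc T g.perm β) {k : ℕ} (h1 : 1 ≤ k) (h2 : k ≤ n) :
    ThinIso n (loopOf g.perm P β n) n (loopOf g.perm P β k) := by
  obtain ⟨j, rfl⟩ := h.exists_pow h1 h2
  rw [funext (loopOf_apply_pow g.perm P β n j)]
  exact ThinIso.of_loopIso h.closes.1 (LoopIso.shift (hβ.isLoop hT hTP h.closes) j)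

theorem wordArc_eq_letterPath (w : List (ℕ × Bool)) : ∀ (j : ℕ), j ≤ w.length → ∀ (k : ℕ) (τ : ℝ),
    0 ≤ τ → τ ≤ 1 →
    wordArc w k (j + τ) = letterPath (w[j]?) (wordPerm (w.take j) k) τ := by
  induction w with
  | nil =>
    intro j hj k τ _ _
    obtain rfl : j = 0 := by simpa using hj
    rfl
  | cons l w ih =>
    intro j hj k τ h0 h1
    rcases j with _ | j
    · simp only [wordArc, Nat.cast_zero, zero_add, List.getElem?_cons_zero, List.take_zero, wordPerm,
        Equiv.Perm.one_apply]
      exact arcConcat_of_le (isArc_wordArc w) _ h1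
    · have hj' : j ≤ w.length := by simpa using hj
      have hc : (0 : ℝ) ≤ j := Nat.cast_nonneg j
      rw [wordArc, arcConcat_of_ge (isArc_letterPath l) _ (by push_cast; linarith),
        show (((j + 1 : ℕ) : ℝ) + τ - 1) = j + τ by push_cast; ring, ih j hj' _ τ h0 h1]
      simp only [List.getElem?_cons_succ, List.take_succ_cons, wordPerm, Equiv.Perm.mul_apply]

theorem closure_eq_range {B : BraidWord} (h : IsKnotBraid B.strands (Br.mk B.letters)) (ε : ℝ) :
    B.closure ε = Set.range (knotOf ε B.strands (closedLoop B.strands B.letters)) := by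
  set n := B.strands with hn
  set w := B.letters with hw
  have hn0 : (0 : ℝ) < n := by exact_mod_cast h.closes.1
  have hA := isArc_wordArc w
  have hP : (0 : ℝ) < w.length + 1 := by positivity
  have hst := Br.perm_mem_stabilizer h.mem
  have hval : ∀ j, Br.perm (Br.mk (w.take j)) ∈ MulAction.stabilizer (Equiv.Perm ℕ) (Set.Icc 1 n) :=
    fun j => Br.perm_mem_stabilizer (Br.mk_mem_below fun l hl => B.valid l (List.mem_of_mem_take hl))
  have hcyl : ∀ (θ : ℝ) (j : ℤ) q, nearCircle ε (2 * Real.pi * (j + θ)) q =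
      nearCircle ε (2 * Real.pi * θ) q := by
    intro θ j q
    have : 2 * Real.pi * (j + θ) = 2 * Real.pi * θ + j * (2 * Real.pi) := by ring
    simp only [nearCircle]
    rw [this, Real.cos_add_int_mul_two_pi, Real.sin_add_int_mul_two_pi]
  ext p
  constructor
  · rintro ⟨j, hj, k, hk1, hk2, τ, ⟨hτ0, hτ1⟩, rfl⟩
    set k' := (wordPerm (w.take j))⁻¹ k with hk'
    have hk'' : k' ∈ Set.Icc 1 n :=
      ((MulAction.mem_stabilizer_set.1 (inv_mem (hval j))) k).2 ⟨hk1, hk2⟩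
    obtain ⟨i, hi⟩ := h.exists_pow hk''.1 hk''.2
    have hj' : (j : ℝ) ≤ w.length := by exact_mod_cast hj
    have hfr0 : 0 ≤ ((j : ℝ) + τ) / (w.length + 1) := by positivity
    have hfr1 : ((j : ℝ) + τ) / (w.length + 1) ≤ 1 := by
      rw [div_le_one hP]; linarith
    refine ⟨(i + (j + τ) / (w.length + 1)) / n, ?_⟩
    have e1 : (n : ℝ) * ((i + (j + τ) / (w.length + 1)) / n) =
        ((i : ℤ) : ℝ) + (j + τ) / (w.length + 1) := by
      push_cast; field_simp
    simp only [knotOf]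
    rw [e1, hcyl]
    congr 1
    rw [closedLoop, hA.loopOf_eq hP (by linarith) n i (by linarith) ?_ (by linarith),
      add_sub_cancel_left, mul_div_cancel₀ _ hP.ne', wordArc_eq_letterPath w j hj _ τ hτ0 hτ1,
      zpow_natCast]
    · have hi' : (wordPerm w ^ i) n = k' := hi
      rw [hi', hk', Equiv.Perm.inv_def, Equiv.apply_symm_apply]
    · rw [add_sub_cancel_left]
      have := mul_nonneg hP.le hfr0
      linarith
  · rintro ⟨t, rfl⟩
    set y := (n : ℝ) * t with hy
    have hf0 := Int.fract_nonneg y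
    have hf1 := Int.fract_lt_one y
    set x := ((w.length : ℝ) + 1) * Int.fract y with hx
    have hx0 : 0 ≤ x := mul_nonneg hP.le hf0
    have hx1 : x < w.length + 1 := by
      calc x < (w.length + 1) * 1 := mul_lt_mul_of_pos_left hf1 hP
        _ = _ := mul_one _
    have hj : ⌊x⌋₊ ≤ w.length := by
      have := (Nat.floor_lt hx0 (n := w.length + 1)).2 (by push_cast; exact hx1)
      omega
    have hk : wordPerm (w.take ⌊x⌋₊) ((wordPerm w ^ ⌊y⌋) n) ∈ Set.Icc 1 n :=
      ((MulAction.mem_stabilizer_set.1 (hval ⌊x⌋₊)) _).2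
        (((MulAction.mem_stabilizer_set.1 (zpow_mem hst ⌊y⌋)) n).2 ⟨h.closes.1, le_rfl⟩)
    refine ⟨⌊x⌋₊, hj, _, hk.1, hk.2, x - ⌊x⌋₊, ⟨?_, ?_⟩, ?_⟩
    · linarith [Nat.floor_le hx0]
    · linarith [Nat.lt_floor_add_one x]
    · rw [← wordArc_eq_letterPath w _ hj _ _ (by linarith [Nat.floor_le hx0])
        (by linarith [Nat.lt_floor_add_one x]), add_sub_cancel]
      have e2 : y = ((⌊y⌋ : ℤ) : ℝ) + x / (w.length + 1) := by
        rw [hx, mul_div_cancel_left₀ _ hP.ne']; exact (Int.floor_add_fract y).symm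
      simp only [knotOf]
      rw [← hy]
      conv_lhs => rw [e2, hcyl]
      congr 1
      rw [← e2]
      rfl

/-- The closures of `g` on `n` strands and of `g'` on `n'` strands are knots, and they represent the
same transverse knot. -/
structure SameKnot (n : ℕ) (g : Br) (n' : ℕ) (g' : Br) : Prop where
  left : IsKnotBraid n g
  right : IsKnotBraid n' g'
  thinIso : ∀ w w', Br.mk w = g → Br.mk w' = g' →
    ThinIso n (closedLoop n w) n' (closedLoop n' w')

theorem IsKnotBraid.thinIso_word {n : ℕ} {w w' : List (ℕ × Bool)} (h : IsKnotBraid n (Br.mk w))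
    (e : Br.mk w = Br.mk w') : ThinIso n (closedLoop n w) n (closedLoop n w') := by
  obtain ⟨h1, h2⟩ := Br.mk_eq_mk.1 e
  have h3 := isArc_wordArc w'
  have h4 : closedLoop n w' = loopOf (wordPerm w) (w'.length + 1) (wordArc w') n := by
    rw [closedLoop, h1]
  rw [← h1] at h3
  rw [h4]
  exact thinIso_of_arcIso (Nat.cast_nonneg _) (Nat.cast_nonneg _) (lt_add_one _) (lt_add_one _)
    (isArc_wordArc w) h3 h2 h.closes

namespace SameKnot

theorem refl {n : ℕ} {g : Br} (h : IsKnotBraid n g) : SameKnot n g n g :=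
  ⟨h, h, fun _ _ e e' => IsKnotBraid.thinIso_word (e ▸ h) (e.trans e'.symm)⟩

theorem symm {n n' : ℕ} {g g' : Br} (h : SameKnot n g n' g') : SameKnot n' g' n g :=
  ⟨h.right, h.left, fun w w' e e' => (h.thinIso w' w e' e).symm⟩

theorem trans {n n' n'' : ℕ} {g g' g'' : Br} (h : SameKnot n g n' g') (h' : SameKnot n' g' n'' g'') :
    SameKnot n g n'' g'' := by
  refine ⟨h.left, h'.right, fun w w'' e e'' => ?_⟩
  obtain ⟨w', e'⟩ := Br.exists_mk g'
  exact (h.thinIso w w' e e').trans (h'.thinIso w' w'' e' e'')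

theorem of_word {n n' : ℕ} {w w' : List (ℕ × Bool)} (h : IsKnotBraid n (Br.mk w))
    (h' : IsKnotBraid n' (Br.mk w')) (e : ThinIso n (closedLoop n w) n' (closedLoop n' w')) :
    SameKnot n (Br.mk w) n' (Br.mk w') :=
  ⟨h, h', fun _ _ ev ev' => (IsKnotBraid.thinIso_word (ev ▸ h) ev).trans
    (e.trans (IsKnotBraid.thinIso_word h' ev'.symm))⟩

theorem representSame {B B' : BraidWord}
    (h : SameKnot B.strands (Br.mk B.letters) B'.strands (Br.mk B'.letters)) :
    RepresentSameTransverseKnot B B' := by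
  obtain ⟨ε₀, h0, H⟩ := h.thinIso _ _ rfl rfl
  refine ⟨ε₀, h0, fun ε ε' a b c d => ?_⟩
  rw [closure_eq_range h.left, closure_eq_range h.right]
  exact (H ε ε' a b c d).transverselyIsotopic

/-- The braids `g h` and `h g` have the same closure, up to a rotation about the axis. -/
theorem mul_comm {n : ℕ} {g h : Br} (hg : g ∈ Br.below n) (hh : h ∈ Br.below n)
    (hk : IsKnotBraid n (g * h)) : SameKnot n (g * h) n (h * g) := by
  obtain ⟨u, rfl⟩ := Br.exists_mk g
  obtain ⟨v, rfl⟩ := Br.exists_mk h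
  have hu := isArc_wordArc u
  have hv := isArc_wordArc v
  have hmem : wordPerm u n ∈ Set.Icc 1 n :=
    ((MulAction.mem_stabilizer_set.1 (Br.perm_mem_stabilizer hg)) n).2 ⟨hk.closes.1, le_rfl⟩
  have hperm : ∀ j : ℕ, ∀ k, ((wordPerm u * wordPerm v) ^ j) (wordPerm u k) =
      wordPerm u (((wordPerm v * wordPerm u) ^ j) k) := by
    intro j k
    have : (wordPerm u * wordPerm v) ^ j * wordPerm u = wordPerm u * (wordPerm v * wordPerm u) ^ j := by
      have e : wordPerm u * wordPerm v = wordPerm u * (wordPerm v * wordPerm u) * (wordPerm u)⁻¹ := by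
        group
      rw [e, conj_pow]; group
    exact congrArg (fun s : Equiv.Perm ℕ => s k) this
  have p1 : Br.perm (Br.mk u * Br.mk v) = wordPerm v * wordPerm u := Br.perm_mul _ _
  have p2 : Br.perm (Br.mk v * Br.mk u) = wordPerm u * wordPerm v := Br.perm_mul _ _
  -- the strand of the second closure lying over strand `n` of the first
  have hcl : ∀ k, ClosesAfter n (wordPerm v * wordPerm u) k →
      ClosesAfter n (wordPerm u * wordPerm v) (wordPerm u k) := by
    rintro k ⟨h1, h2, h3⟩
    refine ⟨h1, by rw [hperm, h2], fun j hj hjn e => ?_⟩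
    rw [hperm] at e
    exact h3 j hj hjn ((wordPerm u).injective e)
  have hk' : IsKnotBraid n (Br.mk v * Br.mk u) := by
    refine ⟨mul_mem hh hg, ?_⟩
    have hm2 : (wordPerm u)⁻¹ n ∈ Set.Icc 1 n :=
      ((MulAction.mem_stabilizer_set.1 (inv_mem (Br.perm_mem_stabilizer hg))) n).2
        ⟨hk.closes.1, le_rfl⟩
    have := hk.closesAfter hm2.1 hm2.2
    rw [p1] at this
    have := hcl _ this
    rwa [Equiv.Perm.inv_def, Equiv.apply_symm_apply, ← p2] at this
  have hk0 := hk.closes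
  rw [p1] at hk0
  refine of_word (w := u ++ v) (w' := v ++ u) hk hk' ?_
  have lu : (0 : ℝ) ≤ u.length := Nat.cast_nonneg _
  have lv : (0 : ℝ) ≤ v.length := Nat.cast_nonneg _
  have A := hu.concat hv (T := u.length + 1) (by linarith) (by linarith) lv
  have B := hv.concat hu (T := v.length + 1) (by linarith) (by linarith) lu
  have s1 : ThinIso n (closedLoop n (u ++ v)) n (loopOf (wordPerm v * wordPerm u)
      ((u.length + 1) + (v.length + 1)) (arcConcat (u.length + 1) (wordPerm u) (wordArc u)
        (wordArc v)) n) := by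
    rw [closedLoop, wordPerm_append, wordArc_append]
    have A' := hu.concat hv (T := u.length) lu le_rfl lv
    refine thinIso_of_arcIso (by linarith) (by linarith) ?_ ?_ A' A
      (ArcIso.concat (ArcIso.refl lu hu) (ArcIso.refl lv hv) lu (by linarith) lv lv hu hv hu hv le_rfl
        (by linarith)) hk0
    · push_cast [List.length_append]; linarith
    · linarith
  have s2 : ThinIso n (loopOf (wordPerm v * wordPerm u)
      ((u.length + 1) + (v.length + 1)) (arcConcat (u.length + 1) (wordPerm u) (wordArc u)
        (wordArc v)) n) n (loopOf (wordPerm u * wordPerm v)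
      ((u.length + 1) + (v.length + 1)) (arcConcat (v.length + 1) (wordPerm v) (wordArc v)
        (wordArc u)) (wordPerm u n)) := by
    rw [funext (loopOf_concat_comm (π := wordPerm u) (ρ := wordPerm v) hu hv lu lv (lt_add_one _)
      (lt_add_one _) n)]
    exact ThinIso.of_loopIso hk.closes.1 (LoopIso.shift (A.isLoop (by linarith) (by linarith) hk0) _)
  have hk0' := hk'.closes
  rw [p2] at hk0'
  have s3 : ThinIso n (loopOf (wordPerm u * wordPerm v)
      ((u.length + 1) + (v.length + 1)) (arcConcat (v.length + 1) (wordPerm v) (wordArc v)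
        (wordArc u)) n) n (loopOf (wordPerm u * wordPerm v)
      ((u.length + 1) + (v.length + 1)) (arcConcat (v.length + 1) (wordPerm v) (wordArc v)
        (wordArc u)) (wordPerm u n)) := by
    rw [← p2] at B ⊢
    exact hk'.thinIso_base (by linarith) (by linarith) B hmem.1 hmem.2
  have s4 : ThinIso n (closedLoop n (v ++ u)) n (loopOf (wordPerm u * wordPerm v)
      ((u.length + 1) + (v.length + 1)) (arcConcat (v.length + 1) (wordPerm v) (wordArc v)
        (wordArc u)) n) := by
    rw [closedLoop, wordPerm_append, wordArc_append]
    have B' := hv.concat hu (T := v.length) lv le_rfl lu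
    refine thinIso_of_arcIso (by linarith) (by linarith) ?_ ?_ B' B
      (ArcIso.concat (ArcIso.refl lv hv) (ArcIso.refl lu hu) lv (by linarith) lu lu hv hu hv hu le_rfl
        (by linarith)) hk0'
    · push_cast [List.length_append]; linarith
    · linarith
  exact ((s1.trans s2).trans s3.symm).trans s4.symm

end SameKnot

/-! ### Profiles for the stabilization -/

theorem deriv_eq_zero_of_const {s : Set ℝ} (hs : UniqueDiffOn ℝ s) {f : ℝ → ℝ} (hf : ContDiff ℝ ∞ f)
    {c : ℝ} (h : ∀ y ∈ s, f y = c) {y : ℝ} (hy : y ∈ s) : deriv f y = 0 := by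
  have h1 := ((hf.differentiable (by simp)) y).hasDerivAt.hasDerivWithinAt (s := s)
  have h2 : HasDerivWithinAt f 0 s y := (hasDerivWithinAt_const y s c).congr h (h y hy)
  exact (hs y hy).eq_deriv s h1 h2

theorem deriv_eq_deriv_of_eqOn {s : Set ℝ} (hs : UniqueDiffOn ℝ s) {f g : ℝ → ℝ} (hf : ContDiff ℝ ∞ f)
    (hg : ContDiff ℝ ∞ g) (h : ∀ y ∈ s, f y = g y) {y : ℝ} (hy : y ∈ s) : deriv f y = deriv g y := by
  have h1 := ((hf.differentiable (by simp)) y).hasDerivAt.hasDerivWithinAt (s := s)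
  have h2 := (((hg.differentiable (by simp)) y).hasDerivAt.hasDerivWithinAt (s := s)).congr h (h y hy)
  exact (hs y hy).eq_deriv s h1 h2

theorem deriv_nonneg_of_monotoneOn {s : Set ℝ} (hs : UniqueDiffOn ℝ s) {f : ℝ → ℝ}
    (hf : ContDiff ℝ ∞ f) (h : MonotoneOn f s) {y : ℝ} (hy : y ∈ s) : 0 ≤ deriv f y := by
  have h1 := ((hf.differentiable (by simp)) y).hasDerivAt.hasDerivWithinAt (s := s)
  have := h.derivWithin_nonneg (x := y)
  rwa [h1.derivWithin (hs y hy)] at this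

open SmoothlyJoined (contDiff_smoothTransition)

/-- The height profile: a slow rise on `[0, 3/4]` and the descent on `[3/4, 7/8]`. -/
noncomputable def hump (y : ℝ) : ℝ :=
  y * Real.smoothTransition (4 * y) * (1 - Real.smoothTransition (8 * y - 6))

/-- The profile of the radius: equal to `1` on `[3/8, 5/8]` and supported in `[1/4, 3/4]`. -/
noncomputable def pinch (y : ℝ) : ℝ := Real.smoothTransition (8 * y - 2) * Real.smoothTransition (6 - 8 * y)

/-- The profile of the additional angle, in turns: it grows from `0` to `1` on `[3/8, 5/8]`. -/
noncomputable def twist (y : ℝ) : ℝ := Real.smoothTransition (4 * y - 3 / 2)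

theorem contDiff_hump : ContDiff ℝ ∞ hump :=
  (contDiff_id.mul (contDiff_smoothTransition.comp (contDiff_const.mul contDiff_id))).mul
    (contDiff_const.sub (contDiff_smoothTransition.comp
      ((contDiff_const.mul contDiff_id).sub contDiff_const)))

theorem contDiff_pinch : ContDiff ℝ ∞ pinch :=
  (contDiff_smoothTransition.comp ((contDiff_const.mul contDiff_id).sub contDiff_const)).mul
    (contDiff_smoothTransition.comp (contDiff_const.sub (contDiff_const.mul contDiff_id)))

theorem contDiff_twist : ContDiff ℝ ∞ twist :=
  contDiff_smoothTransition.comp ((contDiff_const.mul contDiff_id).sub contDiff_const)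

theorem hump_of_le_zero {y : ℝ} (hy : y ≤ 0) : hump y = 0 := by
  rw [hump, Real.smoothTransition.zero_of_nonpos (by linarith)]; ring

theorem hump_of_ge {y : ℝ} (hy : 7 / 8 ≤ y) : hump y = 0 := by
  rw [hump, Real.smoothTransition.one_of_one_le (x := 8 * y - 6) (by linarith)]; ring

theorem hump_of_le {y : ℝ} (hy : y ≤ 3 / 4) : hump y = y * Real.smoothTransition (4 * y) := by
  rw [hump, Real.smoothTransition.zero_of_nonpos (x := 8 * y - 6) (by linarith)]; ring

theorem hump_nonneg {y : ℝ} (hy : 0 ≤ y) : 0 ≤ hump y :=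
  mul_nonneg (mul_nonneg hy (Real.smoothTransition.nonneg _))
    (sub_nonneg.2 (Real.smoothTransition.le_one _))

theorem hump_strictMono {x y : ℝ} (hx : 0 ≤ x) (hxy : x < y) (hy : y ≤ 3 / 4) : hump x < hump y := by
  rw [hump_of_le hy, hump_of_le (hxy.le.trans hy)]
  have h1 := Real.smoothTransition.monotone (show 4 * x ≤ 4 * y by linarith)
  have h2 := Real.smoothTransition.pos_of_pos (show 0 < 4 * y by linarith)
  have h3 := Real.smoothTransition.nonneg (4 * x)
  nlinarith

theorem hump_pos {y : ℝ} (h0 : 0 < y) (hy : y ≤ 3 / 4) : 0 < hump y := by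
  have := hump_strictMono le_rfl h0 hy
  rwa [hump_of_le_zero le_rfl] at this

theorem deriv_hump_mid {y : ℝ} (h1 : 3 / 8 ≤ y) (h2 : y ≤ 5 / 8) : deriv hump y = 1 := by
  rw [deriv_eq_deriv_of_eqOn (uniqueDiffOn_Icc (show (3 / 8 : ℝ) < 5 / 8 by norm_num)) contDiff_hump
    contDiff_id ?_ ⟨h1, h2⟩, deriv_id]
  rintro y ⟨h1, h2⟩
  rw [hump_of_le (by linarith), Real.smoothTransition.one_of_one_le (by linarith), mul_one, id]

theorem deriv_hump_nonneg {y : ℝ} (h0 : 0 ≤ y) (hy : y ≤ 3 / 4) : 0 ≤ deriv hump y := by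
  refine deriv_nonneg_of_monotoneOn (uniqueDiffOn_Icc (show (0 : ℝ) < 3 / 4 by norm_num)) contDiff_hump
    ?_ ⟨h0, hy⟩
  rintro x hx y hy hxy
  rcases eq_or_lt_of_le hxy with rfl | h
  · exact le_rfl
  · exact (hump_strictMono hx.1 h hy.2).le

theorem pinch_nonneg (y : ℝ) : 0 ≤ pinch y :=
  mul_nonneg (Real.smoothTransition.nonneg _) (Real.smoothTransition.nonneg _)

theorem pinch_le_one (y : ℝ) : pinch y ≤ 1 :=
  mul_le_one₀ (Real.smoothTransition.le_one _) (Real.smoothTransition.nonneg _)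
    (Real.smoothTransition.le_one _)

theorem pinch_of_le {y : ℝ} (hy : y ≤ 1 / 4) : pinch y = 0 := by
  rw [pinch, Real.smoothTransition.zero_of_nonpos (by linarith), zero_mul]

theorem pinch_of_ge {y : ℝ} (hy : 3 / 4 ≤ y) : pinch y = 0 := by
  rw [pinch, Real.smoothTransition.zero_of_nonpos (x := 6 - 8 * y) (by linarith), mul_zero]

theorem pinch_pos {y : ℝ} (h1 : 1 / 4 < y) (h2 : y < 3 / 4) : 0 < pinch y :=
  mul_pos (Real.smoothTransition.pos_of_pos (by linarith))
    (Real.smoothTransition.pos_of_pos (by linarith))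

theorem pinch_mid {y : ℝ} (h1 : 3 / 8 ≤ y) (h2 : y ≤ 5 / 8) : pinch y = 1 := by
  rw [pinch, Real.smoothTransition.one_of_one_le (by linarith),
    Real.smoothTransition.one_of_one_le (by linarith), mul_one]

theorem twist_of_le {y : ℝ} (hy : y ≤ 3 / 8) : twist y = 0 :=
  Real.smoothTransition.zero_of_nonpos (by linarith)

theorem twist_of_ge {y : ℝ} (hy : 5 / 8 ≤ y) : twist y = 1 :=
  Real.smoothTransition.one_of_one_le (by linarith)

theorem monotone_twist : Monotone twist := fun _ _ h => Real.smoothTransition.monotone (by linarith)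

theorem deriv_twist_nonneg (y : ℝ) : 0 ≤ deriv twist y := monotone_twist.deriv_nonneg

/-- Constants for the stabilization: the height `c` is small compared to the slope of the descent, and the
radius `ρ` is small compared to `c`. -/
theorem exists_stab_constants : ∃ c ρ : ℝ, 0 < c ∧ 0 < ρ ∧ ρ < 1 ∧
    (∀ y, 3 / 4 ≤ y → y ≤ 7 / 8 → -1 ≤ c * deriv hump y) ∧
    (∀ y, 3 / 8 ≤ y → y ≤ 5 / 8 → 2 * Real.pi * deriv twist y * ρ < c) := by
  obtain ⟨D₁, h₁⟩ := (isCompact_Icc (a := (0 : ℝ)) (b := 1)).exists_bound_of_continuousOn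
    (contDiff_hump.continuous_deriv (by simp)).continuousOn
  obtain ⟨D₂, h₂⟩ := (isCompact_Icc (a := (0 : ℝ)) (b := 1)).exists_bound_of_continuousOn
    (contDiff_twist.continuous_deriv (by simp)).continuousOn
  set D := max 1 (max D₁ D₂) with hD
  have hD1 : 1 ≤ D := le_max_left _ _
  have hDpos : 0 < D := by linarith
  refine ⟨1 / D, 1 / (8 * D ^ 2), by positivity, by positivity, ?_, ?_, ?_⟩
  · rw [div_lt_one (by positivity)]; nlinarith
  · intro y h h'
    have := (abs_le.1 ((h₁ y ⟨by linarith, by linarith⟩).trans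
      ((le_max_left D₁ D₂).trans (le_max_right 1 _)))).1
    rw [div_mul_eq_mul_div, le_div_iff₀ hDpos]
    linarith
  · intro y h h'
    have := (abs_le.1 ((h₂ y ⟨by linarith, by linarith⟩).trans
      ((le_max_right D₁ D₂).trans (le_max_right 1 _)))).2
    have hpi := Real.pi_lt_four
    have hpi' := Real.pi_pos
    have e : 2 * Real.pi * deriv twist y * (1 / (8 * D ^ 2)) =
        (2 * Real.pi * deriv twist y / (8 * D)) * (1 / D) := by field_simp
    rw [e]
    have : 2 * Real.pi * deriv twist y / (8 * D) < 1 := by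
      rw [div_lt_one (by positivity)]
      have h0 := deriv_twist_nonneg y
      nlinarith
    have hpos : 0 < 1 / D := by positivity
    nlinarith

/-- The function repeated with period `n`, increasing by `K` on each period. -/
noncomputable def repeatEvery (n : ℕ) (K : ℝ) (φ : ℝ → ℝ) (y : ℝ) : ℝ :=
  K * ⌊y / n⌋ + φ (y - n * ⌊y / n⌋)

section Repeat

variable {n : ℕ} {K : ℝ} {φ : ℝ → ℝ}

theorem floor_div_eq_zero {y : ℝ} (h0 : 0 ≤ y) (h1 : y < n) : ⌊y / n⌋ = 0 := by
  have : (0 : ℝ) < n := h0.trans_lt h1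
  rw [Int.floor_eq_zero_iff]
  exact ⟨by positivity, by rwa [div_lt_one this]⟩

theorem repeatEvery_of_mem {y : ℝ} (h0 : 0 ≤ y) (h1 : y < n) : repeatEvery n K φ y = φ y := by
  rw [repeatEvery, floor_div_eq_zero h0 h1]; simp

theorem floor_add_div (hn : 0 < n) (y : ℝ) : ⌊(y + n) / n⌋ = ⌊y / n⌋ + 1 := by
  have : (n : ℝ) ≠ 0 := by exact_mod_cast hn.ne'
  rw [add_div, div_self this, Int.floor_add_one]

theorem repeatEvery_add (hn : 0 < n) (y : ℝ) : repeatEvery n K φ (y + n) = repeatEvery n K φ y + K := by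
  rw [repeatEvery, repeatEvery, floor_add_div hn]
  push_cast
  rw [show y + n - n * ((⌊y / n⌋ : ℝ) + 1) = y - n * ⌊y / n⌋ by ring]
  ring

theorem repeatEvery_eventuallyEq (hn : 0 < n) (h0 : ∀ y ≤ 0, φ y = 0) (h1 : ∀ y, 7 / 8 ≤ y → φ y = K)
    (y : ℝ) : repeatEvery n K φ =ᶠ[nhds y] fun x => K * ⌊y / n⌋ + φ (x - n * ⌊y / n⌋) := by
  have hn1 : (1 : ℝ) ≤ n := by exact_mod_cast hn
  have hn0 : (0 : ℝ) < n := by linarith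
  have a := Int.floor_le (y / n)
  have b := Int.lt_floor_add_one (y / n)
  rw [le_div_iff₀ hn0] at a
  rw [div_lt_iff₀ hn0] at b
  filter_upwards [Ioo_mem_nhds (show (⌊y / n⌋ : ℝ) * n - 1 / 8 < y by linarith) b] with x hx
  rcases lt_or_ge x (⌊y / n⌋ * n) with h | h
  · have hf : ⌊x / n⌋ = ⌊y / n⌋ - 1 := by
      rw [Int.floor_eq_iff, le_div_iff₀ hn0, div_lt_iff₀ hn0]
      push_cast
      constructor
      · linarith [hx.1]
      · linarith
    rw [repeatEvery, hf, h0 (x - n * ⌊y / n⌋) (by linarith), h1]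
    · push_cast; ring
    · push_cast; linarith [hx.1]
  · have hf : ⌊x / n⌋ = ⌊y / n⌋ := by
      rw [Int.floor_eq_iff, le_div_iff₀ hn0, div_lt_iff₀ hn0]
      exact ⟨h, hx.2⟩
    rw [repeatEvery, hf]

theorem contDiff_repeatEvery (hn : 0 < n) (hφ : ContDiff ℝ ∞ φ) (h0 : ∀ y ≤ 0, φ y = 0)
    (h1 : ∀ y, 7 / 8 ≤ y → φ y = K) : ContDiff ℝ ∞ (repeatEvery n K φ) := by
  rw [contDiff_iff_contDiffAt]
  intro y
  refine ContDiffAt.congr_of_eventuallyEq ?_ (repeatEvery_eventuallyEq hn h0 h1 y)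
  exact (contDiff_const.add (hφ.comp (contDiff_id.sub contDiff_const))).contDiffAt

theorem hasDerivAt_repeatEvery (hn : 0 < n) (hφ : ContDiff ℝ ∞ φ) (h0 : ∀ y ≤ 0, φ y = 0)
    (h1 : ∀ y, 7 / 8 ≤ y → φ y = K) (y : ℝ) :
    HasDerivAt (repeatEvery n K φ) (deriv φ (y - n * ⌊y / n⌋)) y := by
  refine HasDerivAt.congr_of_eventuallyEq ?_ (repeatEvery_eventuallyEq hn h0 h1 y)
  have h2 := ((hφ.differentiable (by simp)) (y - n * ⌊y / n⌋)).hasDerivAt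
  simpa using (h2.comp_sub_const y (n * ⌊y / n⌋)).const_add (K * ⌊y / n⌋)

end Repeat

/-! ### Adding a small loop around the axis -/

/-- A loop on `n` strands that rests in the top position `n` on `[0, 7/8]`. -/
structure RestsOnTop (n : ℕ) (f : ℝ → ℝ × ℝ) : Prop where
  pos : 0 < n
  loop : IsLoop n f
  rest : ∀ y, 0 ≤ y → y ≤ 7 / 8 → f y = (0, (n : ℝ))
  le : ∀ y, (f y).2 ≤ n
  lt : ∀ y, 0 ≤ y → y ≤ 7 / 8 → ∀ j : ℕ, 0 < j → j < n → (f (y + j)).2 < n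

/-- The thickness `ε` is so small that the curve determined by the loop is transverse. -/
def ThinEnough (ε : ℝ) (f : ℝ → ℝ × ℝ) : Prop :=
  ∀ y, 0 < 1 + ε * (f y).1 ∧ 0 < (1 + ε * (f y).1) ^ 2 * (2 * Real.pi) + ε * deriv (fun y => (f y).2) y

theorem IsLoop.deriv_periodic_int {n : ℕ} {f : ℝ → ℝ × ℝ} (h : IsLoop n f) (y : ℝ) (m : ℤ) :
    deriv (fun y => (f y).2) (y + m * n) = deriv (fun y => (f y).2) y := by
  have e : (fun y => (f y).2) = fun x => (fun y => (f y).2) (x + m * n) := by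
    funext x
    exact congrArg Prod.snd (h.periodic_int x m).symm
  exact ((congrArg (fun g => deriv g y) e).trans (deriv_comp_add_const (fun y => (f y).2) _ y)).symm

theorem IsLoop.deriv_snd {n : ℕ} {f : ℝ → ℝ × ℝ} (h : IsLoop n f) (y : ℝ) :
    (deriv f y).2 = deriv (fun y => (f y).2) y :=
  (hasFDerivAt_snd.comp_hasDerivAt y
    ((h.smooth.differentiable (by simp)) y).hasDerivAt).deriv.symm

theorem exists_base {n : ℕ} (hn : 0 < n) (y : ℝ) :
    ∃ r : ℝ, ∃ m : ℤ, 0 ≤ r ∧ r < n ∧ y = r + m * n := by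
  have hn0 : (0 : ℝ) < n := by exact_mod_cast hn
  have a := Int.floor_le (y / n)
  have b := Int.lt_floor_add_one (y / n)
  rw [le_div_iff₀ hn0] at a
  rw [div_lt_iff₀ hn0] at b
  exact ⟨y - ⌊y / n⌋ * n, ⌊y / n⌋, by linarith, by linarith, by ring⟩

/-- It suffices to look at the part of a loop over one period. -/
theorem IsLoop.of_base {n : ℕ} (hn : 0 < n) {f : ℝ → ℝ × ℝ} (hf : ContDiff ℝ ∞ f)
    (hper : ∀ y, f (y + n) = f y)
    (h : ∀ x : ℝ, 0 ≤ x → ∀ j : ℕ, 0 < j → x + j < n → f (x + j) ≠ f x) : IsLoop n f := by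
  refine ⟨hf, hper, fun y j hj hjn => ?_⟩
  obtain ⟨r, m, h0, h1, rfl⟩ := exists_base hn y
  have hp : ∀ x, f (x + m * n) = f x := (show Function.Periodic f n from hper).int_mul m
  rw [add_right_comm, hp, hp]
  rcases lt_or_ge (r + j) n with hlt | hge
  · exact h r h0 j hj hlt
  · have e := h (r + j - n) (by linarith) (n - j) (by omega)
      (by rw [Nat.cast_sub hjn.le]; linarith)
    have e1 : r + j - n + (n - j : ℕ) = r := by rw [Nat.cast_sub hjn.le]; ring
    have e2 := hper (r + j - n)
    rw [sub_add_cancel] at e2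
    rw [e1, ← e2] at e
    exact e.symm

theorem IsLoop.isTransverseParam_of_base {n : ℕ} (hn : 0 < n) {f : ℝ → ℝ × ℝ} (h : IsLoop n f)
    (hr : ∀ x : ℝ, 0 ≤ x → x < n → 0 < 1 + (f x).1)
    (ht : ∀ x : ℝ, 0 ≤ x → x < n →
      0 < (1 + (f x).1) ^ 2 * (2 * Real.pi) + deriv (fun y => (f y).2) x) :
    IsTransverseParam (knotOf 1 n f) := by
  refine h.isTransverseParam hn one_pos (fun y => ?_) fun y => ?_
  · obtain ⟨r, m, h0, h1, rfl⟩ := exists_base hn y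
    rw [h.periodic_int, one_mul]
    exact hr r h0 h1
  · obtain ⟨r, m, h0, h1, rfl⟩ := exists_base hn y
    rw [h.deriv_snd, h.deriv_periodic_int, h.periodic_int, one_mul, one_mul]
    exact ht r h0 h1

theorem IsLoop.exists_thinEnough {n : ℕ} (hn : 0 < n) {f : ℝ → ℝ × ℝ} (h : IsLoop n f) :
    ∃ ε₀ : ℝ, 0 < ε₀ ∧ ∀ ε, 0 < ε → ε < ε₀ → ThinEnough ε f := by
  obtain ⟨M₁, h₁⟩ := (isCompact_Icc (a := (0 : ℝ)) (b := n)).exists_bound_of_continuousOn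
    h.smooth.fst.continuous.continuousOn
  obtain ⟨M₂, h₂⟩ := (isCompact_Icc (a := (0 : ℝ)) (b := n)).exists_bound_of_continuousOn
    (h.smooth.snd.continuous_deriv (by simp)).continuousOn
  set M := max 1 (max M₁ M₂) with hM
  have hM1 : 1 ≤ M := le_max_left _ _
  refine ⟨1 / (2 * M), by positivity, fun ε hε hεM y => ?_⟩
  rw [lt_div_iff₀ (by positivity)] at hεM
  obtain ⟨r, m, h0, hr, rfl⟩ := exists_base hn y
  rw [h.periodic_int, h.deriv_periodic_int]
  have b1 := (abs_le.1 ((h₁ r ⟨h0, hr.le⟩).trans ((le_max_left M₁ M₂).trans (le_max_right 1 _)))).1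
  have b2 := (abs_le.1 ((h₂ r ⟨h0, hr.le⟩).trans ((le_max_right M₁ M₂).trans (le_max_right 1 _)))).1
  have c1 : 1 / 2 < 1 + ε * (f r).1 := by nlinarith
  have c2 : (1 / 4 : ℝ) < (1 + ε * (f r).1) ^ 2 := by nlinarith
  have c3 : -(1 / 2) ≤ ε * deriv (fun y => (f y).2) r := by nlinarith
  exact ⟨by linarith, by nlinarith [Real.pi_gt_three]⟩

theorem rotForm_spiral (R A B m θ φ z R' m' θ' φ' z' : ℝ) :
    rotForm (R * (A * Real.cos θ + B * m * Real.cos (θ + φ)),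
        R * (A * Real.sin θ + B * m * Real.sin (θ + φ)), z)
      (R' * (A * Real.cos θ + B * m * Real.cos (θ + φ)) +
          R * (A * (-Real.sin θ * θ') + (B * m' * Real.cos (θ + φ) +
            B * m * (-Real.sin (θ + φ) * (θ' + φ')))),
        R' * (A * Real.sin θ + B * m * Real.sin (θ + φ)) +
          R * (A * (Real.cos θ * θ') + (B * m' * Real.sin (θ + φ) +
            B * m * (Real.cos (θ + φ) * (θ' + φ')))), z') =
      R ^ 2 * (A ^ 2 * θ' + B ^ 2 * m ^ 2 * (θ' + φ') + A * B * m * Real.cos φ * (2 * θ' + φ') +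
        A * B * m' * Real.sin φ) + z' := by
  have h1 := Real.sin_sq_add_cos_sq θ
  have h2 := Real.sin_sq_add_cos_sq (θ + φ)
  have h3 : Real.cos φ = Real.cos θ * Real.cos (θ + φ) + Real.sin θ * Real.sin (θ + φ) := by
    rw [Real.cos_add, Real.sin_add]; linear_combination (-Real.cos φ) * h1
  have h4 : Real.sin φ = Real.cos θ * Real.sin (θ + φ) - Real.sin θ * Real.cos (θ + φ) := by
    rw [Real.cos_add, Real.sin_add]; linear_combination (-Real.sin φ) * h1
  simp only [rotForm]
  rw [h3, h4]
  linear_combination (R ^ 2 * A ^ 2 * θ') * h1 + (R ^ 2 * B ^ 2 * m ^ 2 * (θ' + φ')) * h2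

/-- The curve over the loop `f` whose top strand is raised by the height profile and pushed, for `B = 1`,
to the curve of radius profile `1 - (1 - ρ) pinch` that turns once more around the axis. Here `y`
counts the turns. -/
noncomputable def spiral (n : ℕ) (f : ℝ → ℝ × ℝ) (ε ρ c B y : ℝ) : ℝ × ℝ × ℝ :=
  ((1 + ε * (f y).1) * ((1 - B) * Real.cos (2 * Real.pi * y) +
      B * (1 - (1 - ρ) * repeatEvery n 0 pinch y) *
        Real.cos (2 * Real.pi * y + 2 * Real.pi * repeatEvery n 1 twist y)),
    (1 + ε * (f y).1) * ((1 - B) * Real.sin (2 * Real.pi * y) +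
      B * (1 - (1 - ρ) * repeatEvery n 0 pinch y) *
        Real.sin (2 * Real.pi * y + 2 * Real.pi * repeatEvery n 1 twist y)),
    ε * (f y).2 + c * repeatEvery n 0 hump y)

section Spiral

variable {n : ℕ} {f : ℝ → ℝ × ℝ} {ε ρ c c₀ B : ℝ}

theorem RestsOnTop.one_le (h : RestsOnTop n f) : (1 : ℝ) ≤ n := by exact_mod_cast h.pos

theorem contDiff_repeat_hump (hn : 0 < n) : ContDiff ℝ ∞ (repeatEvery n 0 hump) :=
  contDiff_repeatEvery hn contDiff_hump (fun _ h => hump_of_le_zero h) fun _ h => hump_of_ge h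

theorem contDiff_repeat_pinch (hn : 0 < n) : ContDiff ℝ ∞ (repeatEvery n 0 pinch) :=
  contDiff_repeatEvery hn contDiff_pinch (fun _ h => pinch_of_le (by linarith))
    fun _ h => pinch_of_ge (by linarith)

theorem contDiff_repeat_twist (hn : 0 < n) : ContDiff ℝ ∞ (repeatEvery n 1 twist) :=
  contDiff_repeatEvery hn contDiff_twist (fun _ h => twist_of_le (by linarith))
    fun _ h => twist_of_ge (by linarith)

theorem contDiff_spiral (h : RestsOnTop n f) {E : Type*} [NormedAddCommGroup E] [NormedSpace ℝ E]
    {C b y : E → ℝ} (hC : ContDiff ℝ ∞ C) (hb : ContDiff ℝ ∞ b) (hy : ContDiff ℝ ∞ y) :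
    ContDiff ℝ ∞ fun x => spiral n f ε ρ (C x) (b x) (y x) := by
  have hf : ContDiff ℝ ∞ fun x => f (y x) := h.loop.smooth.comp hy
  have h1 : ContDiff ℝ ∞ fun x => 1 + ε * (f (y x)).1 := contDiff_const.add (contDiff_const.mul hf.fst)
  have h2 : ContDiff ℝ ∞ fun x => b x * (1 - (1 - ρ) * repeatEvery n 0 pinch (y x)) :=
    hb.mul (contDiff_const.sub (contDiff_const.mul ((contDiff_repeat_pinch h.pos).comp hy)))
  have h3 : ContDiff ℝ ∞ fun x => 2 * Real.pi * y x := contDiff_const.mul hy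
  have h4 : ContDiff ℝ ∞ fun x => 2 * Real.pi * y x + 2 * Real.pi * repeatEvery n 1 twist (y x) :=
    h3.add (contDiff_const.mul ((contDiff_repeat_twist h.pos).comp hy))
  have h5 : ContDiff ℝ ∞ fun x => 1 - b x := contDiff_const.sub hb
  exact (h1.mul ((h5.mul h3.cos).add (h2.mul h4.cos))).prodMk
    ((h1.mul ((h5.mul h3.sin).add (h2.mul h4.sin))).prodMk
      ((contDiff_const.mul hf.snd).add (hC.mul ((contDiff_repeat_hump h.pos).comp hy))))

theorem spiral_add (h : RestsOnTop n f) (y : ℝ) : spiral n f ε ρ c B (y + n) = spiral n f ε ρ c B y := by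
  have e1 : 2 * Real.pi * (y + n) = 2 * Real.pi * y + n * (2 * Real.pi) := by ring
  have e2 : 2 * Real.pi * (y + n) + 2 * Real.pi * (repeatEvery n 1 twist y + 1) =
      2 * Real.pi * y + 2 * Real.pi * repeatEvery n 1 twist y + (n + 1 : ℕ) * (2 * Real.pi) := by
    push_cast; ring
  simp only [spiral]
  rw [h.loop.periodic, repeatEvery_add h.pos, repeatEvery_add h.pos, repeatEvery_add h.pos, e2, e1,
    Real.cos_add_nat_mul_two_pi, Real.sin_add_nat_mul_two_pi, Real.cos_add_nat_mul_two_pi,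
    Real.sin_add_nat_mul_two_pi, add_zero, add_zero]

theorem RestsOnTop.deriv_eq (h : RestsOnTop n f) {y : ℝ} (h0 : 0 ≤ y) (h1 : y ≤ 7 / 8) :
    deriv (fun y => (f y).2) y = 0 :=
  deriv_eq_zero_of_const (uniqueDiffOn_Icc (show (0 : ℝ) < 7 / 8 by norm_num)) h.loop.smooth.snd
    (c := n) (fun y hy => by rw [h.rest y hy.1 hy.2]) ⟨h0, h1⟩

theorem hasDerivAt_spiral (h : RestsOnTop n f) (y : ℝ) :
    ∃ v, HasDerivAt (spiral n f ε ρ c B) v y ∧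
      rotForm (spiral n f ε ρ c B y) v =
        (1 + ε * (f y).1) ^ 2 * ((1 - B) ^ 2 * (2 * Real.pi) +
          B ^ 2 * (1 - (1 - ρ) * repeatEvery n 0 pinch y) ^ 2 *
            (2 * Real.pi + 2 * Real.pi * deriv twist (y - n * ⌊y / n⌋)) +
          (1 - B) * B * (1 - (1 - ρ) * repeatEvery n 0 pinch y) *
            Real.cos (2 * Real.pi * repeatEvery n 1 twist y) *
            (2 * (2 * Real.pi) + 2 * Real.pi * deriv twist (y - n * ⌊y / n⌋)) +
          (1 - B) * B * (-((1 - ρ) * deriv pinch (y - n * ⌊y / n⌋))) *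
            Real.sin (2 * Real.pi * repeatEvery n 1 twist y)) +
        (ε * deriv (fun y => (f y).2) y + c * deriv hump (y - n * ⌊y / n⌋)) := by
  have hu := ((h.loop.smooth.fst.differentiable (by simp)) y).hasDerivAt
  have hv := ((h.loop.smooth.snd.differentiable (by simp)) y).hasDerivAt
  have hH := hasDerivAt_repeatEvery h.pos contDiff_hump (K := 0) (fun _ h => hump_of_le_zero h)
    (fun _ h => hump_of_ge h) y
  have hP := hasDerivAt_repeatEvery h.pos contDiff_pinch (K := 0)
    (fun _ h => pinch_of_le (by linarith)) (fun _ h => pinch_of_ge (by linarith)) y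
  have hT := hasDerivAt_repeatEvery h.pos contDiff_twist (K := 1)
    (fun _ h => twist_of_le (by linarith)) (fun _ h => twist_of_ge (by linarith)) y
  have h1 := (hu.const_mul ε).const_add 1
  have h2 := ((hP.const_mul (1 - ρ)).const_sub 1).const_mul B
  have h3 : HasDerivAt (fun y => 2 * Real.pi * y) (2 * Real.pi) y := by
    simpa using (hasDerivAt_id y).const_mul (2 * Real.pi)
  have h4 := h3.add (hT.const_mul (2 * Real.pi))
  have h5 := h1.mul ((h3.cos.const_mul (1 - B)).add (h2.mul h4.cos))
  have h6 := h1.mul ((h3.sin.const_mul (1 - B)).add (h2.mul h4.sin))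
  have h7 := (hv.const_mul ε).add (hH.const_mul c)
  exact ⟨_, h5.prodMk (h6.prodMk h7), rotForm_spiral _ _ _ _ _ _ _ _ _ _ _ _⟩

/-- The contact form on the part with the additional turn: up to the nonnegative terms it is the rise
`c` minus `2πτρ(1 - B)B`, and the radius `ρ` has been chosen to make the latter smaller. -/
theorem middle_pos {ρ τ κ c c₀ B : ℝ} (hρ : 0 < ρ) (hτ : 0 ≤ τ) (hκ : -1 ≤ κ)
    (ht : 2 * Real.pi * τ * ρ < c₀) (hB0 : 0 ≤ B) (hB1 : B ≤ 1) (hc : 0 ≤ c) (hBc : B = 0 ∨ c₀ ≤ c) :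
    0 < (1 - B) ^ 2 * (2 * Real.pi) + B ^ 2 * ρ ^ 2 * (2 * Real.pi + 2 * Real.pi * τ) +
      (1 - B) * B * ρ * κ * (2 * (2 * Real.pi) + 2 * Real.pi * τ) + c := by
  have hpi := Real.pi_pos
  rcases hBc with rfl | hBc
  · have : (1 - 0 : ℝ) ^ 2 * (2 * Real.pi) + 0 ^ 2 * ρ ^ 2 * (2 * Real.pi + 2 * Real.pi * τ) +
      (1 - 0) * 0 * ρ * κ * (2 * (2 * Real.pi) + 2 * Real.pi * τ) + c = 2 * Real.pi + c := by ring
    rw [this]; positivity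
  · have e1 : (1 - B) ^ 2 * (2 * Real.pi) + B ^ 2 * ρ ^ 2 * (2 * Real.pi + 2 * Real.pi * τ) +
        (1 - B) * B * ρ * κ * (2 * (2 * Real.pi) + 2 * Real.pi * τ) + c =
        2 * Real.pi * (1 - B - B * ρ) ^ 2 + 4 * Real.pi * ((1 - B) * (B * ρ) * (1 + κ)) +
        2 * Real.pi * τ * (B * ρ) ^ 2 + 2 * Real.pi * τ * ((1 - B) * (B * ρ) * (1 + κ)) +
        (c - 2 * Real.pi * τ * ρ * ((1 - B) * B)) := by ring
    rw [e1]
    have hBB1 : (1 - B) * B ≤ 1 := by nlinarith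
    have t1 : 0 ≤ (1 - B) * (B * ρ) * (1 + κ) :=
      mul_nonneg (mul_nonneg (by linarith) (by positivity)) (by linarith)
    have t2 : 0 ≤ 2 * Real.pi * τ * ρ := by positivity
    have t3 := mul_le_mul_of_nonneg_left hBB1 t2
    have t4 : 0 ≤ 2 * Real.pi * (1 - B - B * ρ) ^ 2 := by positivity
    have t5 : 0 ≤ 2 * Real.pi * τ * (B * ρ) ^ 2 := by positivity
    have t6 : 0 ≤ 2 * Real.pi * τ * ((1 - B) * (B * ρ) * (1 + κ)) := mul_nonneg (by positivity) t1
    have t7 : 0 ≤ 4 * Real.pi * ((1 - B) * (B * ρ) * (1 + κ)) := mul_nonneg (by positivity) t1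
    linarith

/-- Positivity of the contact form on the curve: where the curve turns around the axis its radius is so
small that the rise dominates, and elsewhere the angle grows at least as before. -/
theorem rotForm_spiral_pos (h : RestsOnTop n f) (hε : ThinEnough ε f) (hρ0 : 0 < ρ) (hρ1 : ρ < 1)
    (hc0 : 0 ≤ c) (hcc : c ≤ c₀)
    (hw : ∀ y, 3 / 4 ≤ y → y ≤ 7 / 8 → -1 ≤ c₀ * deriv hump y)
    (ht : ∀ y, 3 / 8 ≤ y → y ≤ 5 / 8 → 2 * Real.pi * deriv twist y * ρ < c₀)
    (hB0 : 0 ≤ B) (hB1 : B ≤ 1) (hBc : B = 0 ∨ c = c₀) (y : ℝ) :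
    0 < rotForm (spiral n f ε ρ c B y) (deriv (spiral n f ε ρ c B) y) := by
  obtain ⟨v, hv, e⟩ := hasDerivAt_spiral (ε := ε) (ρ := ρ) (c := c) (B := B) h y
  rw [hv.deriv, e]
  have hpi := Real.pi_gt_three
  have hn0 : (0 : ℝ) < n := by linarith [h.one_le]
  set r := y - n * ⌊y / n⌋ with hr
  have hr0 : 0 ≤ r := by
    have := Int.floor_le (y / n)
    rw [le_div_iff₀ hn0] at this
    linarith
  have hfr : f y = f r := by
    have := h.loop.periodic_int r ⌊y / n⌋
    rw [← this, hr]; congr 1; ring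
  have hvr : deriv (fun y => (f y).2) y = deriv (fun y => (f y).2) r := by
    rw [← h.loop.deriv_periodic_int r ⌊y / n⌋, hr]; congr 1; ring
  have hPr : repeatEvery n 0 pinch y = pinch r := by rw [repeatEvery, zero_mul, zero_add]
  have hTr : ∃ k : ℤ, repeatEvery n 1 twist y = twist r + k := ⟨⌊y / n⌋, by rw [repeatEvery]; ring⟩
  obtain ⟨k, hk⟩ := hTr
  have hang : 2 * Real.pi * (twist r + k) = 2 * Real.pi * twist r + k * (2 * Real.pi) := by ring
  rw [hfr, hvr, hPr, hk, hang, Real.cos_add_int_mul_two_pi, Real.sin_add_int_mul_two_pi]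
  have hT0 := deriv_twist_nonneg r
  by_cases hmid : 3 / 8 ≤ r ∧ r ≤ 5 / 8
  · obtain ⟨m1, m2⟩ := hmid
    have hp' : deriv pinch r = 0 := deriv_eq_zero_of_const
      (uniqueDiffOn_Icc (show (3 / 8 : ℝ) < 5 / 8 by norm_num)) contDiff_pinch
      (fun y hy => pinch_mid hy.1 hy.2) ⟨m1, m2⟩
    rw [h.rest r (by linarith) (by linarith), h.deriv_eq (by linarith) (by linarith), pinch_mid m1 m2,
      hp', deriv_hump_mid m1 m2]
    simp only [mul_zero, add_zero, neg_zero, mul_one, zero_add, one_pow, one_mul, sub_sub_cancel,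
      zero_mul]
    exact middle_pos hρ0 hT0 (Real.neg_one_le_cos _) (ht r m1 m2) hB0 hB1 hc0
      (hBc.imp id fun h => h.ge)
  · -- away from the turn around the axis the additional angle is constant
    have hcs : Real.cos (2 * Real.pi * twist r) = 1 ∧ Real.sin (2 * Real.pi * twist r) = 0 ∧
        deriv twist r = 0 := by
      rcases le_or_gt r (3 / 8) with hr' | hr'
      · rw [twist_of_le hr', deriv_eq_zero_of_const (uniqueDiffOn_Iic (3 / 8 : ℝ)) contDiff_twist
          (fun y hy => twist_of_le hy) hr']
        simp
      · have hr'' : 5 / 8 ≤ r := by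
          by_contra! hcon
          exact hmid ⟨hr'.le, hcon.le⟩
        rw [twist_of_ge hr'', deriv_eq_zero_of_const (uniqueDiffOn_Ici (5 / 8 : ℝ)) contDiff_twist
          (fun y hy => twist_of_ge hy) hr'']
        simp
    rw [hcs.1, hcs.2.1, hcs.2.2]
    set m := 1 - (1 - ρ) * pinch r with hm
    have hm0 : 0 < m := by
      have := pinch_le_one r
      have := pinch_nonneg r
      nlinarith
    have e1 : (1 - B) ^ 2 * (2 * Real.pi) + B ^ 2 * m ^ 2 * (2 * Real.pi + 2 * Real.pi * 0) +
        (1 - B) * B * m * 1 * (2 * (2 * Real.pi) + 2 * Real.pi * 0) +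
        (1 - B) * B * (-((1 - ρ) * deriv pinch r)) * 0 = (1 - B + B * m) ^ 2 * (2 * Real.pi) := by ring
    rw [e1]
    have hpos : 0 < 1 - B + B * m := by
      rcases eq_or_lt_of_le hB1 with rfl | hB
      · linarith
      · have := mul_nonneg hB0 hm0.le; linarith
    rcases le_or_gt r (7 / 8) with h8 | h8
    · rw [h.rest r hr0 h8, h.deriv_eq hr0 h8]
      simp only [mul_zero, add_zero, one_pow, one_mul, zero_add]
      rcases le_or_gt r (3 / 4) with h4 | h4
      · have := mul_nonneg hc0 (deriv_hump_nonneg hr0 h4)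
        positivity
      · have hm1 : m = 1 := by rw [hm, pinch_of_ge h4.le]; ring
        have h1 := hw r h4.le h8
        have h2 : -1 ≤ c * deriv hump r := by
          rcases le_total 0 (deriv hump r) with h3 | h3
          · have := mul_nonneg hc0 h3; linarith
          · have := mul_le_mul_of_nonpos_right hcc h3; linarith
        rw [hm1]
        have : (1 - B + B * 1) ^ 2 = 1 := by ring
        rw [this]; linarith
    · have hm1 : m = 1 := by rw [hm, pinch_of_ge (by linarith)]; ring
      have hd : deriv hump r = 0 := deriv_eq_zero_of_const (uniqueDiffOn_Ici (7 / 8 : ℝ)) contDiff_hump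
        (fun y hy => hump_of_ge hy) h8.le
      rw [hm1, hd]
      have := (hε r).2
      have e2 : (1 - B + B * 1) ^ 2 = 1 := by ring
      rw [e2]; linarith

/-- A point at distance `1` from the axis, moved part of the way towards a point at distance `m < 1`, comes
to lie at a distance less than `1`; here `κ` is the cosine of the angle between the two points. -/
theorem pushed_lt_one {B m κ : ℝ} (hB : 0 < B) (hB1 : B ≤ 1) (hm0 : 0 < m) (hm1 : m < 1) (hκ : κ ≤ 1) :
    (1 - B) ^ 2 + (B * m) ^ 2 + 2 * ((1 - B) * (B * m)) * κ < 1 := by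
  have h1 : 0 ≤ (1 - B) * (B * m) := mul_nonneg (by linarith) (by positivity)
  have h2 := mul_le_mul_of_nonneg_left hκ h1
  have h3 : 0 < B * (1 - m) := mul_pos hB (by linarith)
  have h4 : B * (1 - m) < 2 := by nlinarith
  have h5 := mul_pos h3 (sub_pos.2 h4)
  nlinarith

/-- The curve is embedded: the raised strand is strictly rising as long as it may leave its angle, and on
its descent it stays outside the part that has been pushed inwards. -/
theorem injOn_spiral (h : RestsOnTop n f) (hε0 : 0 < ε) (hε : ThinEnough ε f) (hρ0 : 0 < ρ)
    (hρ1 : ρ < 1) (hc0 : 0 ≤ c) (hB0 : 0 ≤ B) (hB1 : B ≤ 1) (hBc : B = 0 ∨ 0 < c) :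
    Set.InjOn (spiral n f ε ρ c B) (Set.Ico 0 n) := by
  have hn1 := h.one_le
  -- off the region of the additional turn the curve is a graph over the angle
  have hplain : ∀ y : ℝ, 0 ≤ y → y < n → (B = 0 ∨ y ≤ 1 / 4 ∨ 3 / 4 ≤ y) →
      spiral n f ε ρ c B y = nearCircle 1 (2 * Real.pi * y) (ε * (f y).1, ε * (f y).2 + c * hump y) := by
    intro y h0 h1 hy
    simp only [spiral, nearCircle, one_mul]
    rw [repeatEvery_of_mem h0 h1, repeatEvery_of_mem h0 h1, repeatEvery_of_mem h0 h1]
    rcases hy with rfl | hy | hy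
    · simp
    · rw [pinch_of_le hy, twist_of_le (by linarith)]
      simp only [mul_zero, add_zero, sub_zero, mul_one]
      rw [← add_mul, ← add_mul, sub_add_cancel, one_mul, one_mul]
    · rw [pinch_of_ge hy, twist_of_ge (by linarith)]
      simp only [mul_zero, sub_zero, mul_one]
      rw [Real.cos_add_two_pi, Real.sin_add_two_pi, ← add_mul, ← add_mul, sub_add_cancel, one_mul,
        one_mul]
  -- two points of the graph over the same angle: the raised strand only moved away from the others
  have hboth : ∀ y y' : ℝ, 0 ≤ y → y < y' → y' < n → (B = 0 ∨ y ≤ 1 / 4 ∨ 3 / 4 ≤ y) →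
      (B = 0 ∨ y' ≤ 1 / 4 ∨ 3 / 4 ≤ y') → spiral n f ε ρ c B y ≠ spiral n f ε ρ c B y' := by
    intro y y' h0 hlt h1 hy hy' e
    rw [hplain y h0 (hlt.trans h1) hy, hplain y' (h0.trans hlt.le) h1 hy'] at e
    obtain ⟨e1, j, hj⟩ := nearCircle_inj one_pos (by simpa using (hε y).1) (by simpa using (hε y').1) e
    have hpi := Real.pi_pos
    have hj' : y' = y + j := by
      have : 2 * Real.pi * y' = 2 * Real.pi * (y + j) := by linarith
      exact mul_left_cancel₀ (by positivity) this
    have hj0 : (0 : ℤ) < j := by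
      have : (0 : ℝ) < j := by linarith
      exact_mod_cast this
    lift j to ℕ using hj0.le
    have hj0' : 0 < j := by exact_mod_cast hj0
    have hj1 : (1 : ℝ) ≤ j := by exact_mod_cast hj0'
    have hjn : j < n := by
      have : (j : ℝ) < n := by push_cast at hj'; linarith
      exact_mod_cast this
    push_cast at hj'
    obtain ⟨e2, e3⟩ := Prod.ext_iff.1 e1
    simp only at e2 e3
    rw [hump_of_ge (show 7 / 8 ≤ y' by linarith), mul_zero, add_zero] at e3
    rcases le_or_gt y (7 / 8) with h8 | h8
    · have h2 := h.lt y h0 h8 j hj0' hjn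
      rw [← hj'] at h2
      rw [h.rest y h0 h8] at e3
      have h3 := mul_nonneg hc0 (hump_nonneg h0)
      have h4 := mul_lt_mul_of_pos_left h2 hε0
      simp only at e3
      linarith
    · rw [hump_of_ge h8.le, mul_zero, add_zero] at e3
      refine h.loop.ne y j hj0' hjn ?_
      rw [← hj']
      exact Prod.ext (mul_left_cancel₀ hε0.ne' e2.symm) (mul_left_cancel₀ hε0.ne' e3.symm)
  -- a point that has been pushed: on the rise the heights are distinct, a point of the descent has a
  -- greater distance from the axis, and the remaining curve lies lower
  have hone : ∀ p q : ℝ, 0 < B → 1 / 4 < p → p < 3 / 4 → 0 ≤ q → q < n → p ≠ q →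
      spiral n f ε ρ c B p ≠ spiral n f ε ρ c B q := by
    intro p q hB hp1 hp2 hq0 hq1 hpq e
    have hc : 0 < c := hBc.resolve_left hB.ne'
    have hz : ε * (f p).2 + c * hump p = ε * (f q).2 + c * hump q := by
      have := congrArg (fun x : ℝ × ℝ × ℝ => x.2.2) e
      simp only [spiral] at this
      rwa [repeatEvery_of_mem hq0 hq1, repeatEvery_of_mem (by linarith) (by linarith)] at this
    rw [h.rest p (by linarith) (by linarith)] at hz
    simp only at hz
    rcases le_or_gt q (3 / 4) with hq2 | hq2
    · rw [h.rest q hq0 (by linarith)] at hz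
      have hz' : hump p = hump q := mul_left_cancel₀ hc.ne' (by linarith)
      rcases lt_or_gt_of_ne hpq with hlt | hlt
      · exact (hump_strictMono (by linarith) hlt hq2).ne hz'
      · exact (hump_strictMono hq0 hlt hp2.le).ne hz'.symm
    rcases le_or_gt q (7 / 8) with hq3 | hq3
    · -- compare the distances from the axis
      rw [hplain q hq0 hq1 (Or.inr (Or.inr hq2.le))] at e
      have e1 := congrArg (fun x : ℝ × ℝ × ℝ => x.1 ^ 2 + x.2.1 ^ 2) e
      simp only [spiral, nearCircle] at e1
      rw [h.rest p (by linarith) (by linarith), h.rest q hq0 hq3,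
        repeatEvery_of_mem (by linarith) (by linarith)] at e1
      set θ := 2 * Real.pi * p
      set θ' := 2 * Real.pi * p + 2 * Real.pi * repeatEvery n 1 twist p
      set m := 1 - (1 - ρ) * pinch p with hm
      have hm1 : m < 1 := by
        have := mul_pos (sub_pos.2 hρ1) (pinch_pos hp1 hp2)
        linarith
      have hm0 : 0 < m := by
        have := pinch_le_one p
        have := pinch_nonneg p
        nlinarith
      have s1 := Real.sin_sq_add_cos_sq θ
      have s2 := Real.sin_sq_add_cos_sq θ'
      have s3 := Real.sin_sq_add_cos_sq (2 * Real.pi * q)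
      have s4 : Real.cos θ * Real.cos θ' + Real.sin θ * Real.sin θ' ≤ 1 := by
        rw [← Real.cos_sub]; exact Real.cos_le_one _
      refine (pushed_lt_one hB hB1 hm0 hm1 s4).ne ?_
      linear_combination e1 + s3 - (1 - B) ^ 2 * s1 - (B * m) ^ 2 * s2
    · rw [hump_of_ge hq3.le] at hz
      have h1 := mul_pos hc (hump_pos (by linarith) hp2.le)
      have h2 := mul_le_mul_of_nonneg_left (h.le q) hε0.le
      linarith
  intro y hy y' hy' e
  by_contra hne
  by_cases hyp : B = 0 ∨ y ≤ 1 / 4 ∨ 3 / 4 ≤ y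
  · by_cases hyp' : B = 0 ∨ y' ≤ 1 / 4 ∨ 3 / 4 ≤ y'
    · rcases lt_or_gt_of_ne hne with hlt | hlt
      · exact hboth y y' hy.1 hlt hy'.2 hyp hyp' e
      · exact hboth y' y hy'.1 hlt hy.2 hyp' hyp e.symm
    · push Not at hyp'
      exact hone y' y (lt_of_le_of_ne hB0 (Ne.symm hyp'.1)) hyp'.2.1 hyp'.2.2 hy.1 hy.2 (Ne.symm hne)
        e.symm
  · push Not at hyp
    exact hone y y' (lt_of_le_of_ne hB0 (Ne.symm hyp.1)) hyp.2.1 hyp.2.2 hy'.1 hy'.2 hne e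

theorem isTransverseParam_spiral (h : RestsOnTop n f) (hε0 : 0 < ε) (hε : ThinEnough ε f) (hρ0 : 0 < ρ)
    (hρ1 : ρ < 1) (hc0 : 0 ≤ c) (hcc : c ≤ c₀) (hc₀ : 0 < c₀)
    (hw : ∀ y, 3 / 4 ≤ y → y ≤ 7 / 8 → -1 ≤ c₀ * deriv hump y)
    (ht : ∀ y, 3 / 8 ≤ y → y ≤ 5 / 8 → 2 * Real.pi * deriv twist y * ρ < c₀)
    (hB0 : 0 ≤ B) (hB1 : B ≤ 1) (hBc : B = 0 ∨ c = c₀) :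
    IsTransverseParam fun t => spiral n f ε ρ c B (n * t) := by
  have hn0 : (0 : ℝ) < n := by linarith [h.one_le]
  have hs : ContDiff ℝ ∞ (spiral n f ε ρ c B) :=
    contDiff_spiral h contDiff_const contDiff_const contDiff_id
  refine ⟨hs.comp (contDiff_const.mul contDiff_id), fun t => ?_, fun t ht' s hs' e => ?_, fun t => ?_⟩
  · rw [mul_add, mul_one, spiral_add h]
  · have key : ∀ t ∈ Set.Ico (0 : ℝ) 1, (n : ℝ) * t ∈ Set.Ico (0 : ℝ) n := fun t ht =>
      ⟨mul_nonneg hn0.le ht.1, mul_lt_of_lt_one_right hn0 ht.2⟩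
    exact mul_left_cancel₀ hn0.ne' (injOn_spiral h hε0 hε hρ0 hρ1 hc0 hB0 hB1
      (hBc.imp id fun h => by rw [h]; exact hc₀) (key t ht') (key s hs') e)
  · have h1 : HasDerivAt (spiral n f ε ρ c B) _ (n * t) :=
      ((hs.differentiable (by simp)) (n * t)).hasDerivAt
    have h2 : HasDerivAt (fun t : ℝ => (n : ℝ) * t) n t := by
      simpa using (hasDerivAt_id t).const_mul (n : ℝ)
    have h3 := (h1.scomp t h2).deriv
    simp only [Function.comp_def] at h3
    rw [h3]
    have h4 := rotForm_spiral_pos h hε hρ0 hρ1 hc0 hcc hw ht hB0 hB1 hBc (n * t)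
    have h5 : ∀ p v : ℝ × ℝ × ℝ, rotForm p ((n : ℝ) • v) = n * rotForm p v := by
      intro p v; simp [rotForm]; ring
    rw [h5]
    exact mul_pos hn0 h4

end Spiral

/-! ### From the additional turn to an additional strand -/

/-- The loop `g` on `n + 1` strands runs like `f` except that on its first two turns it first rises from
position `n` to position `n + 1` on the inner side and then returns on the outer side. -/
structure IsStabilizedLoop (n : ℕ) (f g : ℝ → ℝ × ℝ) : Prop where
  loop : IsLoop (n + 1) g
  low : ∀ x, 0 ≤ x → x ≤ 3 / 4 → g x = (0, (n : ℝ))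
  up : ∀ x, 3 / 4 ≤ x → x ≤ 7 / 8 → (g x).1 ≤ 0 ∧ (n : ℝ) ≤ (g x).2
  mono : MonotoneOn (fun x => (g x).2) (Set.Icc 0 (7 / 4))
  high : ∀ x, 7 / 8 ≤ x → x ≤ 7 / 4 → g x = (0, (n : ℝ) + 1)
  down : ∀ x, 7 / 4 ≤ x → x ≤ 15 / 8 → 0 ≤ (g x).1 ∧ (n : ℝ) ≤ (g x).2
  tail : ∀ x : ℝ, 15 / 8 ≤ x → x ≤ n + 1 → g x = f (x - 1)

/-- The angle of the pushed curve, in turns, as a function of the angle of the original curve. -/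
noncomputable def pushedAngle (n : ℕ) (y : ℝ) : ℝ := y + repeatEvery n 1 twist y

section PushedAngle

variable {n : ℕ}

theorem hasDerivAt_pushedAngle (hn : 0 < n) (y : ℝ) :
    HasDerivAt (pushedAngle n) (1 + deriv twist (y - n * ⌊y / n⌋)) y :=
  (hasDerivAt_id y).add (hasDerivAt_repeatEvery hn contDiff_twist (fun _ h => twist_of_le (by linarith))
    (fun _ h => twist_of_ge (by linarith)) y)

theorem contDiff_pushedAngle (hn : 0 < n) : ContDiff ℝ ∞ (pushedAngle n) :=
  contDiff_id.add (contDiff_repeat_twist hn)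

theorem deriv_pushedAngle_pos (y : ℝ) : 0 < 1 + deriv twist (y - n * ⌊y / n⌋) := by
  have := deriv_twist_nonneg (y - n * ⌊y / n⌋)
  linarith

theorem strictMono_pushedAngle (hn : 0 < n) : StrictMono (pushedAngle n) :=
  strictMono_of_deriv_pos fun y => by
    rw [(hasDerivAt_pushedAngle hn y).deriv]; exact deriv_pushedAngle_pos y

theorem pushedAngle_add (hn : 0 < n) (y : ℝ) : pushedAngle n (y + n) = pushedAngle n y + (n + 1 : ℕ) := by
  rw [pushedAngle, pushedAngle, repeatEvery_add hn]; push_cast; ring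

theorem surjective_pushedAngle (hn : 0 < n) : Function.Surjective (pushedAngle n) := by
  have hn0 : (0 : ℝ) < n := by exact_mod_cast hn
  refine (contDiff_pushedAngle hn).continuous.surjective ?_ ?_
  · refine Filter.tendsto_atTop_mono' _ ?_ Filter.tendsto_id
    filter_upwards [Filter.eventually_ge_atTop (0 : ℝ)] with y hy
    have h1 : (0 : ℝ) ≤ ⌊y / n⌋ := by
      exact_mod_cast Int.floor_nonneg.2 (div_nonneg hy hn0.le)
    have h2 : 0 ≤ twist (y - n * ⌊y / n⌋) := Real.smoothTransition.nonneg _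
    simp only [pushedAngle, repeatEvery, id]
    linarith
  · refine Filter.tendsto_atBot_mono' _ ?_ (Filter.tendsto_atBot_add_const_right _ 1 Filter.tendsto_id)
    filter_upwards [Filter.eventually_le_atBot (0 : ℝ)] with y hy
    have h1 : (⌊y / n⌋ : ℝ) ≤ 0 :=
      (Int.floor_le _).trans (div_nonpos_of_nonpos_of_nonneg hy hn0.le)
    have h2 : twist (y - n * ⌊y / n⌋) ≤ 1 := Real.smoothTransition.le_one _
    simp only [pushedAngle, repeatEvery, id]
    linarith

/-- The inverse of the angle function is smooth. -/
theorem exists_inverse_pushedAngle (hn : 0 < n) : ∃ Y : ℝ → ℝ, ContDiff ℝ ∞ Y ∧ StrictMono Y ∧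
    (∀ y, Y (pushedAngle n y) = y) ∧ ∀ x, pushedAngle n (Y x) = x := by
  let e : ℝ ≃o ℝ := (strictMono_pushedAngle hn).orderIsoOfSurjective _ (surjective_pushedAngle hn)
  refine ⟨e.symm, ?_, e.symm.strictMono, fun y => e.symm_apply_apply y, fun x => e.apply_symm_apply x⟩
  exact e.toHomeomorph.contDiff_symm_deriv (f' := fun y => 1 + deriv twist (y - n * ⌊y / n⌋))
    (fun y => (deriv_pushedAngle_pos y).ne') (fun y => hasDerivAt_pushedAngle hn y)
    (contDiff_pushedAngle hn)

theorem pushedAngle_of_le (hn : 0 < n) {y : ℝ} (h0 : 0 ≤ y) (h1 : y ≤ 3 / 8) : pushedAngle n y = y := by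
  have hn1 : (1 : ℝ) ≤ n := by exact_mod_cast hn
  rw [pushedAngle, repeatEvery_of_mem h0 (by linarith), twist_of_le h1, add_zero]

theorem pushedAngle_of_ge (hn : 0 < n) {y : ℝ} (h0 : 5 / 8 ≤ y) (h1 : y ≤ n) :
    pushedAngle n y = y + 1 := by
  rcases eq_or_lt_of_le h1 with rfl | h1
  · have := repeatEvery_add hn (K := 1) (φ := twist) 0
    rw [zero_add, repeatEvery_of_mem le_rfl (by exact_mod_cast hn), twist_of_le (by norm_num)] at this
    rw [pushedAngle, this, zero_add]
  · rw [pushedAngle, repeatEvery_of_mem (by linarith) h1, twist_of_ge h0]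

end PushedAngle

/-- The radius (minus `1`) and the height of the pushed curve over the point with angle function `y`. -/
noncomputable def pushedPoint (n : ℕ) (f : ℝ → ℝ × ℝ) (ε ρ c y : ℝ) : ℝ × ℝ :=
  ((1 + ε * (f y).1) * (1 - (1 - ρ) * repeatEvery n 0 pinch y) - 1,
    ε * (f y).2 + c * repeatEvery n 0 hump y)

theorem spiral_one (n : ℕ) (f : ℝ → ℝ × ℝ) (ε ρ c y : ℝ) :
    spiral n f ε ρ c 1 y = nearCircle 1 (2 * Real.pi * pushedAngle n y) (pushedPoint n f ε ρ c y) := by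
  have e : 2 * Real.pi * pushedAngle n y =
      2 * Real.pi * y + 2 * Real.pi * repeatEvery n 1 twist y := by rw [pushedAngle]; ring
  simp only [spiral, nearCircle, pushedPoint, e]
  ext <;> simp <;> ring

/-- A loop that rests on top becomes, after a positive stabilization, a loop on one more strand. -/
theorem RestsOnTop.thinIso {n : ℕ} {f g : ℝ → ℝ × ℝ} (hf : RestsOnTop n f)
    (hg : IsStabilizedLoop n f g) : ThinIso n f (n + 1) g := by
  have hn := hf.pos
  have hn1 := hf.one_le
  have hn0 : (0 : ℝ) < n := by linarith
  have hpi := Real.pi_gt_three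
  -- a single pair of thin curves has to be joined
  suffices H : ∃ ε₀ : ℝ, 0 < ε₀ ∧ ∀ ε, 0 < ε → ε < ε₀ →
      TransIso (knotOf ε n f) (knotOf ε (n + 1) g) by
    obtain ⟨ε₀, h0, H⟩ := H
    obtain ⟨ε₁, h1, H₁⟩ := ThinIso.of_loopIso hn (LoopIso.refl hf.loop)
    obtain ⟨ε₂, h2, H₂⟩ := ThinIso.of_loopIso (Nat.succ_pos n) (LoopIso.refl hg.loop)
    set δ := min ε₀ (min ε₁ ε₂) / 2 with hδ
    have hm : 0 < min ε₀ (min ε₁ ε₂) := lt_min h0 (lt_min h1 h2)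
    have hδ0 : 0 < δ := by positivity
    have hδm : δ < min ε₀ (min ε₁ ε₂) := by rw [hδ]; linarith
    have d0 : δ < ε₀ := hδm.trans_le (min_le_left _ _)
    have d1 : δ < ε₁ := hδm.trans_le ((min_le_right _ _).trans (min_le_left _ _))
    have d2 : δ < ε₂ := hδm.trans_le ((min_le_right _ _).trans (min_le_right _ _))
    refine ⟨min ε₁ ε₂, lt_min h1 h2, fun ε ε' a b c d => ?_⟩
    exact ((H₁ ε δ a (b.trans_le (min_le_left _ _)) hδ0 d1).trans (H δ hδ0 d0)).trans
      (H₂ δ ε' hδ0 d2 c (d.trans_le (min_le_right _ _)))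
  obtain ⟨c, ρ, hc, hρ0, hρ1, hw, ht⟩ := exists_stab_constants
  obtain ⟨ε₁, h1, hε₁⟩ := hf.loop.exists_thinEnough hn
  -- the descending slope of the stabilized loop on its first two turns is bounded
  obtain ⟨M, hM⟩ := (isCompact_Icc (a := (0 : ℝ)) (b := 2)).exists_bound_of_continuousOn
    (hg.loop.smooth.snd.continuous_deriv (by simp)).continuousOn
  obtain ⟨ε₂, h2, hε₂⟩ := hg.loop.exists_thinEnough (Nat.succ_pos n)
  have hM1 : 1 ≤ max 1 M := le_max_left _ _
  refine ⟨min (min ε₁ ε₂) (1 / max 1 M), lt_min (lt_min h1 h2) (by positivity), fun ε hε hεm => ?_⟩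
  have hthin := hε₁ ε hε (hεm.trans_le ((min_le_left _ _).trans (min_le_left _ _)))
  have hthin' := hε₂ ε hε (hεm.trans_le ((min_le_left _ _).trans (min_le_right _ _)))
  have hεM : ∀ x, 0 ≤ x → x ≤ 2 → -1 ≤ ε * deriv (fun y => (g y).2) x := by
    intro x hx hx'
    have a := hεm.trans_le (min_le_right _ _)
    rw [lt_div_iff₀ (by positivity)] at a
    have b := (abs_le.1 ((hM x ⟨hx, hx'⟩).trans (le_max_right 1 _))).1
    nlinarith
  -- raise the top strand and push it around the axis
  have s0 : (fun t => spiral n f ε ρ 0 0 (n * t)) = knotOf ε n f := by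
    funext t
    simp [spiral, knotOf, nearCircle]
  have s1 : TransIso (fun t => spiral n f ε ρ 0 0 (n * t)) (fun t => spiral n f ε ρ c 0 (n * t)) := by
    have := TransIso.of_Icc (fun s t => spiral n f ε ρ (s * c) 0 (n * t))
      (contDiff_spiral hf (contDiff_fst.mul contDiff_const) contDiff_const
        (contDiff_const.mul contDiff_snd)) fun s hs =>
      isTransverseParam_spiral hf hε hthin hρ0 hρ1 (mul_nonneg hs.1 hc.le)
        (mul_le_of_le_one_left hc.le hs.2) hc hw ht le_rfl zero_le_one (Or.inl rfl)
    simpa using this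
  have s2 : TransIso (fun t => spiral n f ε ρ c 0 (n * t)) (fun t => spiral n f ε ρ c 1 (n * t)) :=
    TransIso.of_Icc (fun s t => spiral n f ε ρ c s (n * t))
      (contDiff_spiral hf contDiff_const contDiff_fst (contDiff_const.mul contDiff_snd)) fun s hs =>
      isTransverseParam_spiral hf hε hthin hρ0 hρ1 hc.le le_rfl hc hw ht hs.1 hs.2 (Or.inr rfl)
  -- parametrize the pushed curve by its angle
  obtain ⟨Y, hYs, hYm, hYX, hXY⟩ := exists_inverse_pushedAngle hn
  set h : ℝ → ℝ × ℝ := fun x => pushedPoint n f ε ρ c (Y x) with hh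
  have hYadd : ∀ x, Y (x + (n + 1 : ℕ)) = Y x + n := by
    intro x
    rw [← hYX (Y x + n), pushedAngle_add hn, hXY]
  have hY1 : ∀ x, 0 ≤ x → x ≤ 3 / 8 → Y x = x := by
    intro x a b
    conv_lhs => rw [← pushedAngle_of_le hn a b]
    exact hYX x
  have hY3 : ∀ x : ℝ, 13 / 8 ≤ x → x ≤ n + 1 → Y x = x - 1 := by
    intro x a b
    have := pushedAngle_of_ge hn (y := x - 1) (by linarith) (by linarith)
    rw [sub_add_cancel] at this
    conv_lhs => rw [← this]
    exact hYX _
  have hY2 : ∀ x, 3 / 8 ≤ x → x ≤ 13 / 8 → 3 / 8 ≤ Y x ∧ Y x ≤ 5 / 8 := by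
    intro x a b
    have a1 := hYm.monotone a
    have b1 := hYm.monotone b
    rw [hY1 (3 / 8) (by norm_num) le_rfl] at a1
    rw [hY3 (13 / 8) le_rfl (by linarith)] at b1
    exact ⟨a1, by linarith⟩
  have hY0 : ∀ x, 0 ≤ x → 0 ≤ Y x := fun x hx => by
    have := hYm.monotone hx
    rwa [hY1 0 le_rfl (by norm_num)] at this
  have hYle : ∀ x, 0 ≤ x → x ≤ 15 / 8 → Y x ≤ 7 / 8 := fun x h0 hx => by
    have := hYm.monotone hx
    rw [hY3 (15 / 8) (by norm_num) (by linarith)] at this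
    linarith
  have hYle' : ∀ x, 0 ≤ x → x ≤ 7 / 4 → Y x ≤ 3 / 4 := fun x h0 hx => by
    have := hYm.monotone hx
    rw [hY3 (7 / 4) (by norm_num) (by linarith)] at this
    linarith
  -- the values of the pushed curve
  have hsm : ContDiff ℝ ∞ h := by
    have hfY : ContDiff ℝ ∞ fun x => f (Y x) := hf.loop.smooth.comp hYs
    exact (((contDiff_const.add (contDiff_const.mul hfY.fst)).mul (contDiff_const.sub
      (contDiff_const.mul ((contDiff_repeat_pinch hn).comp hYs)))).sub contDiff_const).prodMk
      ((contDiff_const.mul hfY.snd).add (contDiff_const.mul ((contDiff_repeat_hump hn).comp hYs)))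
  have hper : ∀ x, h (x + (n + 1 : ℕ)) = h x := by
    intro x
    simp only [hh, pushedPoint]
    rw [hYadd, hf.loop.periodic, repeatEvery_add hn, repeatEvery_add hn, add_zero, add_zero]
  have hval : ∀ x, 0 ≤ x → x ≤ 15 / 8 →
      h x = (-((1 - ρ) * pinch (Y x)), ε * n + c * hump (Y x)) := by
    intro x a b
    have y0 := hY0 x a
    have y1 := hYle x a b
    simp only [hh, pushedPoint]
    rw [repeatEvery_of_mem y0 (by linarith), repeatEvery_of_mem y0 (by linarith), hf.rest _ y0 y1]
    simp
  have hmid : ∀ x, 3 / 8 ≤ x → x ≤ 13 / 8 → (h x).1 = ρ - 1 := by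
    intro x a b
    rw [hval x (by linarith) (by linarith), pinch_mid (hY2 x a b).1 (hY2 x a b).2]
    ring
  have hdesc : ∀ x, 7 / 4 ≤ x → x ≤ 15 / 8 → h x = (0, ε * n + c * hump (x - 1)) := by
    intro x a b
    rw [hval x (by linarith) b, hY3 x (by linarith) (by linarith), pinch_of_ge (by linarith)]
    simp
  have htail : ∀ x : ℝ, 15 / 8 ≤ x → x < n + 1 → h x = ε • f (x - 1) := by
    intro x a b
    simp only [hh, pushedPoint]
    rw [hY3 x (by linarith) b.le, repeatEvery_of_mem (by linarith) (by linarith),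
      repeatEvery_of_mem (by linarith) (by linarith), pinch_of_ge (by linarith),
      hump_of_ge (by linarith)]
    ext <;> simp
  have hrad : ∀ x, 0 < 1 + (h x).1 := by
    intro x
    have p1 : repeatEvery n 0 pinch (Y x) ≤ 1 := by
      rw [repeatEvery, zero_mul, zero_add]; exact pinch_le_one _
    have p0 : 0 ≤ repeatEvery n 0 pinch (Y x) := by
      rw [repeatEvery, zero_mul, zero_add]; exact pinch_nonneg _
    simp only [hh, pushedPoint]
    rw [add_sub_cancel]
    exact mul_pos (hthin (Y x)).1 (by nlinarith)
  have hheight : ∀ x, 0 ≤ x → x ≤ 15 / 8 → ε * n ≤ (h x).2 := by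
    intro x a b
    rw [hval x a b]
    have := mul_nonneg hc.le (hump_nonneg (hY0 x a))
    simp only; linarith
  have hgheight : ∀ x, 0 ≤ x → x ≤ 15 / 8 → (n : ℝ) ≤ (g x).2 := by
    intro x a b
    rcases le_total x (3 / 4) with h1 | h1
    · rw [hg.low x a h1]
    rcases le_total x (7 / 8) with h2 | h2
    · exact (hg.up x h1 h2).2
    rcases le_total x (7 / 4) with h3 | h3
    · rw [hg.high x h2 h3]; simp
    · exact (hg.down x h3 b).2
  have hhmono : ∀ x x', 0 ≤ x → x < x' → x' ≤ 7 / 4 → (h x).2 < (h x').2 := by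
    intro x x' a b b'
    rw [hval x a (by linarith), hval x' (by linarith) (by linarith)]
    have := hump_strictMono (hY0 x a) (hYm b) (hYle' x' (by linarith) b')
    have := mul_lt_mul_of_pos_left this hc
    simp only; linarith
  -- interpolate to the stabilized loop
  let G : ℝ → ℝ → ℝ × ℝ := fun s x => (1 - s) • h x + s • (ε • g x)
  have G1 : ∀ s x, (G s x).1 = (1 - s) * (h x).1 + s * (ε * (g x).1) := fun s x => by
    simp [G]
  have G2 : ∀ s x, (G s x).2 = (1 - s) * (h x).2 + s * (ε * (g x).2) := fun s x => by
    simp [G]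
  have Gtail : ∀ s x : ℝ, 15 / 8 ≤ x → x < n + 1 → G s x = ε • f (x - 1) := by
    intro s x a b
    simp only [G]
    rw [htail x a b, hg.tail x a b.le, ← add_smul, sub_add_cancel, one_smul]
  have Gheight : ∀ s : ℝ, 0 ≤ s → s ≤ 1 → ∀ x, 0 ≤ x → x ≤ 15 / 8 → ε * n ≤ (G s x).2 := by
    intro s s0 s1 x a b
    rw [G2]
    have a1 := mul_le_mul_of_nonneg_left (hheight x a b) (sub_nonneg.2 s1)
    have a2 := mul_le_mul_of_nonneg_left (mul_le_mul_of_nonneg_left (hgheight x a b) hε.le) s0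
    nlinarith
  have Gmono : ∀ s : ℝ, 0 ≤ s → s ≤ 1 → MonotoneOn (fun x => (G s x).2) (Set.Icc 0 (7 / 4)) := by
    intro s s0 s1 x hx x' hx' hxx
    simp only [G2]
    have a2 := mul_le_mul_of_nonneg_left (mul_le_mul_of_nonneg_left (hg.mono hx hx' hxx) hε.le) s0
    rcases eq_or_lt_of_le hxx with rfl | hlt
    · exact le_rfl
    · have a1 := mul_le_mul_of_nonneg_left (hhmono x x' hx.1 hlt hx'.2).le (sub_nonneg.2 s1)
      simp only at a2
      linarith
  have Gsm : ContDiff ℝ ∞ fun p : ℝ × ℝ => G p.1 p.2 :=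
    ((contDiff_const.sub contDiff_fst).smul (hsm.comp contDiff_snd)).add
      (contDiff_fst.smul ((hg.loop.smooth.comp contDiff_snd).const_smul ε))
  have Gsm' : ∀ s, ContDiff ℝ ∞ (G s) := fun s =>
    Gsm.comp (contDiff_const.prodMk contDiff_id : ContDiff ℝ ∞ fun x : ℝ => (s, x))
  have Gloop : ∀ s : ℝ, 0 ≤ s → s ≤ 1 → IsLoop (n + 1) (G s) := by
    intro s s0 s1
    refine IsLoop.of_base (Nat.succ_pos n) (Gsm' s) (fun x => ?_) fun x x0 j hj hxj => ?_
    · simp only [G]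
      rw [hper, hg.loop.periodic]
    rcases eq_or_lt_of_le s1 with rfl | s1'
    · -- the stabilized loop itself
      have e : ∀ x, G 1 x = ε • g x := fun x => by simp [G]
      rw [e, e]
      intro he
      have hjn : j < n + 1 := by
        have : (j : ℝ) < (n + 1 : ℕ) := by linarith
        exact_mod_cast this
      exact hg.loop.ne x j hj hjn (smul_right_injective _ hε.ne' he)
    push_cast at hxj
    have hj1 : (1 : ℝ) ≤ j := by exact_mod_cast hj
    -- a point of the tail lies below the first two turns
    have below : ∀ x' : ℝ, 0 ≤ x' → x' ≤ 15 / 8 → ∀ z : ℝ, z < ε * n → ∀ w : ℝ × ℝ, w.2 = z → w ≠ G s x' := by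
      rintro x' a b z hz w rfl rfl
      exact absurd (Gheight s s0 s1 x' a b) (not_le.2 hz)
    rcases le_or_gt (15 / 8) x with hx | hx
    · rw [Gtail s x hx (by linarith), Gtail s (x + j) (by linarith) hxj]
      intro he
      have := smul_right_injective _ hε.ne' he
      refine hf.loop.ne (x - 1) j hj ?_ (by rw [← this]; congr 1; ring)
      have : (j : ℝ) < n := by linarith
      exact_mod_cast this
    rcases lt_or_ge (x + j) (15 / 8) with hxj' | hxj'
    · -- the two turns of the new strand
      have hj' : j = 1 := by
        have : (j : ℝ) < 2 := by linarith
        have : j < 2 := by exact_mod_cast this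
        omega
      subst hj'
      rw [Nat.cast_one] at hxj hxj' ⊢
      rcases lt_or_ge x (3 / 4) with h4 | h4
      · intro he
        have := congrArg Prod.snd he
        rw [G2, G2, hg.low x x0 h4.le, hg.high (x + 1) (by linarith) (by linarith)] at this
        have a1 := hhmono x (x + 1) x0 (by linarith) (by linarith)
        have a2 := mul_lt_mul_of_pos_left a1 (sub_pos.2 s1')
        have a3 := mul_nonneg s0 hε.le
        simp only at this
        nlinarith
      · intro he
        have := congrArg Prod.fst he
        rw [G1, G1, hmid x (by linarith) (by linarith), hdesc (x + 1) (by linarith) hxj'.le] at this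
        have a1 := (hg.up x h4 (by linarith)).1
        have a2 := (hg.down (x + 1) (by linarith) hxj'.le).1
        have a3 := mul_nonneg s0 (mul_nonneg hε.le a2)
        have a4 := mul_nonneg s0 (mul_nonneg hε.le (neg_nonneg.2 a1))
        have a5 := mul_pos (sub_pos.2 s1') (sub_pos.2 hρ1)
        simp only at this
        nlinarith
    · rw [Gtail s (x + j) hxj' hxj]
      rcases lt_or_ge x (7 / 8) with h8 | h8
      · have hj2 : 1 < j := by
          have : (1 : ℝ) < j := by linarith
          exact_mod_cast this
        have hjn : j - 1 < n := by
          have : (j : ℝ) < n + 1 := by linarith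
          have : j < n + 1 := by exact_mod_cast this
          omega
        have hlt := hf.lt x x0 h8.le (j - 1) (by omega) hjn
        rw [Nat.cast_sub hj2.le, Nat.cast_one, ← add_sub_assoc] at hlt
        exact below x x0 hx.le _ (mul_lt_mul_of_pos_left hlt hε) _ rfl
      rcases lt_or_ge x 1 with h9 | h9
      · intro he
        have := congrArg Prod.snd he
        rw [G2, hval x x0 hx.le, hg.high x h8 (by linarith)] at this
        have a1 := mul_le_mul_of_nonneg_left (hf.le (x + j - 1)) hε.le
        have y1 := hY2 x (by linarith) (by linarith)
        have a2 := mul_pos (sub_pos.2 s1') (mul_pos hc (hump_pos (y := Y x) (by linarith)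
          (by linarith)))
        have a3 := mul_nonneg s0 hε.le
        simp only [Prod.smul_snd, smul_eq_mul] at this
        nlinarith
      · have hjn : j < n := by
          have : (j : ℝ) < n := by linarith
          exact_mod_cast this
        have hlt := hf.lt (x - 1) (by linarith) (by linarith) j hj hjn
        rw [show x - 1 + (j : ℝ) = x + j - 1 by ring] at hlt
        exact below x x0 hx.le _ (mul_lt_mul_of_pos_left hlt hε) _ rfl
  have Gtrans : ∀ s : ℝ, 0 ≤ s → s ≤ 1 → IsTransverseParam (knotOf 1 (n + 1) (G s)) := by
    intro s s0 s1
    refine (Gloop s s0 s1).isTransverseParam_of_base (Nat.succ_pos n) (fun x x0 x1 => ?_)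
      fun x x0 x1 => ?_
    · have a1 := hrad x
      have a2 := (hthin' x).1
      rw [G1]
      rcases eq_or_lt_of_le s0 with rfl | s0'
      · linarith
      · nlinarith [mul_pos s0' a2, mul_nonneg (sub_nonneg.2 s1) a1.le]
    · push_cast at x1
      have hd : deriv (fun y => (G s y).2) x =
          (1 - s) * deriv (fun y => (h y).2) x + s * (ε * deriv (fun y => (g y).2) x) := by
        have e : (fun y => (G s y).2) = fun y => (1 - s) * (h y).2 + s * (ε * (g y).2) := funext (G2 s)
        rw [e]
        exact ((((hsm.snd.differentiable (by simp)) x).hasDerivAt.const_mul (1 - s)).add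
          ((((hg.loop.smooth.snd.differentiable (by simp)) x).hasDerivAt.const_mul ε).const_mul s)).deriv
      rcases le_or_gt x (7 / 4) with h4 | h4
      · have a0 : 0 ≤ deriv (fun y => (G s y).2) x :=
          deriv_nonneg_of_monotoneOn (uniqueDiffOn_Icc (show (0 : ℝ) < 7 / 4 by norm_num))
            (Gsm' s).snd (Gmono s s0 s1) ⟨x0, h4⟩
        have a1 := hrad x
        have a2 := (hthin' x).1
        have a3 : 0 < 1 + (G s x).1 := by
          rw [G1]
          rcases eq_or_lt_of_le s0 with rfl | s0'
          · linarith
          · nlinarith [mul_pos s0' a2, mul_nonneg (sub_nonneg.2 s1) a1.le]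
        positivity
      rcases le_or_gt x (15 / 8) with h8 | h8
      · have b1 : deriv (fun y => (h y).2) x = c * deriv hump (x - 1) := by
          have e1 : ContDiff ℝ ∞ fun x => ε * n + c * hump (x - 1) := contDiff_const.add
            (contDiff_const.mul (contDiff_hump.comp (contDiff_id.sub contDiff_const)))
          rw [deriv_eq_deriv_of_eqOn (uniqueDiffOn_Icc (show (7 / 4 : ℝ) < 15 / 8 by norm_num)) hsm.snd
            e1 (fun x hx => by rw [hdesc x hx.1 hx.2]) ⟨h4.le, h8⟩]
          exact ((((contDiff_hump.differentiable (by simp)) (x - 1)).hasDerivAt.comp_sub_const x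
            1).const_mul c |>.const_add (ε * n)).deriv
        have b2 := hw (x - 1) (by linarith) (by linarith)
        have b3 := hεM x x0 (by linarith)
        have b4 : 1 ≤ 1 + (G s x).1 := by
          rw [G1, hdesc x h4.le h8]
          have := mul_nonneg s0 (mul_nonneg hε.le (hg.down x h4.le h8).1)
          simp only; linarith
        have b5 : -1 ≤ deriv (fun y => (G s y).2) x := by
          rw [hd, b1]
          nlinarith [mul_le_mul_of_nonneg_left b2 (sub_nonneg.2 s1), mul_le_mul_of_nonneg_left b3 s0]
        have b6 : 1 ≤ (1 + (G s x).1) ^ 2 := by nlinarith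
        nlinarith
      · have e1 : ContDiff ℝ ∞ fun x => ε * (f (x - 1)).2 := contDiff_const.mul
          (hf.loop.smooth.comp (contDiff_id.sub contDiff_const)).snd
        have b1 : deriv (fun y => (G s y).2) x = ε * deriv (fun y => (f y).2) (x - 1) := by
          rw [deriv_eq_deriv_of_eqOn (uniqueDiffOn_Ico (15 / 8 : ℝ) (n + 1)) (Gsm' s).snd e1
            (fun x hx => by rw [Gtail s x hx.1 hx.2]; rfl) ⟨h8.le, x1⟩]
          exact (((hf.loop.smooth.snd.differentiable (by simp)) (x - 1)).hasDerivAt.comp_sub_const x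
            1 |>.const_mul ε).deriv
        rw [b1, Gtail s x h8.le x1]
        exact (hthin (x - 1)).2
  have s3 : TransIso (knotOf 1 (n + 1) h) (knotOf ε (n + 1) g) := by
    have := TransIso.of_Icc (fun s => knotOf 1 (n + 1) (G s)) ?_ fun s hs => Gtrans s hs.1 hs.2
    · have e0 : G 0 = h := by funext x; simp [G]
      have e1 : knotOf 1 (n + 1) (G 1) = knotOf ε (n + 1) g := by
        funext t
        simp [knotOf, nearCircle, G]
      simp only [e0, e1] at this
      exact this
    · have e : ContDiff ℝ ∞ fun p : ℝ × ℝ => ((n + 1 : ℕ) : ℝ) * p.2 := contDiff_const.mul contDiff_snd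
      exact contDiff_nearCircle contDiff_const (contDiff_const.mul e)
        (Gsm.comp (contDiff_fst.prodMk e))
  have s4 : TransIso (knotOf 1 (n + 1) h) (fun t => spiral n f ε ρ c 1 (n * t)) := by
    have hN : (0 : ℝ) < (n + 1 : ℕ) := by positivity
    have hk : IsTransverseParam (knotOf 1 (n + 1) h) := by
      have := Gtrans 0 le_rfl zero_le_one
      have e0 : G 0 = h := by funext x; simp [G]
      rwa [e0] at this
    have := TransIso.comp hk (φ := fun t => pushedAngle n (n * t) / (n + 1 : ℕ))
      (φ' := fun t => (1 + deriv twist ((n * t) - n * ⌊(n * t) / n⌋)) * n / (n + 1 : ℕ)) ?_ ?_ ?_ ?_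
    · have e : knotOf 1 (n + 1) h ∘ (fun t => pushedAngle n (n * t) / (n + 1 : ℕ)) =
          fun t => spiral n f ε ρ c 1 (n * t) := by
        funext t
        simp only [Function.comp_apply, knotOf]
        rw [mul_div_cancel₀ _ hN.ne', spiral_one]
        simp only [hh, hYX]
      rwa [e] at this
    · exact ((contDiff_pushedAngle hn).comp (contDiff_const.mul contDiff_id)).div_const _
    · intro t
      have a : HasDerivAt (fun t : ℝ => (n : ℝ) * t) n t := by
        simpa using (hasDerivAt_id t).const_mul (n : ℝ)
      exact ((hasDerivAt_pushedAngle hn (n * t)).comp t a).div_const _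
    · intro t
      have := deriv_pushedAngle_pos (n := n) (n * t)
      positivity
    · intro t
      rw [mul_add, mul_one, pushedAngle_add hn, add_div, div_self hN.ne']
  rw [s0] at s1
  exact ((s1.trans s2).trans s4.symm).trans s3

/-! ### Positive stabilization of closed braids -/

theorem turnedPoint_snd_le {i k n : ℕ} {φ : ℝ} (hi : i < n) (hk : k ≤ n) : (turnedPoint i φ k).2 ≤ n := by
  have c1 := Real.neg_one_le_cos φ
  have c2 := Real.cos_le_one φ
  have hi' : (i : ℝ) + 1 ≤ n := by exact_mod_cast hi
  have hk' : (k : ℝ) ≤ n := by exact_mod_cast hk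
  unfold turnedPoint
  split_ifs <;> simp only <;> linarith

theorem wordArc_snd_le {n : ℕ} {w : List (ℕ × Bool)} (hw : ∀ l ∈ w, 1 ≤ l.1 ∧ l.1 < n) : ∀ (k : ℕ),
    k ≤ n → ∀ y, (wordArc w k y).2 ≤ n := by
  induction w with
  | nil => intro k hk y; simpa [wordArc] using hk
  | cons l w ih =>
    intro k hk y
    obtain ⟨h1, h2⟩ := hw l List.mem_cons_self
    rcases le_total y 1 with hy | hy
    · rw [wordArc, arcConcat_of_le (isArc_wordArc w) _ hy, letterPath_some]
      exact turnedPoint_snd_le h2 hk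
    · rw [wordArc, arcConcat_of_ge (isArc_letterPath l) _ hy]
      refine ih (fun l hl => hw l (List.mem_cons_of_mem _ hl)) _ ?_ _
      rw [Equiv.swap_apply_def]
      split_ifs <;> omega

theorem wordArc_of_gt {n : ℕ} {w : List (ℕ × Bool)} (hw : ∀ l ∈ w, 1 ≤ l.1 ∧ l.1 < n) {k : ℕ}
    (hk : n < k) (y : ℝ) : wordArc w k y = (0, (k : ℝ)) := by
  induction w generalizing y with
  | nil => rfl
  | cons l w ih =>
    obtain ⟨h1, h2⟩ := hw l List.mem_cons_self
    rw [wordArc, arcConcat, letterPath_some, turnedPoint, if_neg (by omega), if_neg (by omega),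
      Equiv.swap_apply_of_ne_of_ne (by omega) (by omega),
      ih (fun l hl => hw l (List.mem_cons_of_mem _ hl)), sub_self, add_zero]

section Stabilize

variable {n : ℕ} {w : List (ℕ × Bool)}

/-- The loop of the closure of `w`, with a long rest of strand `n` before the letters of `w`. -/
noncomputable def restingLoop (n : ℕ) (w : List (ℕ × Bool)) (y : ℝ) : ℝ × ℝ :=
  loopOf (wordPerm w) (8 * (w.length + 1)) (wordArc w) n (y - 7 / 8)

/-- Each turn lasts `8 (ℓ + 1)` units of time for a word of length `ℓ`, of which the letters need less
than one eighth. -/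
theorem restsOnTop (hw : ∀ l ∈ w, 1 ≤ l.1 ∧ l.1 < n) (h : IsKnotBraid n (Br.mk w)) :
    RestsOnTop n (restingLoop n w) := by
  have hA := isArc_wordArc w
  have hl : (0 : ℝ) ≤ w.length := Nat.cast_nonneg _
  have hst := Br.perm_mem_stabilizer h.mem
  rw [Br.perm_mk] at hst
  have hcl : ClosesAfter n (wordPerm w) n := h.closes
  have hmem : ∀ i : ℤ, (wordPerm w ^ i) n ∈ Set.Icc 1 n := fun i =>
    ((MulAction.mem_stabilizer_set.1 (zpow_mem hst i)) n).2 ⟨h.closes.1, le_rfl⟩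
  have hrest : ∀ y : ℝ, 0 ≤ y → y ≤ 7 / 8 → ∀ j : ℕ,
      restingLoop n w (y + j) = (0, (((wordPerm w ^ j) n : ℕ) : ℝ)) := by
    intro y h0 h1 j
    rw [restingLoop, hA.loopOf_eq (by positivity) (by linarith) n j (by push_cast; linarith)
      (by push_cast; nlinarith) (by push_cast; linarith), hA.start _ _ (by push_cast; nlinarith),
      zpow_natCast]
  refine ⟨h.closes.1, ?_, fun y h0 h1 => ?_, fun y => ?_, fun y h0 h1 j hj hjn => ?_⟩
  · have := hA.isLoop hl (P := 8 * (w.length + 1)) (by linarith) hcl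
    refine ⟨this.smooth.comp (contDiff_id.sub contDiff_const), fun y => ?_, fun y j hj hjn => ?_⟩
    · simp only [restingLoop]
      rw [add_sub_right_comm, this.periodic]
    · simp only [restingLoop]
      rw [add_sub_right_comm]
      exact this.ne _ j hj hjn
  · have := hrest y h0 h1 0
    simpa using this
  · exact wordArc_snd_le hw _ (hmem _).2 _
  · rw [hrest y h0 h1 j]
    have h2 : (wordPerm w ^ j) n ≤ n := by
      have := (hmem j).2
      rwa [zpow_natCast] at this
    have h3 := hcl.2.2 j hj hjn
    have h4 : (wordPerm w ^ j) n < n := lt_of_le_of_ne h2 h3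
    simpa using h4

/-- The loop of the closure of `σ_n w`, with a rest of strand `n` before the letter `σ_n`. -/
noncomputable def stabilizedLoop (n : ℕ) (w : List (ℕ × Bool)) (x : ℝ) : ℝ × ℝ :=
  loopOf (wordPerm w * Equiv.swap n (n + 1)) (8 * (w.length + 1))
    (arcConcat (w.length + 1) (Equiv.swap n (n + 1)) (letterPath (some (n, true))) (wordArc w)) n
    (x - 3 / 4)

/-- Strand `n + 1` runs through the same positions as strand `n` did, and then through `n`. -/
theorem pow_stabilized (hgt : wordPerm w (n + 1) = n + 1) (hcl : ClosesAfter n (wordPerm w) n) (j : ℕ)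
    (hj : j < n) :
    ((wordPerm w * Equiv.swap n (n + 1)) ^ (j + 1)) n = if j = 0 then n + 1 else (wordPerm w ^ j) n := by
  induction j with
  | zero => simp [hgt]
  | succ j ih =>
    rw [pow_succ', Equiv.Perm.mul_apply, ih (by omega), Equiv.Perm.mul_apply]
    have hne : (wordPerm w ^ j) n ≠ n + 1 := by
      intro e
      have : (wordPerm w ^ j) (n + 1) = n + 1 := by
        clear ih hj e
        induction j with
        | zero => rfl
        | succ j ih => rw [pow_succ', Equiv.Perm.mul_apply, ih, hgt]
      have := (wordPerm w ^ j).injective (e.trans this.symm)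
      omega
    by_cases h0 : j = 0
    · subst h0; simp
    · rw [if_neg h0, if_neg (by omega), Equiv.swap_apply_of_ne_of_ne (hcl.2.2 j (by omega) (by omega)) hne,
        pow_succ', Equiv.Perm.mul_apply]

theorem IsKnotBraid.stabilize {g : Br} (h : IsKnotBraid n g) : IsKnotBraid (n + 1) (Br.σ n * g) := by
  obtain ⟨w, hw, rfl⟩ := Br.exists_word_of_mem_below h.mem
  have hcl : ClosesAfter n (wordPerm w) n := h.closes
  have hgt : wordPerm w (n + 1) = n + 1 := Br.perm_apply_of_gt h.mem (Nat.lt_succ_self n)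
  have hn : 0 < n := hcl.1
  have key := pow_stabilized hgt hcl
  refine ⟨mul_mem (Br.σ_mem_below hcl.1 (Nat.lt_succ_self n)) (Br.below_mono (Nat.le_succ n) h.mem), ?_⟩
  rw [Br.perm_mul, Br.perm_σ, Br.perm_mk]
  have hstep : ∀ j, ((wordPerm w * Equiv.swap n (n + 1)) ^ j) (n + 1) =
      ((wordPerm w * Equiv.swap n (n + 1)) ^ (j + 1)) n := by
    intro j
    rw [pow_succ, Equiv.Perm.mul_apply, Equiv.Perm.mul_apply, Equiv.swap_apply_left, hgt]
  have hlast : ((wordPerm w * Equiv.swap n (n + 1)) ^ (n + 1)) n = n := by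
    obtain ⟨m, rfl⟩ : ∃ m, n = m + 1 := ⟨n - 1, by omega⟩
    rw [pow_succ', Equiv.Perm.mul_apply, key m (by omega)]
    by_cases h0 : m = 0
    · subst h0
      rw [if_pos rfl, Equiv.Perm.mul_apply, Equiv.swap_apply_right]
      simpa using hcl.2.1
    · rw [if_neg h0, Equiv.Perm.mul_apply, Equiv.swap_apply_of_ne_of_ne, ← Equiv.Perm.mul_apply,
        ← pow_succ', hcl.2.1]
      · exact hcl.2.2 m (by omega) (by omega)
      · have := ((MulAction.mem_stabilizer_set.1 (pow_mem (Br.perm_mem_stabilizer h.mem) m)) (m + 1)).2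
          ⟨hcl.1, le_rfl⟩
        have h2 : (wordPerm w ^ m) (m + 1) ≤ m + 1 := this.2
        omega
  refine ⟨Nat.succ_pos n, ?_, fun j hj hjn e => ?_⟩
  · rw [pow_succ', Equiv.Perm.mul_apply, hstep, hlast, Equiv.Perm.mul_apply, Equiv.swap_apply_left, hgt]
  · rw [hstep] at e
    rcases eq_or_lt_of_le (Nat.lt_succ_iff.1 hjn) with rfl | hjn'
    · omega
    · rw [key j hjn', if_neg hj.ne'] at e
      have := ((MulAction.mem_stabilizer_set.1 (pow_mem (Br.perm_mem_stabilizer h.mem) j)) n).2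
        ⟨hcl.1, le_rfl⟩
      have h2 : (wordPerm w ^ j) n ≤ n := this.2
      omega

/-- The letter `σ_n` is read at the parameters in `[3/4, 7/8]` of each turn, and the letters of `w` in
`[7/8, 1]`, so that after the first two turns the loop agrees with `restingLoop`, one turn later. -/
theorem isStabilizedLoop (hw : ∀ l ∈ w, 1 ≤ l.1 ∧ l.1 < n) (h : IsKnotBraid n (Br.mk w)) :
    IsStabilizedLoop n (restingLoop n w) (stabilizedLoop n w) := by
  have hl : (0 : ℝ) ≤ w.length := Nat.cast_nonneg _
  set T : ℝ := w.length + 1 with hT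
  have hW := isArc_wordArc w
  have hL := isArc_letterPath (n, true)
  have hA : IsArc (T + w.length) _ _ := hL.concat hW (T := T) (by linarith) (by linarith) hl
  have hcl : ClosesAfter n (wordPerm w) n := h.closes
  have hgt : wordPerm w (n + 1) = n + 1 := Br.perm_apply_of_gt h.mem (Nat.lt_succ_self n)
  have hk := h.stabilize
  have hcl' : ClosesAfter (n + 1) (wordPerm w * Equiv.swap n (n + 1)) n := by
    have := hk.closesAfter hcl.1 (Nat.le_succ n)
    rwa [Br.perm_mul, Br.perm_σ, Br.perm_mk] at this
  have hloop := hA.isLoop (P := 8 * T) (by linarith) (by linarith) hcl'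
  set ρ := wordPerm w * Equiv.swap n (n + 1) with hρ
  have hρn : ρ n = n + 1 := by rw [hρ, Equiv.Perm.mul_apply, Equiv.swap_apply_left, hgt]
  have turn : ∀ (x : ℝ) (i : ℤ), (i : ℝ) - 1 / 4 ≤ x → -(4 * T) ≤ 8 * T * (x - 3 / 4 - i) →
      x ≤ i + 7 / 4 → stabilizedLoop n w x =
      arcConcat T (Equiv.swap n (n + 1)) (letterPath (some (n, true))) (wordArc w) ((ρ ^ i) n)
        (8 * T * (x - 3 / 4 - i)) := by
    intro x i h1 h2 h3
    exact hA.loopOf_eq (by linarith) (by linarith) n i (by linarith) (by nlinarith) (by linarith)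
  have turn0 : ∀ x : ℝ, 1 / 2 ≤ x → x ≤ 7 / 4 → stabilizedLoop n w x =
      arcConcat T (Equiv.swap n (n + 1)) (letterPath (some (n, true))) (wordArc w) n
        (8 * T * (x - 3 / 4)) := by
    intro x h1 h2
    rw [turn x 0 (by norm_num; linarith) (by push_cast; nlinarith) (by push_cast; linarith)]
    simp
  have turn1 : ∀ x : ℝ, 7 / 4 ≤ x → x ≤ 11 / 4 → stabilizedLoop n w x =
      arcConcat T (Equiv.swap n (n + 1)) (letterPath (some (n, true))) (wordArc w) (n + 1)
        (8 * T * (x - 7 / 4)) := by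
    intro x h1 h2
    rw [turn x 1 (by norm_num; linarith) (by push_cast; nlinarith) (by push_cast; linarith), zpow_one, hρn]
    congr 1
    push_cast; ring
  have low : ∀ x, 0 ≤ x → x ≤ 3 / 4 → stabilizedLoop n w x = (0, (n : ℝ)) := by
    intro x h0 h1
    rw [turn x (-1) (by norm_num; linarith) (by push_cast; nlinarith) (by push_cast; linarith),
      hA.finish _ _ (by push_cast; nlinarith), zpow_neg_one]
    congr 2
    exact Equiv.apply_symm_apply ρ n
  have high : ∀ x, 7 / 8 ≤ x → x ≤ 7 / 4 → stabilizedLoop n w x = (0, (n : ℝ) + 1) := by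
    intro x h0 h1
    rw [turn0 x (by linarith) h1, arcConcat_of_ge hL _ (by nlinarith), Equiv.swap_apply_left,
      wordArc_of_gt hw (Nat.lt_succ_self n)]
    push_cast; rfl
  have upval : ∀ x, 1 / 2 ≤ x → x ≤ 7 / 8 → stabilizedLoop n w x =
      turnedPoint n (Real.pi * Real.smoothTransition (8 * T * (x - 3 / 4))) n := by
    intro x h0 h1
    rw [turn0 x h0 (by linarith), arcConcat_of_le hW _ (by nlinarith), letterPath_some]
    simp
  have sinS : ∀ t : ℝ, 0 ≤ Real.sin (Real.pi * Real.smoothTransition t) := fun t =>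
    Real.sin_nonneg_of_nonneg_of_le_pi (mul_nonneg Real.pi_pos.le (Real.smoothTransition.nonneg _))
      (mul_le_of_le_one_right Real.pi_pos.le (Real.smoothTransition.le_one _))
  have upmono : MonotoneOn (fun x => (stabilizedLoop n w x).2) (Set.Icc (3 / 4) (7 / 8)) := by
    intro x hx x' hx' hxx
    simp only
    rw [upval x (by linarith [hx.1]) hx.2, upval x' (by linarith [hx'.1]) hx'.2]
    simp only [turnedPoint, if_true]
    have h1 : Real.smoothTransition (8 * T * (x - 3 / 4)) ≤
        Real.smoothTransition (8 * T * (x' - 3 / 4)) := Real.smoothTransition.monotone (by nlinarith)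
    have h2 := Real.cos_le_cos_of_nonneg_of_le_pi
      (mul_nonneg Real.pi_pos.le (Real.smoothTransition.nonneg (8 * T * (x - 3 / 4))))
      (mul_le_of_le_one_right Real.pi_pos.le (Real.smoothTransition.le_one (8 * T * (x' - 3 / 4))))
      (mul_le_mul_of_nonneg_left h1 Real.pi_pos.le)
    linarith
  refine ⟨?_, low, fun x h0 h1 => ?_, ?_, high, fun x h0 h1 => ?_, fun x h0 h1 => ?_⟩
  · refine ⟨hloop.smooth.comp (contDiff_id.sub contDiff_const), fun y => ?_, fun y j hj hjn => ?_⟩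
    · simp only [stabilizedLoop]
      rw [add_sub_right_comm]; exact hloop.periodic _
    · simp only [stabilizedLoop]
      rw [add_sub_right_comm]
      exact hloop.ne _ j hj hjn
  · rw [upval x (by linarith) h1]
    simp only [turnedPoint, if_true]
    have := sinS (8 * T * (x - 3 / 4))
    have := Real.cos_le_one (Real.pi * Real.smoothTransition (8 * T * (x - 3 / 4)))
    constructor <;> linarith
  · have e1 : MonotoneOn (fun x => (stabilizedLoop n w x).2) (Set.Icc 0 (3 / 4)) := by
      intro x hx x' hx' _
      simp only
      rw [low x hx.1 hx.2, low x' hx'.1 hx'.2]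
    have e3 : MonotoneOn (fun x => (stabilizedLoop n w x).2) (Set.Icc (7 / 8) (7 / 4)) := by
      intro x hx x' hx' _
      simp only
      rw [high x hx.1 hx.2, high x' hx'.1 hx'.2]
    have e12 := e1.union_right upmono (c := 3 / 4) (isGreatest_Icc (by norm_num))
      (isLeast_Icc (by norm_num))
    rw [Set.Icc_union_Icc_eq_Icc (by norm_num) (by norm_num)] at e12
    have e123 := e12.union_right e3 (c := 7 / 8) (isGreatest_Icc (by norm_num))
      (isLeast_Icc (by norm_num))
    rwa [Set.Icc_union_Icc_eq_Icc (by norm_num) (by norm_num)] at e123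
  · rw [turn1 x h0 (by linarith), arcConcat_of_le hW _ (by nlinarith), letterPath_some]
    simp only [turnedPoint, if_true, Nat.succ_ne_self, if_false, one_mul]
    have := sinS (8 * T * (x - 7 / 4))
    have := Real.neg_one_le_cos (Real.pi * Real.smoothTransition (8 * T * (x - 7 / 4)))
    constructor <;> linarith
  · obtain ⟨i, hi⟩ : ∃ i : ℕ, i = ⌊x - 7 / 4⌋₊ := ⟨_, rfl⟩
    have i0 : (i : ℝ) ≤ x - 7 / 4 := by rw [hi]; exact Nat.floor_le (by linarith)
    have i1 : x - 7 / 4 < i + 1 := by rw [hi]; exact Nat.lt_floor_add_one _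
    have hin : i < n := by
      have : (i : ℝ) < n := by linarith
      exact_mod_cast this
    have e1 : 8 * T * (x - 3 / 4 - ((i + 1 : ℕ) : ℤ)) = 8 * T * (x - 7 / 4 - i) := by push_cast; ring
    have e2 : 8 * T * (x - 1 - 7 / 8 - (i : ℤ)) = 8 * T * (x - 7 / 4 - i) - T := by push_cast; ring
    have e3 : 0 ≤ 8 * T * (x - 7 / 4 - i) := mul_nonneg (by linarith) (by linarith)
    rw [turn x ((i + 1 : ℕ) : ℤ) (by push_cast; linarith) (by rw [e1]; linarith)
      (by push_cast; linarith), e1, restingLoop, ← hT, hW.loopOf_eq (by linarith) (by linarith) n i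
      (by push_cast; linarith) (by rw [e2]; linarith) (by push_cast; linarith), e2, zpow_natCast,
      zpow_natCast, pow_stabilized hgt hcl i hin]
    by_cases hi0 : i = 0
    · subst hi0
      rw [if_pos rfl, arcConcat_of_ge hL _ (by push_cast; nlinarith), Equiv.swap_apply_right]
      rfl
    · have h2 : (wordPerm w ^ i) n ≠ n := hcl.2.2 i (by omega) hin
      have h3 : (wordPerm w ^ i) n ≠ n + 1 := by
        have := (((MulAction.mem_stabilizer_set.1
          (pow_mem (Br.perm_mem_stabilizer h.mem) i)) n).2 ⟨hcl.1, le_rfl⟩).2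
        have h4 : (wordPerm w ^ i) n ≤ n := this
        omega
      rw [if_neg hi0, arcConcat, letterPath_some, turnedPoint, if_neg h2, if_neg h3,
        Equiv.swap_apply_of_ne_of_ne h2 h3, add_sub_cancel]

/-- Positive stabilization does not change the transverse knot. -/
theorem SameKnot.stabilize {g : Br} (h : IsKnotBraid n g) : SameKnot n g (n + 1) (Br.σ n * g) := by
  obtain ⟨w, hw, rfl⟩ := Br.exists_word_of_mem_below h.mem
  have hl : (0 : ℝ) ≤ w.length := Nat.cast_nonneg _
  have hk := h.stabilize
  have hW := isArc_wordArc w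
  have hL := isArc_letterPath (n, true)
  have main := (restsOnTop hw h).thinIso (isStabilizedLoop hw h)
  have hcl : ClosesAfter n (wordPerm w) n := h.closes
  have hp : Br.perm (Br.σ n * Br.mk w) = wordPerm w * Equiv.swap n (n + 1) := by
    rw [Br.perm_mul, Br.perm_σ, Br.perm_mk]
  have hcl1 : ClosesAfter (n + 1) (wordPerm w * Equiv.swap n (n + 1)) n := by
    have := hk.closesAfter hcl.1 (Nat.le_succ n)
    rwa [hp] at this
  have hcl2 : ClosesAfter (n + 1) (wordPerm w * Equiv.swap n (n + 1)) (n + 1) := by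
    have := hk.closes
    rwa [hp] at this
  have hA := hL.concat hW (T := w.length + 1) (by linarith) (by linarith) hl
  have hA1 := hL.concat hW (T := 1) zero_le_one le_rfl hl
  refine SameKnot.of_word (w := w) (w' := (n, true) :: w) h hk ?_
  have s1 : ThinIso n (closedLoop n w) n
      (loopOf (wordPerm w) (8 * (w.length + 1)) (wordArc w) n) :=
    thinIso_of_arcIso hl hl (lt_add_one _) (by linarith) hW hW (ArcIso.refl hl hW) hcl
  have s2 : ThinIso n (loopOf (wordPerm w) (8 * (w.length + 1)) (wordArc w) n) n (restingLoop n w) :=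
    ThinIso.of_loopIso hcl.1 (LoopIso.shift (hW.isLoop hl (by linarith) hcl) (-(7 / 8)))
  have s3 : ThinIso (n + 1) (loopOf (wordPerm w * Equiv.swap n (n + 1)) (8 * (w.length + 1))
      (arcConcat (w.length + 1) (Equiv.swap n (n + 1)) (letterPath (some (n, true))) (wordArc w)) n)
      (n + 1) (stabilizedLoop n w) :=
    ThinIso.of_loopIso (Nat.succ_pos n) (LoopIso.shift (hA.isLoop (by linarith) (by linarith) hcl1)
      (-(3 / 4)))
  have s4 : ThinIso (n + 1) (loopOf (wordPerm w * Equiv.swap n (n + 1)) (8 * (w.length + 1))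
      (arcConcat (w.length + 1) (Equiv.swap n (n + 1)) (letterPath (some (n, true))) (wordArc w))
      (n + 1)) (n + 1) (loopOf (wordPerm w * Equiv.swap n (n + 1)) (8 * (w.length + 1))
      (arcConcat (w.length + 1) (Equiv.swap n (n + 1)) (letterPath (some (n, true))) (wordArc w)) n) := by
    have hA' := hA
    rw [← hp] at hA' ⊢
    exact hk.thinIso_base (by linarith) (by linarith) hA' hcl.1 (Nat.le_succ n)
  have s5 : ThinIso (n + 1) (closedLoop (n + 1) ((n, true) :: w)) (n + 1)
      (loopOf (wordPerm w * Equiv.swap n (n + 1)) (8 * (w.length + 1))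
      (arcConcat (w.length + 1) (Equiv.swap n (n + 1)) (letterPath (some (n, true))) (wordArc w))
      (n + 1)) := by
    refine thinIso_of_arcIso (by linarith) (by linarith) ?_ (by linarith) hA1 hA
      (ArcIso.concat (ArcIso.refl zero_le_one hL) (ArcIso.refl hl hW) zero_le_one (by linarith) hl hl hL
        hW hL hW le_rfl (by linarith)) hcl2
    push_cast [List.length_cons]; linarith
  exact ((s1.trans s2).trans main).trans ((s5.trans s4).trans s3).symm

end Stabilize

/-! ### Ascending products of generators -/

namespace Br

theorem commute_σ {i j : ℕ} (h : i + 2 ≤ j ∨ j + 2 ≤ i) : Commute (σ i) (σ j) := by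
  rcases h with h | h
  · exact σ_comm h
  · exact (σ_comm h).symm

/-- The ascending product `σ_p σ_{p+1} ⋯ σ_q`, which is `1` if `q < p`. -/
noncomputable def asc (p q : ℕ) : Br := ((List.range' p (q + 1 - p)).map σ).prod

theorem asc_of_lt {p q : ℕ} (h : q < p) : asc p q = 1 := by
  rw [asc, Nat.sub_eq_zero_of_le h]; rfl

theorem asc_succ {p q : ℕ} (h : p ≤ q + 1) : asc p (q + 1) = asc p q * σ (q + 1) := by
  rw [asc, asc, show q + 1 + 1 - p = (q + 1 - p) + 1 by omega, List.range'_1_concat, List.map_append,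
    List.prod_append, show p + (q + 1 - p) = q + 1 by omega]
  simp

theorem asc_self (p : ℕ) : asc p p = σ p := by
  simp [asc]

theorem asc_eq_mul {p q : ℕ} (h : p ≤ q) : asc p q = σ p * asc (p + 1) q := by
  rw [asc, asc, show q + 1 - p = (q + 1 - (p + 1)) + 1 by omega, List.range'_succ]
  simp

theorem commute_asc {p q i : ℕ} (h : q + 2 ≤ i ∨ i + 2 ≤ p) : Commute (asc p q) (σ i) := by
  refine Commute.list_prod_left _ _ fun x hx => ?_
  obtain ⟨j, hj, rfl⟩ := List.mem_map.1 hx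
  rw [List.mem_range'_1] at hj
  exact commute_σ (by omega)

theorem semiconjBy_asc {p q i : ℕ} (hp : p ≤ i) (hq : i < q) :
    SemiconjBy (asc p q) (σ i) (σ (i + 1)) := by
  obtain ⟨d, rfl⟩ := Nat.exists_eq_add_of_lt hq
  induction d with
  | zero =>
    have hc : Commute (asc p i * (σ i)⁻¹) (σ (i + 1)) := by
      cases i with
      | zero =>
        obtain rfl : p = 0 := by omega
        rw [asc_self, mul_inv_cancel]
        exact Commute.one_left _
      | succ i =>
        rw [asc_succ hp, mul_inv_cancel_right]
        exact commute_asc (Or.inl le_rfl)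
    rw [Nat.add_zero, asc_succ (by omega), SemiconjBy]
    calc asc p i * σ (i + 1) * σ i
        = asc p i * (σ i)⁻¹ * (σ i * σ (i + 1) * σ i) := by group
      _ = (asc p i * (σ i)⁻¹ * σ (i + 1)) * σ i * σ (i + 1) := by rw [σ_braid]; simp only [mul_assoc]
      _ = σ (i + 1) * (asc p i * σ (i + 1)) := by rw [hc.eq]; group
  | succ d ih =>
    rw [← add_assoc, asc_succ (by omega)]
    exact (ih (by omega)).mul_left (commute_σ (by omega))

theorem semiconjBy_asc_asc {p q i j : ℕ} (hp : p ≤ i) (hq : j < q) :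
    SemiconjBy (asc p q) (asc i j) (asc (i + 1) (j + 1)) := by
  rcases lt_or_ge j i with h | h
  · rw [asc_of_lt h, asc_of_lt (Nat.succ_lt_succ h)]
    exact SemiconjBy.one_right _
  · obtain ⟨d, rfl⟩ := Nat.exists_eq_add_of_le h
    induction d with
    | zero => simpa [asc_self] using semiconjBy_asc hp hq
    | succ d ih =>
      rw [← add_assoc, asc_succ (by omega), asc_succ (by omega)]
      exact (ih (by omega) (by omega)).mul_right (semiconjBy_asc (by omega) (by omega))

theorem asc_mul_asc {p q : ℕ} (h : p ≤ q + 1) :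
    asc p (q + 1) * asc p (q + 1) = σ p * asc p (q + 1) * asc p q := by
  rw [mul_assoc, (semiconjBy_asc_asc le_rfl (Nat.lt_succ_self q)).eq, ← mul_assoc, ← asc_eq_mul h]

theorem asc_mem_below {n p q : ℕ} (hp : 1 ≤ p) (hq : q < n) : asc p q ∈ below n := by
  refine Subgroup.list_prod_mem _ fun x hx => ?_
  obtain ⟨j, hj, rfl⟩ := List.mem_map.1 hx
  rw [List.mem_range'_1] at hj
  exact σ_mem_below (by omega) (by omega)

theorem commute_of_mem_below {n i : ℕ} (h : n + 1 ≤ i) {g : Br} (hg : g ∈ below n) :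
    Commute g (σ i) := by
  refine Subgroup.closure_induction (p := fun g _ => Commute g (σ i)) ?_ (Commute.one_left _)
    (fun _ _ _ _ => Commute.mul_left) (fun _ _ => Commute.inv_left) hg
  rintro _ ⟨j, -, hj, rfl⟩
  exact commute_σ (by omega)

end Br

namespace SameKnot

/-- Cyclic permutation of a braid. -/
theorem rotate {n : ℕ} {g h : Br} (hk : IsKnotBraid n (g * h)) (hg : g ∈ Br.below n) :
    SameKnot n (g * h) n (h * g) :=
  SameKnot.mul_comm hg ((Subgroup.mul_mem_cancel_left _ hg).1 hk.mem) hk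

theorem conj {n : ℕ} {g x : Br} (hk : IsKnotBraid n g) (hx : x ∈ Br.below n) :
    SameKnot n g n (x * g * x⁻¹) := by
  have e : g = x⁻¹ * (x * g) := by group
  have := rotate (e ▸ hk) (inv_mem hx)
  rwa [← e] at this

theorem of_semiconjBy {n : ℕ} {g g' x : Br} (hk : IsKnotBraid n g) (hx : x ∈ Br.below n)
    (e : SemiconjBy x g g') : SameKnot n g n g' := by
  have h := conj hk hx
  rwa [e.eq, mul_inv_cancel_right] at h

/-- Positive stabilization between the two lowest positions; `g'` is `g` moved up by one. -/
theorem stabilize_bottom {n : ℕ} {g g' : Br} (hk : IsKnotBraid n g)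
    (hg : SemiconjBy (Br.asc 1 n) g g') : SameKnot n g (n + 1) (Br.σ 1 * g') := by
  obtain ⟨m, rfl⟩ : ∃ m, n = m + 1 := ⟨n - 1, by have := hk.closes.1; omega⟩
  set U := Br.asc 1 (m + 1) with hU
  set V := Br.asc 1 m with hV
  have hVm : V ∈ Br.below (m + 1) := Br.asc_mem_below le_rfl (Nat.lt_succ_self m)
  have h1 := conj hk (inv_mem hVm)
  have h2 := stabilize h1.right
  have h3 := conj h2.right (mul_mem (Br.asc_mem_below le_rfl (Nat.lt_succ_self (m + 1)))
    (Br.below_mono (Nat.le_succ _) hVm) : U * V ∈ Br.below (m + 1 + 1))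
  have e : U * V * (Br.σ (m + 1) * (V⁻¹ * g * V⁻¹⁻¹)) * (U * V)⁻¹ = Br.σ 1 * g' := by
    have e1 : U * U = Br.σ 1 * U * V := Br.asc_mul_asc (by omega)
    have e2 : U = V * Br.σ (m + 1) := Br.asc_succ (by omega)
    calc _ = U * (V * Br.σ (m + 1)) * V⁻¹ * g * U⁻¹ := by group
      _ = Br.σ 1 * (U * g) * U⁻¹ := by rw [← e2, e1]; group
      _ = _ := by rw [hg.eq]; group
  exact h1.trans (h2.trans (e ▸ h3))

end SameKnot

theorem IsKnotBraid.of_perm_eq {n : ℕ} {g h : Br} (hk : IsKnotBraid n g) (hh : h ∈ Br.below n)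
    (e : h.perm = g.perm) : IsKnotBraid n h :=
  ⟨hh, e ▸ hk.closes⟩

/-- The exchange move: a positive and a negative letter `σ_n` that occur once each in a braid on
`n + 1` strands can be exchanged. -/
theorem SameKnot.exchange {n : ℕ} (hn : 1 ≤ n) {α β : Br} (hα : α ∈ Br.below n) (hβ : β ∈ Br.below n)
    (hk : IsKnotBraid (n + 1) (α * Br.σ n * β * (Br.σ n)⁻¹)) :
    SameKnot (n + 1) (α * Br.σ n * β * (Br.σ n)⁻¹) (n + 1) (α * (Br.σ n)⁻¹ * β * Br.σ n) := by
  have hα' := Br.below_mono (Nat.le_succ n) hα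
  have hβ' := Br.below_mono (Nat.le_succ n) hβ
  have hs := Br.σ_mem_below hn (Nat.lt_succ_self n)
  have k1 : IsKnotBraid (n + 1) (α * (Br.σ n)⁻¹ * β * Br.σ n) :=
    hk.of_perm_eq (mul_mem (mul_mem (mul_mem hα' (inv_mem hs)) hβ') hs)
      (by simp only [Br.perm_mul, Br.perm_inv, Br.perm_σ, Equiv.swap_inv])
  set s := Br.σ n with hs_def
  set t := Br.σ (n + 1) with ht_def
  have hts : s * t * s = t * s * t := Br.σ_braid n
  have ht := Br.σ_mem_below (Nat.succ_pos n) (Nat.lt_succ_self (n + 1))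
  have cα : t * α = α * t := (Br.commute_of_mem_below le_rfl hα).eq.symm
  have cβ : β * t⁻¹ = t⁻¹ * β := (Br.commute_of_mem_below le_rfl hβ).inv_right.eq
  have h1 := conj hk (inv_mem (mul_mem hs hs))
  have h2 := conj k1 (mul_mem (mul_mem hs hβ') hs)
  have h3 := stabilize h1.right
  have h4 := stabilize h2.right
  have up := Br.below_mono (Nat.le_succ (n + 1))
  have h5 := conj h3.right (mul_mem (mul_mem (inv_mem (mul_mem (mul_mem (up hα') (inv_mem (up hs)))
    (inv_mem (up hs)))) ht) (mul_mem (mul_mem (mul_mem (up hα') (up hs)) (up hβ')) (up hs)) :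
    (α * s⁻¹ * s⁻¹)⁻¹ * t * (α * s * β * s) ∈ Br.below (n + 1 + 1))
  have e1 : s * t * s⁻¹ = t⁻¹ * s * t := by
    calc s * t * s⁻¹ = t⁻¹ * (t * s * t) * s⁻¹ := by group
      _ = t⁻¹ * s * t := by rw [← hts]; group
  have e2 : t * s * t⁻¹ = s⁻¹ * t * s := by
    calc t * s * t⁻¹ = s⁻¹ * (s * t * s) * t⁻¹ := by group
      _ = s⁻¹ * t * s := by rw [hts]; group
  have e : (α * s⁻¹ * s⁻¹)⁻¹ * t * (α * s * β * s) * (t * ((s * s)⁻¹ * (α * s * β * s⁻¹) * (s * s)⁻¹⁻¹)) *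
      ((α * s⁻¹ * s⁻¹)⁻¹ * t * (α * s * β * s))⁻¹ =
      t * (s * β * s * (α * s⁻¹ * β * s) * (s * β * s)⁻¹) := by
    calc _ = (α * s⁻¹ * s⁻¹)⁻¹ * (t * α) * s * β * (s * t * s⁻¹) * s⁻¹ * t⁻¹ * (α * s⁻¹ * s⁻¹) := by group
      _ = (α * s⁻¹ * s⁻¹)⁻¹ * α * t * s * (β * t⁻¹) * s * t * s⁻¹ * t⁻¹ * (α * s⁻¹ * s⁻¹) := by
        rw [cα, e1]; simp only [mul_assoc]
      _ = s ^ 2 * (t * s * t⁻¹) * β * ((s * t * s⁻¹) * t⁻¹) * (α * s⁻¹ * s⁻¹) := by rw [cβ]; group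
      _ = s * t * s * (β * t⁻¹) * s * (α * s⁻¹ * s⁻¹) := by rw [e1, e2]; group
      _ = s * (t * s * t⁻¹) * β * s * (α * s⁻¹ * s⁻¹) := by rw [cβ]; simp only [mul_assoc]
      _ = _ := by rw [e2]; group
  exact h1.trans (h3.trans (h5.trans (e ▸ h4.symm.trans h2.symm)))

/-- In the closure of a braid with two ascending products up to the highest letter and a power of this
letter, positive stabilizations trade the power for longer products. -/
theorem SameKnot.inflate_top {n p q : ℕ} (hpn : p ≤ n + 1) (hqn : q ≤ n + 1)
    {w : Br} (hw : w ∈ Br.below (n + 2)) (e : ℕ)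
    (hk : IsKnotBraid (n + 2) (w * Br.asc p (n + 1) * Br.asc q (n + 1) * Br.σ (n + 1) ^ e)) :
    SameKnot (n + 2) (w * Br.asc p (n + 1) * Br.asc q (n + 1) * Br.σ (n + 1) ^ e)
      (n + 2 + e) (w * Br.asc p (n + 1 + e) * Br.asc q (n + 1 + e)) := by
  induction e generalizing n with
  | zero => simpa using SameKnot.refl hk
  | succ e ih =>
    set P := Br.asc p (n + 1) with hP
    set Q := Br.asc q (n + 1) with hQ
    set s := Br.σ (n + 1) with hs_def
    set t := Br.σ (n + 2) with ht_def
    have hs : s ∈ Br.below (n + 2) := Br.σ_mem_below (by omega) (by omega)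
    have ht : t ∈ Br.below (n + 3) := Br.σ_mem_below (by omega) (by omega)
    have up := Br.below_mono (Nat.le_succ (n + 2))
    have hst : s * t * s = t * s * t := Br.σ_braid (n + 1)
    have h1 := conj hk hs
    have h2 := stabilize h1.right
    have h3 := conj h2.right (inv_mem (mul_mem ht (up hs)))
    have eP : Br.asc p (n + 2) = P * t := Br.asc_succ (by omega)
    have eQ : Br.asc q (n + 2) = Q * t := Br.asc_succ (by omega)
    have eQ' : Q = Br.asc q n * s := Br.asc_succ hqn
    have ct : Commute (Br.asc q n) t := Br.commute_asc (by omega)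
    have est : SemiconjBy (t * s) t s := by rw [SemiconjBy, ← hst]; simp only [mul_assoc]
    have ee : (t * s)⁻¹ * (t * (s * (w * P * Q * s ^ (e + 1)) * s⁻¹)) * (t * s)⁻¹⁻¹ =
        w * Br.asc p (n + 2) * Br.asc q (n + 2) * t ^ e := by
      calc _ = w * P * Q * (s ^ e * (t * s)) := by rw [pow_succ]; group
        _ = w * P * Br.asc q n * (s * t * s) * t ^ e := by
          rw [← (est.pow_right e).eq, eQ']; simp only [mul_assoc]
        _ = w * P * (Br.asc q n * t) * s * t * t ^ e := by rw [hst]; simp only [mul_assoc]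
        _ = _ := by rw [ct.eq, eP, eQ, eQ']; simp only [mul_assoc]
    rw [ee] at h3
    have h4 := ih (n := n + 1) (by omega) (by omega) (up hw) h3.right
    have h5 := h1.trans (h2.trans (h3.trans h4))
    rw [show n + 1 + 1 + e = n + 1 + (e + 1) by ring, show n + 1 + 2 + e = n + 2 + (e + 1) by ring] at h5
    exact h5

/-- In the closure of a braid with the square of an ascending product from the lowest letter and a power
of this letter, positive stabilizations trade the power for a longer product, while the rest `w 0` of
the braid moves up to `w e`. -/
theorem SameKnot.inflate_bottom {n j e : ℕ} (i : ℤ) (hj : j + 2 ≤ n) {w : ℕ → Br}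
    (hw : ∀ d, SemiconjBy (Br.asc 1 (n + d)) (w d) (w (d + 1)))
    (hk : IsKnotBraid n (Br.σ 1 ^ (i + e) * Br.asc 1 (j + 1) * Br.asc 1 (j + 1) * w 0)) :
    SameKnot n (Br.σ 1 ^ (i + e) * Br.asc 1 (j + 1) * Br.asc 1 (j + 1) * w 0)
      (n + e) (Br.σ 1 ^ i * Br.asc 1 (j + 1 + e) * Br.asc 1 (j + 1 + e) * w e) := by
  induction e generalizing n j w with
  | zero => simpa using SameKnot.refl hk
  | succ e ih =>
    set U := Br.asc 1 (j + 1) with hU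
    set S := Br.asc 2 (j + 2) with hS
    set s := Br.σ 1 with hs_def
    set t := Br.σ 2 with ht_def
    have hst : s * t * s = t * s * t := Br.σ_braid 1
    have hs : s ∈ Br.below n := Br.σ_mem_below (by omega) (by omega)
    have ht : t ∈ Br.below (n + 1) := Br.σ_mem_below (by omega) (by omega)
    have h1 := conj hk (inv_mem hs)
    have cs : SemiconjBy (Br.asc 1 n) s t := Br.semiconjBy_asc le_rfl (by omega)
    have cU : SemiconjBy (Br.asc 1 n) U S := Br.semiconjBy_asc_asc le_rfl (by omega)
    have cw : SemiconjBy (Br.asc 1 n) (w 0) (w 1) := hw 0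
    have h2 := stabilize_bottom h1.right ((cs.inv_right.mul_right
      ((((cs.zpow_right (i + (e + 1 : ℕ))).mul_right cU).mul_right cU).mul_right cw)).mul_right
      cs.inv_right.inv_right)
    have h3 := conj h2.right ht
    have eU : Br.asc 1 (j + 2) = s * S := Br.asc_eq_mul (by omega)
    have est : SemiconjBy (t * s) t s := by rw [SemiconjBy, ← hst]; simp only [mul_assoc]
    have eUU : Br.asc 1 (j + 2) * Br.asc 1 (j + 2) = t * s * S * S := by
      have : SemiconjBy (Br.asc 1 (j + 2)) s t := Br.semiconjBy_asc le_rfl (by omega)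
      calc _ = Br.asc 1 (j + 2) * s * S := by rw [mul_assoc, ← eU]
        _ = _ := by rw [this.eq, eU]; simp only [mul_assoc]
    have ee : t * (s * (t⁻¹ * (t ^ (i + (e + 1 : ℕ)) * S * S * w 1) * t⁻¹⁻¹)) * t⁻¹ =
        s ^ (i + e) * Br.asc 1 (j + 2) * Br.asc 1 (j + 2) * w 1 := by
      calc _ = t * s * t ^ (i + e) * S * S * w 1 := by
            push_cast; group
        _ = s ^ (i + e) * (t * s * S * S) * w 1 := by
          rw [(est.zpow_right (i + e)).eq]; simp only [mul_assoc]
        _ = _ := by rw [← eUU]; simp only [mul_assoc]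
    rw [ee] at h3
    have h4 := ih (n := n + 1) (j := j + 1) (w := fun d => w (d + 1)) (by omega)
      (fun d => by have := hw (d + 1); rwa [show n + 1 + d = n + (d + 1) by ring]) h3.right
    have h5 := h1.trans (h2.trans (h3.trans h4))
    rw [show j + 1 + 1 + e = j + 1 + (e + 1) by ring, show n + 1 + e = n + (e + 1) by ring] at h5
    exact h5

/-! ### Identities in groups with braid relations -/

section GroupIdentities

variable {G : Type*} [Group G]

theorem mul_mul_inv_of_braid {x y : G} (h : x * y * x = y * x * y) : x * y * x⁻¹ = y⁻¹ * x * y := by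
  calc x * y * x⁻¹ = y⁻¹ * (y * x * y) * x⁻¹ := by group
    _ = y⁻¹ * x * y := by rw [← h]; group

theorem inv_mul_mul_of_braid {x y : G} (h : x * y * x = y * x * y) : x⁻¹ * y * x = y * x * y⁻¹ := by
  calc x⁻¹ * y * x = x⁻¹ * (y * x * y) * y⁻¹ := by group
    _ = y * x * y⁻¹ := by rw [← h]; group

/-- For `x` and `y` satisfying the braid relation, conjugation by `x y` maps `x` to `y`. -/
theorem semiconjBy_of_braid {x y : G} (h : x * y * x = y * x * y) : SemiconjBy (x * y) x y := by
  rw [SemiconjBy, h, mul_assoc]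

/-- Conjugation by the half twist on four strands exchanges the outer generators and fixes the middle one. -/
theorem semiconjBy_flip_left {a b c : G} (hab : a * b * a = b * a * b) (hbc : b * c * b = c * b * c)
    (hac : a * c = c * a) : SemiconjBy (a * b * c * a * b * a) a c := by
  rw [SemiconjBy]
  calc a * b * c * a * b * a * a = a * b * c * (a * b * a) * a := by simp only [mul_assoc]
    _ = a * (b * c * b) * a * b * a := by rw [hab]; simp only [mul_assoc]
    _ = (a * c) * b * c * a * b * a := by rw [hbc]; simp only [mul_assoc]
    _ = _ := by rw [hac]; simp only [mul_assoc]

theorem semiconjBy_flip_middle {a b c : G} (hab : a * b * a = b * a * b) (hac : a * c = c * a) :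
    SemiconjBy (a * b * c * a * b * a) b b := by
  have h1 : SemiconjBy (a * b * a) b a := by
    rw [SemiconjBy]
    calc a * b * a * b = a * (b * a * b) := by simp only [mul_assoc]
      _ = _ := by rw [← hab]
  have h2 : SemiconjBy (a * b * c) a b := by
    rw [SemiconjBy]
    calc a * b * c * a = a * b * (c * a) := by simp only [mul_assoc]
      _ = (a * b * a) * c := by rw [← hac]; simp only [mul_assoc]
      _ = _ := by rw [hab]; simp only [mul_assoc]
  have := h2.mul_left h1
  simpa only [mul_assoc] using this

theorem semiconjBy_flip_right {a b c : G} (hab : a * b * a = b * a * b) (hbc : b * c * b = c * b * c)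
    (hac : a * c = c * a) : SemiconjBy (a * b * c * a * b * a) c a := by
  rw [SemiconjBy]
  calc a * b * c * a * b * a * c = a * b * (c * a) * b * (a * c) := by simp only [mul_assoc]
    _ = a * b * (a * c) * b * (c * a) := by rw [hac]
    _ = a * (b * a) * (c * b * c) * a := by simp only [mul_assoc]
    _ = a * (b * a * b) * c * b * a := by rw [← hbc]; simp only [mul_assoc]
    _ = a * (a * b * (a * c) * b * a) := by rw [← hab]; simp only [mul_assoc]
    _ = _ := by rw [hac]; simp only [mul_assoc]

/-- The factor of the first braid containing the power of `c = σ₃`, multiplied on both sides, becomes a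
word with a single letter `c` and a single letter `c⁻¹`, as the exchange move requires. -/
theorem flipped_exchange_word_eq {a b c : G} (hab : a * b * a = b * a * b) (hbc : b * c * b = c * b * c)
    (hac : a * c = c * a) (n : ℕ) :
    a * b * a * c * b⁻¹ * b⁻¹ * c ^ n * b * c⁻¹ * a⁻¹ * a⁻¹ =
      c⁻¹ * b⁻¹ * b⁻¹ * a * b ^ (n + 1) * a * b⁻¹ * c * b * a⁻¹ := by
  have hq : SemiconjBy (c * b * a * (b * c * b * b * c)) b a := by
    have h1 : SemiconjBy (b * c * b * b * c) b b := by
      rw [SemiconjBy]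
      calc b * c * b * b * c * b = b * c * b * (b * c * b) := by simp only [mul_assoc]
        _ = b * c * b * (c * b * c) := by rw [← hbc]
        _ = b * (c * b * c) * b * c := by simp only [mul_assoc]
        _ = _ := by rw [← hbc]; simp only [mul_assoc]
    have h2 : SemiconjBy (c * b * a) b a := by
      rw [SemiconjBy]
      calc c * b * a * b = c * (b * a * b) := by simp only [mul_assoc]
        _ = (c * a) * b * a := by rw [← hab]; simp only [mul_assoc]
        _ = _ := by rw [← hac]; simp only [mul_assoc]
    exact h2.mul_left h1
  have hbn : c * c ^ n * b = b * c * (b * b ^ n) * c⁻¹ := by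
    have := ((semiconjBy_of_braid hbc).pow_right (n + 1)).eq
    rw [pow_succ', pow_succ'] at this
    rw [this]; group
  have han : a * (b * b ^ n) = b⁻¹ * (a * a ^ n) * b * a := by
    have := ((semiconjBy_of_braid hab.symm).pow_right (n + 1)).eq
    rw [pow_succ', pow_succ'] at this
    rw [mul_assoc b⁻¹, mul_assoc b⁻¹, mul_assoc (a * a ^ n), ← this]; group
  have e1 : c * b⁻¹ * b⁻¹ * c⁻¹ = b⁻¹ * c⁻¹ * c⁻¹ * b := by
    calc _ = (c * b * c⁻¹)⁻¹ * (c * b * c⁻¹)⁻¹ := by group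
      _ = _ := by rw [mul_mul_inv_of_braid hbc.symm]; group
  have e2 : a * b * a * b⁻¹ = b * a := by rw [hab]; group
  have hac' : Commute a c := hac
  have e3 : c * b * c⁻¹ * c⁻¹ = b⁻¹ * b⁻¹ * c * b := by
    rw [mul_mul_inv_of_braid hbc.symm]
    calc _ = b⁻¹ * (c * b * c⁻¹) := by simp only [mul_assoc]
      _ = _ := by rw [mul_mul_inv_of_braid hbc.symm]; simp only [mul_assoc]
  have e4 : b * a * c⁻¹ * c⁻¹ * b * b * c * b =
      c⁻¹ * b⁻¹ * b⁻¹ * b⁻¹ * (c * b * a * (b * c * b * b * c)) := by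
    calc _ = c⁻¹ * (c * b * (a * (c⁻¹ * c⁻¹))) * b * b * c * b := by group
      _ = c⁻¹ * (c * b * c⁻¹ * c⁻¹) * a * b * b * c * b := by
        rw [(hac'.inv_right.mul_right hac'.inv_right).eq]; simp only [mul_assoc]
      _ = c⁻¹ * b⁻¹ * b⁻¹ * c * b * a * b * (b * c * b) := by rw [e3]; simp only [mul_assoc]
      _ = c⁻¹ * b⁻¹ * b⁻¹ * c * b * a * b * (c * b * c) := by rw [hbc]
      _ = c⁻¹ * b⁻¹ * b⁻¹ * b⁻¹ * (b * c * b) * a * b * c * b * c := by group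
      _ = c⁻¹ * b⁻¹ * b⁻¹ * b⁻¹ * c * b * (c * a) * b * c * b * c := by
        rw [hbc]; simp only [mul_assoc]
      _ = c⁻¹ * b⁻¹ * b⁻¹ * b⁻¹ * c * b * a * (c * b * c) * b * c := by
        rw [← hac]; simp only [mul_assoc]
      _ = _ := by rw [← hbc]; simp only [mul_assoc]
  have e5 : c * b * a * (b * c * b * b * c) * c⁻¹ * c⁻¹ * a⁻¹ * a⁻¹ =
      b * b * c * b⁻¹ * a * b := by
    calc _ = c * b * a * b * (c * b * c⁻¹) * (c * b * c⁻¹) * a⁻¹ * a⁻¹ := by group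
      _ = c * b * (a * (c * c)) * b * a⁻¹ * a⁻¹ := by rw [mul_mul_inv_of_braid hbc.symm]; group
      _ = c * b * c * c * (a * b * a⁻¹) * a⁻¹ := by
        rw [(hac'.mul_right hac').eq]; simp only [mul_assoc]
      _ = c * b * c * c * b⁻¹ * a * b * a⁻¹ := by
        rw [mul_mul_inv_of_braid hab]; simp only [mul_assoc]
      _ = c * b * c * c * b⁻¹ * (a * b * a⁻¹) := by simp only [mul_assoc]
      _ = (c * b * c) * c * b⁻¹ * b⁻¹ * a * b := by
        rw [mul_mul_inv_of_braid hab]; simp only [mul_assoc]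
      _ = b * c * (b * c * b⁻¹) * b⁻¹ * a * b := by rw [← hbc]; simp only [mul_assoc]
      _ = _ := by rw [mul_mul_inv_of_braid hbc]; group
  have e6 : a * b * a * a * b⁻¹ * c * b * a⁻¹ = b * b * c * b⁻¹ * a * b := by
    calc _ = a * (b * a * b⁻¹) * (b * a * b⁻¹) * c * b * a⁻¹ := by group
      _ = b * b * (a * c) * b * a⁻¹ := by rw [mul_mul_inv_of_braid hab.symm]; group
      _ = b * b * c * (a * b * a⁻¹) := by rw [hac]; simp only [mul_assoc]
      _ = _ := by rw [mul_mul_inv_of_braid hab]; simp only [mul_assoc]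
  calc _ = (a * b * a) * (c * b⁻¹ * b⁻¹ * c⁻¹) * (c * c ^ n * b) * c⁻¹ * a⁻¹ * a⁻¹ := by group
    _ = (a * b * a * b⁻¹) * c⁻¹ * c⁻¹ * b * b * c * b * b ^ n * c⁻¹ * c⁻¹ * a⁻¹ * a⁻¹ := by
      rw [e1, hbn]; simp only [mul_assoc]
    _ = (b * a * c⁻¹ * c⁻¹ * b * b * c * b) * b ^ n * c⁻¹ * c⁻¹ * a⁻¹ * a⁻¹ := by
      rw [e2]
    _ = c⁻¹ * b⁻¹ * b⁻¹ * b⁻¹ * (c * b * a * (b * c * b * b * c) * b ^ n) * c⁻¹ * c⁻¹ * a⁻¹ * a⁻¹ := by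
      rw [e4]; simp only [mul_assoc]
    _ = c⁻¹ * b⁻¹ * b⁻¹ * b⁻¹ * a ^ n *
        (c * b * a * (b * c * b * b * c) * c⁻¹ * c⁻¹ * a⁻¹ * a⁻¹) := by
      rw [(hq.pow_right n).eq]; simp only [mul_assoc]
    _ = c⁻¹ * b⁻¹ * b⁻¹ * b⁻¹ * a ^ n * (a * b * a * a * b⁻¹ * c * b * a⁻¹) := by rw [e5, e6]
    _ = c⁻¹ * b⁻¹ * b⁻¹ * (a * (b * b ^ n)) * a * b⁻¹ * c * b * a⁻¹ := by
      rw [han, ← pow_succ', pow_succ a n]; simp only [mul_assoc]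
    _ = _ := by rw [pow_succ']; simp only [mul_assoc]

/-- The inverse of a band generator of the first and the last strand, written in two ways. -/
theorem braid_triple_inv_eq {a b c : G} (hab : a * b * a = b * a * b) (hbc : b * c * b = c * b * c)
    (hac : a * c = c * a) : c * b⁻¹ * a⁻¹ * b * c⁻¹ = a * b⁻¹ * c⁻¹ * b * a⁻¹ := by
  have e1 := inv_mul_mul_of_braid hab.symm
  calc c * b⁻¹ * a⁻¹ * b * c⁻¹ = c * (b⁻¹ * a * b)⁻¹ * c⁻¹ := by group
    _ = (c * a) * b⁻¹ * (c * a)⁻¹ := by rw [e1]; group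
    _ = a * (c * b * c⁻¹)⁻¹ * a⁻¹ := by rw [← hac]; group
    _ = a * b⁻¹ * c⁻¹ * b * a⁻¹ := by rw [mul_mul_inv_of_braid hbc.symm]; group

/-- The word left by the exchange moves, conjugated so that the power of the first generator comes first. -/
theorem exchanged_word_conj_eq {a b c : G} (hab : a * b * a = b * a * b) (hbc : b * c * b = c * b * c)
    (hac : a * c = c * a) (m n : ℕ) :
    (b ^ 2)⁻¹ * (b * a⁻¹ * b ^ m * a * b⁻¹ * b⁻¹ * c⁻¹ * (b ^ n * a * b⁻¹) * c) * b ^ 2 =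
      a ^ m * b⁻¹ * b⁻¹ * c ^ n * a * b * c⁻¹ * a⁻¹ * b := by
  have e1 : a⁻¹ * b ^ m * a = b * a ^ m * b⁻¹ := by
    have := ((semiconjBy_of_braid hab).pow_right m).eq
    calc _ = a⁻¹ * (b ^ m * (a * b)) * b⁻¹ := by group
      _ = _ := by rw [← this]; group
  have e2 : c⁻¹ * b ^ n = b * c ^ n * b⁻¹ * c⁻¹ := by
    have := ((semiconjBy_of_braid hbc.symm).pow_right n).eq
    calc _ = c⁻¹ * (b ^ n * (c * b)) * b⁻¹ * c⁻¹ := by group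
      _ = _ := by rw [← this]; group
  have e3 : c⁻¹ * b⁻¹ * c = b * c⁻¹ * b⁻¹ := by
    calc _ = (c⁻¹ * b * c)⁻¹ := by group
      _ = _ := by rw [inv_mul_mul_of_braid hbc.symm]; group
  have hac' : c⁻¹ * a = a * c⁻¹ := (Commute.inv_right hac).eq.symm
  calc _ = (b ^ 2)⁻¹ * b * (a⁻¹ * b ^ m * a) * b⁻¹ * b⁻¹ * (c⁻¹ * b ^ n) * a * b⁻¹ * c * b ^ 2 := by
        simp only [mul_assoc]
    _ = a ^ m * b⁻¹ * b⁻¹ * c ^ n * b⁻¹ * (c⁻¹ * a) * b⁻¹ * c * b ^ 2 := by rw [e1, e2]; group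
    _ = a ^ m * b⁻¹ * b⁻¹ * c ^ n * b⁻¹ * a * (c⁻¹ * b⁻¹ * c) * b ^ 2 := by
      rw [hac']; simp only [mul_assoc]
    _ = a ^ m * b⁻¹ * b⁻¹ * c ^ n * (b⁻¹ * a * b) * c⁻¹ * b := by rw [e3]; group
    _ = _ := by
      rw [inv_mul_mul_of_braid hab.symm]
      have : a⁻¹ * c⁻¹ = c⁻¹ * a⁻¹ := (Commute.inv_inv hac).eq
      simp only [mul_assoc]
      rw [← mul_assoc a⁻¹, this, mul_assoc]

/-- With `s = σ₁`, `u = σ₁ ⋯ σ_{2b}`, `x = σ_{2b+1}`, `b = σ_{2b+2}` and `c = σ_{2b+3}` this matches the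
braid with additional strands at the bottom with the rows of the first grid diagram. -/
theorem gridOne_word_conj_eq {s u x b c : G} (hub : Commute u b) (huc : Commute u c) (hxc : Commute x c)
    (hsc : Commute s c) (hxb : x * b * x = b * x * b) (hs : (u * x) * (u * x) = s * (u * x) * u)
    (n : ℕ) :
    ((u * x) * u * (x * b * c⁻¹ * x⁻¹ * b)) *
        (s⁻¹ * (u * x) * (u * x) * (b⁻¹ * b⁻¹ * c ^ n * x * b * c⁻¹ * x⁻¹ * b)) *
        ((u * x) * u * (x * b * c⁻¹ * x⁻¹ * b))⁻¹ =
      u * x * b⁻¹ * (u * x * b) * (u * x)⁻¹ * s⁻¹ * c⁻¹ * (s⁻¹ * (u * x) * b) * c ^ n := by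
  have key : u * x * b⁻¹ * (u * x * b) * (u * x)⁻¹ * s⁻¹ * c⁻¹ * (s⁻¹ * (u * x) * b) * (u * x * u) =
      u * x * u * (x * b * c⁻¹ * x⁻¹ * b) * (u * x * u) * b⁻¹ * b⁻¹ := by
    have hsU : (u * x)⁻¹ * s⁻¹ * (u * x) = u * x⁻¹ * u⁻¹ := by
      calc _ = ((u * x)⁻¹ * (s * (u * x) * u) * u⁻¹)⁻¹ := by group
        _ = _ := by rw [← hs]; group
    have e2 : b⁻¹ * x * b = x * b * x⁻¹ := inv_mul_mul_of_braid hxb.symm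
    have e3 : x⁻¹ * b * x * b = b * x := by
      rw [inv_mul_mul_of_braid hxb]; group
    have e4 : x⁻¹ * x⁻¹ * b * x = b * x * b⁻¹ * b⁻¹ := by
      calc _ = x⁻¹ * (x⁻¹ * b * x * b) * b⁻¹ := by group
        _ = x⁻¹ * b * x * b⁻¹ := by rw [e3]; simp only [mul_assoc]
        _ = (x⁻¹ * b * x * b) * b⁻¹ * b⁻¹ := by rw [mul_inv_cancel_right]
        _ = _ := by rw [e3]
    calc _ = u * x * (b⁻¹ * u) * x * b * ((u * x)⁻¹ * s⁻¹ * (s⁻¹ * c⁻¹) * (u * x)) * b * (u * x * u) := by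
          rw [hsc.inv_inv.eq]; simp only [mul_assoc]
      _ = u * x * u * (b⁻¹ * x * b) * ((u * x)⁻¹ * s⁻¹ * s⁻¹ * (u * x) * c⁻¹) * b * (u * x * u) := by
          rw [← hub.inv_right.eq, ← mul_assoc _ s⁻¹ c⁻¹, mul_assoc _ c⁻¹ (u * x),
            ← ((huc.mul_left hxc).inv_right).eq]
          simp only [mul_assoc]
      _ = u * x * u * (b⁻¹ * x * b) * (((u * x)⁻¹ * s⁻¹ * (u * x)) * ((u * x)⁻¹ * s⁻¹ * (u * x)) * c⁻¹) *
            b * (u * x * u) := by group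
      _ = u * x * u * x * b * x⁻¹ * u * x⁻¹ * x⁻¹ * (u⁻¹ * c⁻¹) * b * u * x * u := by
          rw [hsU, e2]; group
      _ = u * x * u * x * b * x⁻¹ * u * (x⁻¹ * x⁻¹ * c⁻¹) * u⁻¹ * (b * u) * x * u := by
          rw [huc.inv_inv.eq]; simp only [mul_assoc]
      _ = u * x * u * x * b * x⁻¹ * (u * c⁻¹) * (x⁻¹ * x⁻¹ * b * x) * u := by
          rw [(hxc.inv_inv.mul_left hxc.inv_inv).eq, ← hub.eq]; group
      _ = u * x * u * x * b * (x⁻¹ * c⁻¹) * (u * b) * x * b⁻¹ * (b⁻¹ * u) := by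
          rw [e4, huc.inv_right.eq]; simp only [mul_assoc]
      _ = u * x * u * x * b * c⁻¹ * x⁻¹ * b * u * x * b⁻¹ * u * b⁻¹ := by
          rw [hxc.inv_inv.eq, hub.eq, ← hub.inv_right.eq]; simp only [mul_assoc]
      _ = u * x * u * x * b * c⁻¹ * x⁻¹ * b * u * x * (b⁻¹ * u) * b⁻¹ := by simp only [mul_assoc]
      _ = _ := by rw [← hub.inv_right.eq]; simp only [mul_assoc]
  have hD : Commute (u * x * u) (c ^ n) := ((huc.mul_left hxc).mul_left huc).pow_right n
  rw [mul_inv_eq_iff_eq_mul]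
  have hs' : s⁻¹ * (u * x) * (u * x) = u * x * u := by rw [mul_assoc, hs]; group
  calc _ = u * x * u * (x * b * c⁻¹ * x⁻¹ * b) * (u * x * u) * b⁻¹ * b⁻¹ * c ^ n * (x * b * c⁻¹ * x⁻¹ * b) := by
        rw [hs']; simp only [mul_assoc]
    _ = u * x * b⁻¹ * (u * x * b) * (u * x)⁻¹ * s⁻¹ * c⁻¹ * (s⁻¹ * (u * x) * b) *
          (u * x * u * c ^ n) * (x * b * c⁻¹ * x⁻¹ * b) := by rw [← key]; simp only [mul_assoc]
    _ = _ := by rw [hD.eq]; simp only [mul_assoc]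

/-- With `α = σ₁`, `β = σ₂`, `u = σ₁ ⋯ σ_{2b}`, `x = σ_{2b+1}`, `b = σ_{2b+2}`, `c = σ_{2b+3}` and
`Uₖ = σₖ ⋯ σ_{2b+3}` this matches the braid with additional strands at the bottom with the rows of the
second grid diagram. -/
theorem gridTwo_word_eq {α β u x b c U₂ U₃ : G} (hub : Commute u b) (huc : Commute u c)
    (hxc : Commute x c) (hxb : x * b * x = b * x * b) (hbc : b * c * b = c * b * c)
    (hU : (u * x) * (u * x) = α * (u * x) * u)
    (hY : (u * x * b) * (u * x * b) = α * (u * x * b) * (u * x))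
    (hZ : (u * x * b * c) * (u * x * b * c) = α * (u * x * b * c) * (u * x * b))
    (hYα : SemiconjBy (u * x * b) α β) (hZα : SemiconjBy (u * x * b * c) α β)
    (h₂ : u * x * b * c = α * U₂) (h₃ : U₂ = β * U₃) (hα₃ : Commute α U₃) (hαβ : α * β * α = β * α * β) :
    c * b * c⁻¹ * (u * x) * (u * x) * b * x⁻¹ * c * b⁻¹ * b⁻¹ * c⁻¹ =
      (u * x * b)⁻¹ * (u * x * b)⁻¹ * β⁻¹ * α⁻¹ * α⁻¹ * U₃ * U₂ * (u * x * b * c) * (u * x * b) := by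
  set E := c * b * c⁻¹ * (u * x) * (u * x) * b * x⁻¹ * c * b⁻¹ * b⁻¹ * c⁻¹ with hE
  set Y := u * x * b with hY_def
  set Z := Y * c with hZ_def
  set U := u * x with hU_def
  have F : U * U * b * b * x * b * u⁻¹ * E = c * Y * Y * Y := by
    have i1 : b * c * b * c⁻¹ = c * b := by rw [hbc]; group
    have i2 : b * U * b * x⁻¹ = U * b := by
      calc _ = (b * u) * x * b * x⁻¹ := by simp only [hU_def, mul_assoc]
        _ = u * (b * x * b) * x⁻¹ := by rw [← hub.eq]; simp only [mul_assoc]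
        _ = _ := by rw [← hxb, hU_def]; group
    have i3 : b * c * b⁻¹ * b⁻¹ * c⁻¹ = c⁻¹ * c⁻¹ * b := by
      rw [mul_mul_inv_of_braid hbc]
      calc _ = c⁻¹ * (b * c * b⁻¹) * c⁻¹ := by simp only [mul_assoc]
        _ = _ := by rw [mul_mul_inv_of_braid hbc]; group
    have i4 : c * b * c⁻¹ * c⁻¹ = b⁻¹ * b⁻¹ * c * b := by
      rw [mul_mul_inv_of_braid hbc.symm]
      calc _ = b⁻¹ * (c * b * c⁻¹) := by simp only [mul_assoc]
        _ = _ := by rw [mul_mul_inv_of_braid hbc.symm]; simp only [mul_assoc]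
    have hUc : Commute U c := huc.mul_left hxc
    have hcb : Commute u⁻¹ (c * b * c⁻¹) := ((huc.mul_right hub).mul_right huc.inv_right).inv_left
    calc _ = U * U * b * b * x * b * (u⁻¹ * (c * b * c⁻¹)) * U * U * b * x⁻¹ * c * b⁻¹ * b⁻¹ * c⁻¹ := by
          simp only [hE, mul_assoc]
      _ = U * U * b * b * x * (b * c * b * c⁻¹) * (u⁻¹ * U) * U * b * x⁻¹ * c * b⁻¹ * b⁻¹ * c⁻¹ := by
          rw [hcb.eq]; simp only [mul_assoc]
      _ = U * U * b * b * (x * c) * b * x * U * b * x⁻¹ * c * b⁻¹ * b⁻¹ * c⁻¹ := by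
          rw [i1, hU_def, inv_mul_cancel_left]; simp only [mul_assoc]
      _ = U * U * b * b * c * (x * b * x) * U * b * x⁻¹ * c * b⁻¹ * b⁻¹ * c⁻¹ := by
          rw [hxc.eq]; simp only [mul_assoc]
      _ = U * U * b * b * c * b * x * (b * U * b * x⁻¹) * c * b⁻¹ * b⁻¹ * c⁻¹ := by
          rw [hxb]; simp only [mul_assoc]
      _ = U * U * b * b * c * b * x * U * (b * c * b⁻¹ * b⁻¹ * c⁻¹) := by
          rw [i2]; simp only [mul_assoc]
      _ = U * U * b * b * c * b * ((x * U) * (c⁻¹ * c⁻¹)) * b := by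
          rw [i3]; simp only [mul_assoc]
      _ = U * U * b * b * (c * b * c⁻¹ * c⁻¹) * x * U * b := by
          rw [((hxc.mul_left hUc).inv_right.mul_right (hxc.mul_left hUc).inv_right).eq]
          simp only [mul_assoc]
      _ = (U * U * c) * b * x * U * b := by rw [i4]; group
      _ = c * U * u * (x * b * x) * U * b := by
          rw [(hUc.mul_left hUc).eq, hU_def]; simp only [mul_assoc]
      _ = c * U * (u * b) * x * b * U * b := by rw [hxb]; simp only [mul_assoc]
      _ = _ := by rw [hub.eq, hY_def, hU_def]; simp only [mul_assoc]
  have H : β * α * α * β * Y * Y * E = Y * c * Y * Y * Y := by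
    have e1 : α * Y = Y * (U * b * U⁻¹) := by
      calc α * Y = α * Y * U * U⁻¹ := by group
        _ = Y * (U * b * U⁻¹) := by rw [← hY]; simp only [hY_def, mul_assoc]
    have e2 : α * U * u = U * U := hU.symm
    have e3 : α * U = U * (u * x * u⁻¹) := by
      calc α * U = α * U * u * u⁻¹ := by group
        _ = U * (u * x * u⁻¹) := by rw [← hU]; simp only [hU_def, mul_assoc]
    calc _ = β * α * α * (β * Y) * Y * E := by simp only [mul_assoc]
      _ = β * α * (α * Y) * α * Y * E := by rw [← hYα.eq]; simp only [mul_assoc]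
      _ = β * α * Y * (U * b * U⁻¹) * α * Y * E := by rw [e1]; simp only [mul_assoc]
      _ = β * (α * Y) * (U * b * U⁻¹) * α * Y * E := by simp only [mul_assoc]
      _ = (β * Y) * (U * b * U⁻¹) * (U * b * U⁻¹) * α * Y * E := by rw [e1]; simp only [mul_assoc]
      _ = Y * α * U * b * b * U⁻¹ * (α * U) * b * E := by
        rw [← hYα.eq, ← show U * b = Y from rfl]; group
      _ = Y * α * U * (b * b * u) * x * (u⁻¹ * b) * E := by rw [e3]; group
      _ = Y * (α * U * u) * b * b * x * b * u⁻¹ * E := by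
        rw [((hub.mul_right hub)).eq.symm, hub.inv_left.eq]; simp only [mul_assoc]
      _ = Y * (U * U * b * b * x * b * u⁻¹ * E) := by rw [e2]; simp only [mul_assoc]
      _ = _ := by rw [F]; simp only [mul_assoc]
  have K : α * β * α * (α * α * β * Y * Y * E) = α * β * α * (U₃ * U₂ * Z * Y) := by
    calc _ = β * α * (β * α * α * β * Y * Y * E) := by
          calc _ = (α * β * α) * α * α * β * Y * Y * E := by simp only [mul_assoc]
            _ = _ := by rw [hαβ]; simp only [mul_assoc]
      _ = β * (α * Z * Y) * Y * Y := by rw [H]; simp only [hZ_def, mul_assoc]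
      _ = (β * Z) * Z * Y * Y := by rw [← hZ]; simp only [mul_assoc]
      _ = Z * (α * Z * Y) * Y := by rw [← hZα.eq]; simp only [mul_assoc]
      _ = Z * Z * Z * Y := by rw [← hZ]; simp only [mul_assoc]
      _ = α * (β * U₃) * (α * U₂) * Z * Y := by rw [← h₃, ← h₂]
      _ = α * β * (U₃ * α) * U₂ * Z * Y := by simp only [mul_assoc]
      _ = _ := by rw [← hα₃.eq]; simp only [mul_assoc]
  have L := mul_left_cancel K
  calc E = Y⁻¹ * Y⁻¹ * β⁻¹ * α⁻¹ * α⁻¹ * (α * α * β * Y * Y * E) := by group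
    _ = _ := by rw [L]; simp only [mul_assoc]

end GroupIdentities

/-! ### Simplifying the braids on four strands -/

namespace Br

theorem mk_sigmaPow (i : ℕ) (e : ℤ) : mk (sigmaPow i e) = σ i ^ e := by
  rw [sigmaPow]
  have : ∀ (s : Bool) (n : ℕ), mk (List.replicate n (i, s)) = mk [(i, s)] ^ n := by
    intro s n
    induction n with
    | zero => rfl
    | succ n ih => rw [List.replicate_succ, mk_cons, ih, pow_succ']
  rw [this]
  rcases lt_or_ge 0 e with h | h
  · rw [decide_eq_true h, mk_true, ← zpow_natCast, Int.natAbs_of_nonneg h.le]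
  · rw [decide_eq_false (not_lt.2 h), mk_false, inv_pow, ← zpow_natCast, ← zpow_neg,
      Int.ofNat_natAbs_of_nonpos h, neg_neg]

theorem perm_sq_pow (i k : ℕ) : perm (σ i ^ (2 * k)) = 1 := by
  induction k with
  | zero => rfl
  | succ k ih =>
    rw [mul_add, pow_add, perm_mul, ih, mul_one (2 : ℕ), mul_one, pow_two, perm_mul, perm_σ]
    exact Equiv.swap_mul_self _ _

end Br

theorem mk_braidOne (a b : ℕ) : Br.mk (braidOne a b).letters =
    Br.σ 3 * (Br.σ 2)⁻¹ * (Br.σ 2)⁻¹ * Br.σ 3 ^ (2 * a + 2) * Br.σ 2 * (Br.σ 3)⁻¹ * (Br.σ 1)⁻¹ * Br.σ 2 *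
      Br.σ 1 ^ (2 * b + 2) := by
  simp only [braidOne, Br.mk_append, Br.mk_sigmaPow]
  norm_cast
  simp only [Int.reduceNegSucc]
  group

theorem mk_braidTwo (a b : ℕ) : Br.mk (braidTwo a b).letters =
    Br.σ 3 * (Br.σ 2)⁻¹ * (Br.σ 2)⁻¹ * Br.σ 3 ^ (2 * a + 2) * Br.σ 2 * (Br.σ 3)⁻¹ * Br.σ 1 ^ (2 * b + 2) *
      Br.σ 2 * (Br.σ 1)⁻¹ := by
  simp only [braidTwo, Br.mk_append, Br.mk_sigmaPow]
  norm_cast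
  simp only [Int.reduceNegSucc]
  group

theorem isKnotBraid_braidOne (a b : ℕ) : IsKnotBraid 4 (Br.mk (braidOne a b).letters) := by
  refine ⟨Br.mk_mem_below (braidOne a b).valid, ?_⟩
  have h1 : Br.perm ((Br.σ 2)⁻¹ * (Br.σ 2)⁻¹) = 1 := by
    rw [Br.perm_mul, Br.perm_inv, Br.perm_σ]; simp
  have h2 := Br.perm_sq_pow 3 (a + 1)
  have h3 := Br.perm_sq_pow 1 (b + 1)
  rw [mul_add, mul_one] at h2 h3
  rw [mk_braidOne, mul_assoc (Br.σ 3)]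
  simp only [Br.perm_mul, h1, h2, h3, Br.perm_inv, Br.perm_σ, Equiv.swap_inv]
  refine ⟨by norm_num, by decide, fun j h1 h2 => ?_⟩
  interval_cases j <;> decide

theorem isKnotBraid_braidTwo (a b : ℕ) : IsKnotBraid 4 (Br.mk (braidTwo a b).letters) := by
  refine ⟨Br.mk_mem_below (braidTwo a b).valid, ?_⟩
  have h1 : Br.perm ((Br.σ 2)⁻¹ * (Br.σ 2)⁻¹) = 1 := by
    rw [Br.perm_mul, Br.perm_inv, Br.perm_σ]; simp
  have h2 := Br.perm_sq_pow 3 (a + 1)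
  have h3 := Br.perm_sq_pow 1 (b + 1)
  rw [mul_add, mul_one] at h2 h3
  rw [mk_braidTwo, mul_assoc (Br.σ 3)]
  simp only [Br.perm_mul, h1, h2, h3, Br.perm_inv, Br.perm_σ, Equiv.swap_inv]
  refine ⟨by norm_num, by decide, fun j h1 h2 => ?_⟩
  interval_cases j <;> decide

/-- The first braid on four strands, brought by conjugations and two exchange moves to a form in which
the powers of the extreme letters can be traded for strands. -/
theorem SameKnot.shortBraidOne (a b : ℕ) : SameKnot 4 (Br.mk (braidOne a b).letters) 4
    (Br.σ 1 ^ (2 * b + 1) * (Br.σ 2)⁻¹ * (Br.σ 2)⁻¹ * Br.σ 3 ^ (2 * a + 3) * Br.σ 1 * Br.σ 2 *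
      (Br.σ 3)⁻¹ * (Br.σ 1)⁻¹ * Br.σ 2) := by
  have hk := isKnotBraid_braidOne a b
  rw [mk_braidOne] at hk ⊢
  have up := Br.below_mono (show 3 ≤ 4 by norm_num)
  have hx₃ : Br.σ 1 ∈ Br.below 3 := Br.σ_mem_below (by norm_num) (by norm_num)
  have hy₃ : Br.σ 2 ∈ Br.below 3 := Br.σ_mem_below (by norm_num) (by norm_num)
  have hx : Br.σ 1 ∈ Br.below 4 := up hx₃
  have hy : Br.σ 2 ∈ Br.below 4 := up hy₃
  have hz : Br.σ 3 ∈ Br.below 4 := Br.σ_mem_below (by norm_num) (by norm_num)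
  have exch := fun α β => SameKnot.exchange (n := 3) (α := α) (β := β) (by norm_num)
  have hxy : Br.σ 1 * Br.σ 2 * Br.σ 1 = Br.σ 2 * Br.σ 1 * Br.σ 2 := Br.σ_braid 1
  have hyz : Br.σ 2 * Br.σ 3 * Br.σ 2 = Br.σ 3 * Br.σ 2 * Br.σ 3 := Br.σ_braid 2
  have hxz : Br.σ 1 * Br.σ 3 = Br.σ 3 * Br.σ 1 := Br.σ_comm (by norm_num)
  generalize Br.σ 1 = x at *
  generalize Br.σ 2 = y at *
  generalize Br.σ 3 = z at *
  have f1 := flipped_exchange_word_eq hxy hyz hxz (2 * a + 2)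
  have f2 := braid_triple_inv_eq hxy hyz hxz
  have f3 := exchanged_word_conj_eq hxy hyz hxz (2 * b + 1) (2 * a + 3)
  have f4 := semiconjBy_flip_left hxy hyz hxz
  have f5 := semiconjBy_flip_middle hxy hxz
  have f6 := semiconjBy_flip_right hxy hyz hxz
  have hα : y * x⁻¹ * y ^ (2 * b + 1) ∈ Br.below 3 := mul_mem (mul_mem hy₃ (inv_mem hx₃)) (pow_mem hy₃ _)
  have hβ : y⁻¹ * y⁻¹ * x * y ^ (2 * a + 3) * x * y⁻¹ ∈ Br.below 3 :=
    mul_mem (mul_mem (mul_mem (mul_mem (mul_mem (inv_mem hy₃) (inv_mem hy₃)) hx₃) (pow_mem hy₃ _)) hx₃)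
      (inv_mem hy₃)
  have hγ : y ^ (2 * a + 3) * x * y⁻¹ ∈ Br.below 3 := mul_mem (mul_mem (pow_mem hy₃ _) hx₃) (inv_mem hy₃)
  have hδ : y * x⁻¹ * y ^ (2 * b + 1) * x * y⁻¹ * y⁻¹ ∈ Br.below 3 :=
    mul_mem (mul_mem (mul_mem hα hx₃) (inv_mem hy₃)) (inv_mem hy₃)
  -- a conjugate with a single letter `z` and a single letter `z⁻¹`, which are then exchanged
  have s1 := of_semiconjBy
    (g' := y⁻¹ * y⁻¹ * x * y ^ (2 * a + 3) * x * y⁻¹ * z * (y * x⁻¹ * y ^ (2 * b + 1)) * z⁻¹)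
    (x := (y ^ (2 * b + 1) * z⁻¹)⁻¹ * x * y * x ^ (2 * b + 2)) hk
    (mul_mem (mul_mem (mul_mem (inv_mem (mul_mem (pow_mem hy _) (inv_mem hz))) hx) hy) (pow_mem hx _)) (by
      have e : y * x ^ (2 * b + 2) = x⁻¹ * y ^ (2 * b + 1) * x * y * x := by
        have := ((semiconjBy_of_braid hxy).pow_right (2 * b + 1)).eq
        calc y * x ^ (2 * b + 2) = x⁻¹ * (x * y * x ^ (2 * b + 1)) * x := by rw [pow_succ x]; group
          _ = _ := by rw [this]; simp only [mul_assoc]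
      rw [SemiconjBy]
      calc _ = z * (y ^ (2 * b + 1))⁻¹ * x * (y * x ^ (2 * b + 2)) *
            (z * y⁻¹ * y⁻¹ * z ^ (2 * a + 2) * y * z⁻¹) * x⁻¹ * (y * x ^ (2 * b + 2)) := by
            rw [mul_inv_rev, inv_inv]; simp only [mul_assoc]
        _ = z * (x * y * x * z * y⁻¹ * y⁻¹ * z ^ (2 * a + 2) * y * z⁻¹ * x⁻¹ * x⁻¹) *
            y ^ (2 * b + 1) * x * y * x := by rw [e]; group
        _ = y⁻¹ * y⁻¹ * x * y ^ (2 * a + 3) * x * y⁻¹ * z * (y * x⁻¹ * y ^ (2 * b + 1)) * x * y * x := by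
            rw [f1]; simp only [mul_assoc, mul_inv_cancel_left]
        _ = y⁻¹ * y⁻¹ * x * y ^ (2 * a + 3) * x * y⁻¹ * z * (y * x⁻¹ * y ^ (2 * b + 1)) * z⁻¹ *
            (z * (y ^ (2 * b + 1))⁻¹ * x * (y * x ^ (2 * b + 2))) := by rw [e]; group
        _ = _ := by rw [mul_inv_rev, inv_inv]; simp only [mul_assoc])
  have s2 := exch _ _ hβ hα s1.right
  -- the half twist carries the roles of `z` over to `x`, and a second exchange becomes possible
  have s3 := of_semiconjBy (g' := y * x⁻¹ * y ^ (2 * b + 1) * x * y⁻¹ * y⁻¹ * z *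
    (y ^ (2 * a + 3) * x * y⁻¹) * z⁻¹) (x := y * x⁻¹ * y ^ (2 * b + 1) * x * (x * y * z * x * y * x)) s2.right
    (mul_mem (mul_mem (up hα) hx) (mul_mem (mul_mem (mul_mem (mul_mem (mul_mem hx hy) hz) hx) hy) hx)) (by
      have := (((((f5.inv_right.mul_right f5.inv_right).mul_right f4).mul_right
        (f5.pow_right (2 * a + 3))).mul_right f4).mul_right f5.inv_right).mul_right f6.inv_right |>.mul_right
        ((f5.mul_right f4.inv_right).mul_right (f5.pow_right (2 * b + 1))) |>.mul_right f6
      refine SemiconjBy.mul_left (y := y⁻¹ * y⁻¹ * z * y ^ (2 * a + 3) * z * y⁻¹ * x⁻¹ *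
        (y * z⁻¹ * y ^ (2 * b + 1)) * x) ?_ this
      rw [SemiconjBy]
      have e : y⁻¹ * y⁻¹ * z * y ^ (2 * a + 3) * z * y⁻¹ * x⁻¹ * (y * z⁻¹ * y ^ (2 * b + 1)) * x =
          y⁻¹ * y⁻¹ * z * y ^ (2 * a + 3) * (x * y⁻¹ * z⁻¹ * y * x⁻¹) * y ^ (2 * b + 1) * x := by
        rw [← f2]; simp only [mul_assoc]
      rw [e]; simp only [mul_assoc])
  have s4 := exch _ _ hδ hγ s3.right
  have s5 := conj s4.right (inv_mem (pow_mem hy 2))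
  rw [inv_inv, f3] at s5
  exact s1.trans (s2.trans (s3.trans (s4.trans s5)))

/-- In the first braid `2 b` of the letters `σ₁` are traded for strands at the bottom, and then `2 a + 1`
of the letters `σ₃` for strands at the top. -/
theorem SameKnot.inflatedBraidOne (a b : ℕ) : SameKnot 4 (Br.mk (braidOne a b).letters) (2 * a + 2 * b + 5)
    (Br.asc 1 (2 * b + 1) * (Br.σ (2 * b + 2))⁻¹ * Br.asc 1 (2 * b + 2) * (Br.asc 1 (2 * b + 1))⁻¹ *
      (Br.σ 1)⁻¹ * (Br.σ (2 * b + 3))⁻¹ * Br.asc 2 (2 * a + 2 * b + 4) *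
      Br.asc (2 * b + 3) (2 * a + 2 * b + 4)) := by
  have s1 := SameKnot.shortBraidOne a b
  have e1 : Br.σ 1 ^ (2 * b + 1) * (Br.σ 2)⁻¹ * (Br.σ 2)⁻¹ * Br.σ 3 ^ (2 * a + 3) * Br.σ 1 * Br.σ 2 *
      (Br.σ 3)⁻¹ * (Br.σ 1)⁻¹ * Br.σ 2 = Br.σ 1 ^ (-1 + ((2 * b : ℕ) : ℤ)) * Br.asc 1 (0 + 1) *
      Br.asc 1 (0 + 1) * ((Br.σ (0 + 2))⁻¹ * (Br.σ (0 + 2))⁻¹ * Br.σ (0 + 3) ^ (2 * a + 3) * Br.σ (0 + 1) *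
      Br.σ (0 + 2) * (Br.σ (0 + 3))⁻¹ * (Br.σ (0 + 1))⁻¹ * Br.σ (0 + 2)) := by
    simp only [zero_add, Br.asc_self]
    push_cast
    group
  rw [e1] at s1
  have s2 := inflate_bottom (n := 4) (j := 0) (e := 2 * b) (-1) (by norm_num)
    (w := fun d => (Br.σ (d + 2))⁻¹ * (Br.σ (d + 2))⁻¹ * Br.σ (d + 3) ^ (2 * a + 3) * Br.σ (d + 1) *
      Br.σ (d + 2) * (Br.σ (d + 3))⁻¹ * (Br.σ (d + 1))⁻¹ * Br.σ (d + 2)) (fun d => by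
      have h1 : SemiconjBy (Br.asc 1 (4 + d)) (Br.σ (d + 1)) (Br.σ (d + 2)) :=
        Br.semiconjBy_asc (by omega) (by omega)
      have h2 : SemiconjBy (Br.asc 1 (4 + d)) (Br.σ (d + 2)) (Br.σ (d + 3)) :=
        Br.semiconjBy_asc (by omega) (by omega)
      have h3 : SemiconjBy (Br.asc 1 (4 + d)) (Br.σ (d + 3)) (Br.σ (d + 4)) :=
        Br.semiconjBy_asc (by omega) (by omega)
      exact ((((((h2.inv_right.mul_right h2.inv_right).mul_right (h3.pow_right _)).mul_right h1).mul_right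
        h2).mul_right h3.inv_right).mul_right h1.inv_right).mul_right h2) s1.right
  have hU : Br.asc 1 (2 * b + 1) = Br.asc 1 (2 * b) * Br.σ (2 * b + 1) := Br.asc_succ (by omega)
  have hUU : Br.asc 1 (2 * b + 1) * Br.asc 1 (2 * b + 1) =
    Br.σ 1 * Br.asc 1 (2 * b + 1) * Br.asc 1 (2 * b) := Br.asc_mul_asc (by omega)
  have hY : Br.asc 1 (2 * b + 2) = Br.asc 1 (2 * b + 1) * Br.σ (2 * b + 2) := Br.asc_succ (by omega)
  have hW : Br.asc 2 (2 * b + 1) = (Br.σ 1)⁻¹ * Br.asc 1 (2 * b + 1) := by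
    rw [Br.asc_eq_mul (by omega : 1 ≤ 2 * b + 1), inv_mul_cancel_left]
  have hW₃ : Br.asc 2 (2 * b + 3) = Br.asc 2 (2 * b + 1) * Br.σ (2 * b + 2) * Br.σ (2 * b + 3) := by
    rw [Br.asc_succ (by omega), Br.asc_succ (by omega)]
  have f := gridOne_word_conj_eq (s := Br.σ 1) (u := Br.asc 1 (2 * b)) (x := Br.σ (2 * b + 1))
    (b := Br.σ (2 * b + 2)) (c := Br.σ (2 * b + 3)) (Br.commute_asc (by omega)) (Br.commute_asc (by omega))
    (Br.commute_σ (by omega)) (Br.commute_σ (by omega)) (Br.σ_braid _) (by rw [← hU]; exact hUU) (2 * a + 3)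
  rw [← hU, ← hY] at f
  have m1 : Br.asc 1 (2 * b + 1) ∈ Br.below (4 + 2 * b) := Br.asc_mem_below le_rfl (by omega)
  have m2 : Br.asc 1 (2 * b) ∈ Br.below (4 + 2 * b) := Br.asc_mem_below le_rfl (by omega)
  have m3 : Br.σ (2 * b + 1) ∈ Br.below (4 + 2 * b) := Br.σ_mem_below (by omega) (by omega)
  have m4 : Br.σ (2 * b + 2) ∈ Br.below (4 + 2 * b) := Br.σ_mem_below (by omega) (by omega)
  have m5 : Br.σ (2 * b + 3) ∈ Br.below (4 + 2 * b) := Br.σ_mem_below (by omega) (by omega)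
  have m6 : Br.σ 1 ∈ Br.below (4 + 2 * b) := Br.σ_mem_below (by omega) (by omega)
  have m7 : Br.asc 1 (2 * b + 2) ∈ Br.below (4 + 2 * b) := Br.asc_mem_below le_rfl (by omega)
  have e2 : Br.σ 1 ^ (-1 : ℤ) * Br.asc 1 (0 + 1 + 2 * b) * Br.asc 1 (0 + 1 + 2 * b) =
      (Br.σ 1)⁻¹ * Br.asc 1 (2 * b + 1) * Br.asc 1 (2 * b + 1) := by
    rw [zpow_neg_one, show 0 + 1 + 2 * b = 2 * b + 1 by ring]
  simp only [e2] at s2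
  have s3 := conj s2.right (mul_mem (mul_mem m1 m2) (mul_mem (mul_mem (mul_mem (mul_mem m3 m4)
    (inv_mem m5)) (inv_mem m3)) m4))
  rw [f] at s3
  have e3 : Br.asc 1 (2 * b + 1) * (Br.σ (2 * b + 2))⁻¹ * Br.asc 1 (2 * b + 2) * (Br.asc 1 (2 * b + 1))⁻¹ *
      (Br.σ 1)⁻¹ * (Br.σ (2 * b + 3))⁻¹ * ((Br.σ 1)⁻¹ * Br.asc 1 (2 * b + 1) * Br.σ (2 * b + 2)) *
      Br.σ (2 * b + 3) ^ (2 * a + 3) =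
      Br.asc 1 (2 * b + 1) * (Br.σ (2 * b + 2))⁻¹ * Br.asc 1 (2 * b + 2) * (Br.asc 1 (2 * b + 1))⁻¹ *
      (Br.σ 1)⁻¹ * (Br.σ (2 * b + 3))⁻¹ * Br.asc 2 (2 * b + 3) * Br.asc (2 * b + 3) (2 * b + 3) *
      Br.σ (2 * b + 3) ^ (2 * a + 1) := by
    rw [hW₃, hW, Br.asc_self, show 2 * a + 3 = 2 * a + 1 + 1 + 1 by ring, pow_succ', pow_succ']
    simp only [mul_assoc]
  rw [e3] at s3
  have s4 := inflate_top (n := 2 * b + 2) (p := 2) (q := 2 * b + 3) (by omega) (by omega)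
    (w := Br.asc 1 (2 * b + 1) * (Br.σ (2 * b + 2))⁻¹ * Br.asc 1 (2 * b + 2) * (Br.asc 1 (2 * b + 1))⁻¹ *
      (Br.σ 1)⁻¹ * (Br.σ (2 * b + 3))⁻¹) (by
      rw [show 2 * b + 2 + 2 = 4 + 2 * b by ring]
      exact mul_mem (mul_mem (mul_mem (mul_mem (mul_mem m1 (inv_mem m4)) m7) (inv_mem m1)) (inv_mem m6))
        (inv_mem m5)) (2 * a + 1) (by
      rw [show 2 * b + 2 + 2 = 4 + 2 * b by ring]
      exact s3.right)
  rw [show 2 * b + 2 + 2 = 4 + 2 * b by ring, show 2 * b + 2 + 1 = 2 * b + 3 by ring,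
    show 4 + 2 * b + (2 * a + 1) = 2 * a + 2 * b + 5 by ring,
    show 2 * b + 3 + (2 * a + 1) = 2 * a + 2 * b + 4 by ring] at s4
  exact s1.trans (s2.trans (s3.trans s4))

/-- In the second braid `2 b` of the letters `σ₁` are traded for strands at the bottom, and then
`2 a + 1` of the letters `σ₃` for strands at the top. -/
theorem SameKnot.inflatedBraidTwo (a b : ℕ) : SameKnot 4 (Br.mk (braidTwo a b).letters) (2 * a + 2 * b + 5)
    ((Br.asc 1 (2 * b + 2))⁻¹ * (Br.asc 1 (2 * b + 2))⁻¹ * (Br.σ 2)⁻¹ * (Br.σ 1)⁻¹ * (Br.σ 1)⁻¹ *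
      Br.asc 3 (2 * b + 3) * Br.asc 2 (2 * b + 3) * Br.asc 1 (2 * a + 2 * b + 4) *
      Br.asc 1 (2 * a + 2 * b + 4)) := by
  have hk := isKnotBraid_braidTwo a b
  rw [mk_braidTwo] at hk ⊢
  have s0 := of_semiconjBy (x := Br.σ 1 ^ (2 * b + 2) * Br.σ 2 * (Br.σ 1)⁻¹)
    (g' := Br.σ 1 ^ (0 + ((2 * b : ℕ) : ℤ)) * Br.asc 1 (0 + 1) *
      Br.asc 1 (0 + 1) * (Br.σ (0 + 2) * (Br.σ (0 + 1))⁻¹ * Br.σ (0 + 3) * (Br.σ (0 + 2))⁻¹ *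
        (Br.σ (0 + 2))⁻¹ * Br.σ (0 + 3) ^ (2 * a + 2) * Br.σ (0 + 2) * (Br.σ (0 + 3))⁻¹)) hk
    (mul_mem (mul_mem (pow_mem (Br.σ_mem_below (by norm_num) (by norm_num)) _)
      (Br.σ_mem_below (by norm_num) (by norm_num))) (inv_mem (Br.σ_mem_below (by norm_num) (by norm_num))))
    (by
      simp only [zero_add, Br.asc_self, SemiconjBy]
      push_cast
      group)
  have s2 := inflate_bottom (n := 4) (j := 0) (e := 2 * b) 0 (by norm_num)
    (w := fun d => Br.σ (d + 2) * (Br.σ (d + 1))⁻¹ * Br.σ (d + 3) * (Br.σ (d + 2))⁻¹ *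
        (Br.σ (d + 2))⁻¹ * Br.σ (d + 3) ^ (2 * a + 2) * Br.σ (d + 2) * (Br.σ (d + 3))⁻¹) (fun d => by
      have h1 : SemiconjBy (Br.asc 1 (4 + d)) (Br.σ (d + 1)) (Br.σ (d + 2)) :=
        Br.semiconjBy_asc (by omega) (by omega)
      have h2 : SemiconjBy (Br.asc 1 (4 + d)) (Br.σ (d + 2)) (Br.σ (d + 3)) :=
        Br.semiconjBy_asc (by omega) (by omega)
      have h3 : SemiconjBy (Br.asc 1 (4 + d)) (Br.σ (d + 3)) (Br.σ (d + 4)) :=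
        Br.semiconjBy_asc (by omega) (by omega)
      exact ((((((h2.mul_right h1.inv_right).mul_right h3).mul_right h2.inv_right).mul_right
        h2.inv_right).mul_right (h3.pow_right _)).mul_right h2).mul_right h3.inv_right) s0.right
  have hU : Br.asc 1 (2 * b + 1) = Br.asc 1 (2 * b) * Br.σ (2 * b + 1) := Br.asc_succ (by omega)
  have hUU : Br.asc 1 (2 * b + 1) * Br.asc 1 (2 * b + 1) =
    Br.σ 1 * Br.asc 1 (2 * b + 1) * Br.asc 1 (2 * b) := Br.asc_mul_asc (by omega)
  have hY : Br.asc 1 (2 * b + 2) = Br.asc 1 (2 * b + 1) * Br.σ (2 * b + 2) := Br.asc_succ (by omega)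
  have hYY : Br.asc 1 (2 * b + 2) * Br.asc 1 (2 * b + 2) =
    Br.σ 1 * Br.asc 1 (2 * b + 2) * Br.asc 1 (2 * b + 1) := Br.asc_mul_asc (by omega)
  have hZ : Br.asc 1 (2 * b + 3) = Br.asc 1 (2 * b + 2) * Br.σ (2 * b + 3) := Br.asc_succ (by omega)
  have hZZ : Br.asc 1 (2 * b + 3) * Br.asc 1 (2 * b + 3) =
    Br.σ 1 * Br.asc 1 (2 * b + 3) * Br.asc 1 (2 * b + 2) := Br.asc_mul_asc (by omega)
  have f := gridTwo_word_eq (α := Br.σ 1) (β := Br.σ 2) (u := Br.asc 1 (2 * b)) (x := Br.σ (2 * b + 1))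
    (b := Br.σ (2 * b + 2)) (c := Br.σ (2 * b + 3)) (U₂ := Br.asc 2 (2 * b + 3)) (U₃ := Br.asc 3 (2 * b + 3))
    (Br.commute_asc (by omega)) (Br.commute_asc (by omega))
    (Br.commute_σ (by omega)) (Br.σ_braid _) (Br.σ_braid _) (by rw [← hU]; exact hUU)
    (by rw [← hU, ← hY]; exact hYY) (by rw [← hU, ← hY, ← hZ]; exact hZZ)
    (by rw [← hU, ← hY]; exact Br.semiconjBy_asc le_rfl (by omega))
    (by rw [← hU, ← hY, ← hZ]; exact Br.semiconjBy_asc le_rfl (by omega))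
    (by rw [← hU, ← hY, ← hZ]; exact Br.asc_eq_mul (by omega)) (Br.asc_eq_mul (by omega))
    (Br.commute_asc (Or.inr le_rfl)).symm (Br.σ_braid 1)
  rw [← hU, ← hY, ← hZ] at f
  have m1 : Br.asc 1 (2 * b + 2) ∈ Br.below (4 + 2 * b) := Br.asc_mem_below le_rfl (by omega)
  have m2 : Br.σ (2 * b + 2) ∈ Br.below (4 + 2 * b) := Br.σ_mem_below (by omega) (by omega)
  have m3 : Br.σ (2 * b + 3) ∈ Br.below (4 + 2 * b) := Br.σ_mem_below (by omega) (by omega)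
  have m4 : Br.σ 1 ∈ Br.below (4 + 2 * b) := Br.σ_mem_below (by omega) (by omega)
  have m5 : Br.σ 2 ∈ Br.below (4 + 2 * b) := Br.σ_mem_below (by omega) (by omega)
  have m6 : Br.asc 2 (2 * b + 3) ∈ Br.below (4 + 2 * b) := Br.asc_mem_below (by omega) (by omega)
  have m7 : Br.asc 3 (2 * b + 3) ∈ Br.below (4 + 2 * b) := Br.asc_mem_below (by omega) (by omega)
  have e2 : Br.σ 1 ^ (0 : ℤ) * Br.asc 1 (0 + 1 + 2 * b) * Br.asc 1 (0 + 1 + 2 * b) =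
      Br.asc 1 (2 * b + 1) * Br.asc 1 (2 * b + 1) := by
    rw [zpow_zero, one_mul, show 0 + 1 + 2 * b = 2 * b + 1 by ring]
  simp only [e2] at s2
  have s3 := of_semiconjBy (x := Br.σ (2 * b + 3) * Br.σ (2 * b + 2) * (Br.σ (2 * b + 3))⁻¹)
    (g' := (Br.asc 1 (2 * b + 2))⁻¹ * (Br.asc 1 (2 * b + 2))⁻¹ * (Br.σ 2)⁻¹ * (Br.σ 1)⁻¹ * (Br.σ 1)⁻¹ *
      Br.asc 3 (2 * b + 3) * Br.asc 2 (2 * b + 3) * Br.asc 1 (2 * b + 3) * Br.asc 1 (2 * b + 3) *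
      Br.σ (2 * b + 3) ^ (2 * a + 1)) s2.right (mul_mem (mul_mem m3 m2) (inv_mem m3)) (by
      have e3 : Br.asc 1 (2 * b + 3) * Br.σ (2 * b + 3) ^ (2 * a + 1) =
          Br.asc 1 (2 * b + 2) * Br.σ (2 * b + 3) ^ (2 * a + 2) := by
        rw [hZ, pow_succ' _ (2 * a + 1), mul_assoc]
      have e4 : (Br.σ (2 * b + 3))⁻¹ * (Br.σ (2 * b + 3) ^ (2 * a + 2) * (Br.σ (2 * b + 3) *
          (Br.σ (2 * b + 2) * (Br.σ (2 * b + 3))⁻¹))) =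
          Br.σ (2 * b + 3) ^ (2 * a + 2) * (Br.σ (2 * b + 2) * (Br.σ (2 * b + 3))⁻¹) := by group
      rw [mul_assoc _ (Br.asc 1 (2 * b + 3)), e3, ← mul_assoc _ _ (Br.σ (2 * b + 3) ^ (2 * a + 2)), ← f,
        SemiconjBy]
      simp only [mul_assoc]
      rw [e4])
  have s4 := inflate_top (n := 2 * b + 2) (p := 1) (q := 1) (by omega) (by omega)
    (w := (Br.asc 1 (2 * b + 2))⁻¹ * (Br.asc 1 (2 * b + 2))⁻¹ * (Br.σ 2)⁻¹ * (Br.σ 1)⁻¹ * (Br.σ 1)⁻¹ *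
      Br.asc 3 (2 * b + 3) * Br.asc 2 (2 * b + 3)) (by
      rw [show 2 * b + 2 + 2 = 4 + 2 * b by ring]
      exact mul_mem (mul_mem (mul_mem (mul_mem (mul_mem (mul_mem (inv_mem m1) (inv_mem m1)) (inv_mem m5))
        (inv_mem m4)) (inv_mem m4)) m7) m6) (2 * a + 1) (by
      rw [show 2 * b + 2 + 2 = 4 + 2 * b by ring]
      exact s3.right)
  rw [show 2 * b + 2 + 2 = 4 + 2 * b by ring, show 2 * b + 2 + 1 = 2 * b + 3 by ring,
    show 4 + 2 * b + (2 * a + 1) = 2 * a + 2 * b + 5 by ring,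
    show 2 * b + 3 + (2 * a + 1) = 2 * a + 2 * b + 4 by ring] at s4
  exact s0.trans (s2.trans (s3.trans s4))

/-! ### Reading off the braid of a grid diagram -/

/-- The numbers of the elements of `A` in `[p, q)`, in order, are consecutive. -/
theorem map_count_filter_range (A : ℕ → Prop) [DecidablePred A] (p q n : ℕ) :
    ((List.range n).filter (fun e => decide (p ≤ e ∧ e < q ∧ A e))).map (Nat.count A) =
      List.range' (Nat.count A p) (Nat.count A (min n q) - Nat.count A p) := by
  induction n with
  | zero => simp
  | succ n ih =>
    rw [List.range_succ, List.filter_append, List.map_append, ih]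
    rcases lt_or_ge n q with h1 | h1
    · rw [min_eq_left h1.le, min_eq_left (Nat.succ_le_of_lt h1), Nat.count_succ]
      rcases lt_or_ge n p with h2 | h2
      · have : Nat.count A n + (if A n then 1 else 0) ≤ Nat.count A p := by
          rw [← Nat.count_succ]; exact Nat.count_monotone A h2
        rw [Nat.sub_eq_zero_of_le this, Nat.sub_eq_zero_of_le (by omega)]
        simp [h2.not_ge]
      · have h3 : Nat.count A p ≤ Nat.count A n := Nat.count_monotone A h2
        by_cases h4 : A n
        · rw [if_pos h4, Nat.sub_add_comm h3, List.range'_1_concat, Nat.add_sub_cancel' h3]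
          simp [h1, h2, h4]
        · simp [h4]
    · rw [min_eq_right h1, min_eq_right (h1.trans (Nat.le_succ n))]
      simp [h1.not_gt]

namespace Br

theorem mk_map_true (l : List ℕ) : mk (l.map fun i => (i, true)) = (l.map σ).prod := by
  induction l with
  | nil => rfl
  | cons i l ih => rw [List.map_cons, mk_cons, ih, mk_true, List.map_cons, List.prod_cons]

theorem mk_map_false_reverse (l : List ℕ) :
    mk (l.reverse.map fun i => (i, false)) = (l.map σ).prod⁻¹ := by
  induction l with
  | nil => exact inv_one.symm
  | cons i l ih =>
    rw [List.reverse_cons, List.map_append, mk_append, ih, List.map_singleton, mk_false, List.map_cons,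
      List.prod_cons, mul_inv_rev]

theorem mk_flatMap {ι : Type*} (l : List ι) (f : ι → List (ℕ × Bool)) :
    mk (l.flatMap f) = (l.map fun j => mk (f j)).prod := by
  induction l with
  | nil => rfl
  | cons i l ih => rw [List.flatMap_cons, mk_append, ih, List.map_cons, List.prod_cons]

end Br

namespace GridDiagram

variable {n : ℕ} (G : GridDiagram n)

/-- `Active` for columns given as natural numbers. -/
def ActiveAt (j c : ℕ) : Prop := ∃ h : c < n, G.Active j ⟨c, h⟩

instance (j : ℕ) : DecidablePred (G.ActiveAt j) := fun c => by
  unfold ActiveAt; infer_instance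

theorem card_filter_activeSet (j m : ℕ) :
    ((G.activeSet j).filter (fun e : Fin n => (e : ℕ) < m)).card = Nat.count (G.ActiveAt j) m := by
  rw [Nat.count_eq_card_filter_range]
  refine Finset.card_bij (fun (e : Fin n) _ => (e : ℕ)) ?_ (fun _ _ _ _ h => Fin.ext h) ?_
  · intro e he
    rw [Finset.mem_filter, mem_activeSet] at he
    rw [Finset.mem_filter, Finset.mem_range]
    exact ⟨he.2, e.2, he.1⟩
  · intro c hc
    rw [Finset.mem_filter, Finset.mem_range] at hc
    obtain ⟨h1, h2, h3⟩ := hc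
    exact ⟨⟨c, h2⟩, by rw [Finset.mem_filter, mem_activeSet]; exact ⟨h3, h1⟩, rfl⟩

theorem rank_eq_count (j : ℕ) (e : Fin n) : G.rank j e = Nat.count (G.ActiveAt j) e :=
  G.card_filter_activeSet j e

/-- A function with the increments of the counting function of the active columns is this function. -/
theorem count_eq {j : ℕ} {F : ℕ → ℕ} (h0 : F 0 = 0)
    (hs : ∀ c : Fin n, (G.Active j c ∧ F (c + 1) = F c + 1) ∨ (¬ G.Active j c ∧ F (c + 1) = F c)) {m : ℕ}
    (hm : m ≤ n) : Nat.count (G.ActiveAt j) m = F m := by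
  induction m with
  | zero => simpa using h0.symm
  | succ m ih =>
    rw [Nat.count_succ, ih (by omega)]
    rcases hs ⟨m, hm⟩ with ⟨h1, h2⟩ | ⟨h1, h2⟩
    · rw [if_pos ⟨hm, h1⟩]; exact h2.symm
    · rw [if_neg (fun ⟨_, h⟩ => h1 h)]; exact h2.symm

theorem map_rank_filter (j : ℕ) (p q : Fin n) :
    ((List.finRange n).filter (fun e => decide (p < e ∧ e < q ∧ G.Active j e))).map (G.rank j) =
      List.range' (Nat.count (G.ActiveAt j) (p + 1)) (G.rank j q - Nat.count (G.ActiveAt j) (p + 1)) := by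
  have h := map_count_filter_range (G.ActiveAt j) (p + 1) q n
  rw [min_eq_right q.2.le, ← rank_eq_count, ← List.map_coe_finRange_eq_range, List.filter_map, List.map_map] at h
  rw [← h]
  have e1 : G.rank j = Nat.count (G.ActiveAt j) ∘ Fin.val := funext (G.rank_eq_count j)
  rw [e1]
  congr 1
  refine List.filter_congr fun e _ => ?_
  rw [Function.comp_apply, decide_eq_decide, Fin.lt_def, Fin.lt_def, Nat.succ_le_iff]
  exact and_congr_right fun _ => and_congr_right fun _ => ⟨fun h => ⟨e.2, h⟩, fun ⟨_, h⟩ => h⟩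

variable {G}

/-- A horizontal segment from left to right passes over one strand after the other. Its own strand enters
in the column of the `O`, which is therefore active below the row. -/
theorem mk_rowLetters_of_lt {j p q : Fin n} (hO : G.O p = j) (hX : G.X q = j) (h : p < q) :
    Br.mk (G.rowLetters j) = Br.asc (G.rank j p + 1) (G.rank j q - 1) := by
  obtain rfl : G.colO j = p := by rw [← hO, colO_O]
  obtain rfl : G.colX j = q := by rw [← hX, colX_X]
  have hr := G.rank_lt_rank (G.active_colO j) h
  have hc : Nat.count (G.ActiveAt j) (G.colO j + 1) = G.rank j (G.colO j) + 1 := by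
    rw [Nat.count_succ, if_pos ⟨(G.colO j).2, G.active_colO j⟩, rank_eq_count]
  have hm := G.map_rank_filter j (G.colO j) (G.colX j)
  rw [hc] at hm
  have e : G.rowLetters j = (List.range' (G.rank j (G.colO j) + 1)
      (G.rank j (G.colX j) - (G.rank j (G.colO j) + 1))).map fun i => (i, true) := by
    rw [← hm, List.map_map, rowLetters, if_pos h]
    rfl
  rw [e, Br.mk_map_true, Br.asc]
  congr 3
  omega

/-- For a horizontal segment from right to left the strand enters in the column of the `O` and leaves in
the column of the `X`, which is not active below the row, so that the ranks are shifted by one. -/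
theorem mk_rowLetters_of_gt {j p q : Fin n} (hO : G.O p = j) (hX : G.X q = j) (h : q < p) :
    Br.mk (G.rowLetters j) = (Br.asc (G.rank j q + 1) (G.rank j p))⁻¹ := by
  obtain rfl : G.colO j = p := by rw [← hO, colO_O]
  obtain rfl : G.colX j = q := by rw [← hX, colX_X]
  have hc : Nat.count (G.ActiveAt j) (G.colX j + 1) = G.rank j (G.colX j) := by
    rw [Nat.count_succ, if_neg (fun ⟨_, h⟩ => G.not_active_colX j h), rank_eq_count, add_zero]
  have hm := G.map_rank_filter j (G.colX j) (G.colO j)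
  rw [hc] at hm
  have e : G.rowLetters j = (List.range' (G.rank j (G.colX j) + 1)
      (G.rank j (G.colO j) - G.rank j (G.colX j))).reverse.map fun i => (i, false) := by
    rw [List.range'_succ_left, ← hm, List.map_map, ← List.map_reverse, List.map_map, ← List.filter_reverse,
      rowLetters, if_neg h.not_gt]
    rfl
  rw [e, Br.mk_map_false_reverse, Br.asc]
  congr 4
  omega

/-- Without a strand between the `X` and the `O` the row contains no crossing. -/
theorem mk_rowLetters_eq_one {j p q : Fin n} (hO : G.O p = j) (hX : G.X q = j)
    (h : ∀ c : Fin n, (p < c ∧ c < q) ∨ (q < c ∧ c < p) → ¬ G.Active j c) :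
    Br.mk (G.rowLetters j) = 1 := by
  obtain rfl : G.colO j = p := by rw [← hO, colO_O]
  obtain rfl : G.colX j = q := by rw [← hX, colX_X]
  have : G.rowLetters j = [] := by
    unfold rowLetters
    split_ifs
    · rw [List.map_eq_nil_iff, List.filter_eq_nil_iff]
      intro c _ hc
      rw [decide_eq_true_eq] at hc
      exact h c (Or.inl ⟨hc.1, hc.2.1⟩) hc.2.2
    · rw [List.map_eq_nil_iff, List.filter_eq_nil_iff]
      intro c _ hc
      rw [decide_eq_true_eq] at hc
      exact h c (Or.inr ⟨hc.1, hc.2.1⟩) hc.2.2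
  rw [this, Br.mk_nil]

/-- The product of the braids of the rows below height `m`. -/
noncomputable def rowsBelow (G : GridDiagram n) (m : ℕ) : Br :=
  ((List.range m).map fun j => if h : j < n then Br.mk (G.rowLetters ⟨j, h⟩) else 1).prod

theorem rowsBelow_zero : G.rowsBelow 0 = 1 := rfl

theorem rowsBelow_succ {m : ℕ} (hm : m < n) :
    G.rowsBelow (m + 1) = G.rowsBelow m * Br.mk (G.rowLetters ⟨m, hm⟩) := by
  rw [rowsBelow, List.range_succ, List.map_append, List.prod_append, List.map_singleton, List.prod_singleton,
    dif_pos hm, rowsBelow]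

theorem rowsBelow_eq_of_trivial {m m' : ℕ} (hm : m ≤ m') (hm' : m' ≤ n)
    (h : ∀ j : Fin n, m ≤ j → j < m' → Br.mk (G.rowLetters j) = 1) : G.rowsBelow m' = G.rowsBelow m := by
  induction m', hm using Nat.le_induction with
  | base => rfl
  | succ k hk ih =>
    rw [rowsBelow_succ (by omega), h ⟨k, by omega⟩ hk (Nat.lt_succ_self k), mul_one]
    exact ih (by omega) fun j h1 h2 => h j h1 (h2.trans (Nat.lt_succ_self k))

theorem mk_toBraid : Br.mk G.toBraid.letters = G.rowsBelow n := by
  rw [toBraid, Br.mk_flatMap, rowsBelow, ← List.map_coe_finRange_eq_range, List.map_map]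
  congr 1
  refine List.map_congr_left fun j _ => ?_
  rw [Function.comp_apply, dif_pos j.2]

theorem strands_toBraid : G.toBraid.strands = Nat.count (G.ActiveAt 0) n := by
  rw [← card_filter_activeSet, Finset.filter_true_of_mem fun (c : Fin n) _ => c.2, toBraid]

end GridDiagram

/-! ### The braids of the two families of grid diagrams -/

namespace GridDiagram

variable {n : ℕ} {G : GridDiagram n}

/-- `F c` is the number of the columns before `c` with a strand at height `j`. In the grid diagrams below
these columns form a few intervals, and `min c q - p` is the number of the columns before `c` in the
interval `[p, q)`. -/
def CountsActive (G : GridDiagram n) (j : ℕ) (F : ℕ → ℕ) : Prop :=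
  F 0 = 0 ∧ ∀ c : Fin n, (G.Active j c ∧ F (c + 1) = F c + 1) ∨ (¬ G.Active j c ∧ F (c + 1) = F c)

theorem CountsActive.rank_eq {j : ℕ} {F : ℕ → ℕ} (h : G.CountsActive j F) (c : Fin n) :
    G.rank j c = F c := by
  rw [rank_eq_count, G.count_eq h.1 h.2 c.2.le]

theorem CountsActive.strands_eq {F : ℕ → ℕ} (h : G.CountsActive 0 F) : G.toBraid.strands = F n := by
  rw [strands_toBraid, G.count_eq h.1 h.2 le_rfl]

theorem CountsActive.mk_rowLetters_of_lt {j p q : ℕ} {F : ℕ → ℕ} (h : G.CountsActive j F) (hj : j < n)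
    (hp : p < n) (hq : q < n) (hO : (G.O ⟨p, hp⟩ : ℕ) = j) (hX : (G.X ⟨q, hq⟩ : ℕ) = j) (hpq : p < q)
    {r s : ℕ} (hr : F p + 1 = r) (hs : F q = s + 1) : Br.mk (G.rowLetters ⟨j, hj⟩) = Br.asc r s := by
  rw [GridDiagram.mk_rowLetters_of_lt (p := ⟨p, hp⟩) (q := ⟨q, hq⟩) (Fin.ext hO) (Fin.ext hX) hpq, h.rank_eq,
    h.rank_eq, ← hr, hs, Nat.add_sub_cancel]

theorem CountsActive.mk_rowLetters_of_gt {j p q : ℕ} {F : ℕ → ℕ} (h : G.CountsActive j F) (hj : j < n)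
    (hp : p < n) (hq : q < n) (hO : (G.O ⟨p, hp⟩ : ℕ) = j) (hX : (G.X ⟨q, hq⟩ : ℕ) = j) (hpq : q < p)
    {r s : ℕ} (hr : F q + 1 = r) (hs : F p = s) : Br.mk (G.rowLetters ⟨j, hj⟩) = (Br.asc r s)⁻¹ := by
  rw [GridDiagram.mk_rowLetters_of_gt (p := ⟨p, hp⟩) (q := ⟨q, hq⟩) (Fin.ext hO) (Fin.ext hX) hpq, h.rank_eq,
    h.rank_eq, ← hr, ← hs]

end GridDiagram

open GridDiagram

theorem gridOne_cases (a b c : ℕ) :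
    (c = 0 ∧ oneX b c = 4 ∧ oneO a b c = 0) ∨
    (c = 1 ∧ oneX b c = 3 ∧ oneO a b c = 2 * a + 2 * b + 7) ∨
    (c = 2 ∧ oneX b c = c + 3 ∧ oneO a b c = 2) ∨
    ((3 ≤ c ∧ c ≤ 2 * b + 2) ∧ oneX b c = c + 3 ∧ oneO a b c = c + 1) ∨
    (c = 2 * b + 3 ∧ oneX b c = 1 ∧ oneO a b c = c + 1) ∨
    (c = 2 * b + 4 ∧ oneX b c = 0 ∧ oneO a b c = 3) ∨
    (c = 2 * b + 5 ∧ oneX b c = 2 ∧ oneO a b c = 2 * a + 2 * b + 8) ∨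
    (c = 2 * b + 6 ∧ oneX b c = c ∧ oneO a b c = 1) ∨
    (c = 2 * b + 7 ∧ oneX b c = c ∧ oneO a b c = 2 * b + 5) ∨
    (2 * b + 8 ≤ c ∧ oneX b c = c ∧ oneO a b c = c - 2) := by
  unfold oneX oneO
  (repeat' split) <;> first
    | (exfalso; omega)
    | repeat first | exact Or.inl ⟨by omega, rfl, rfl⟩ | exact ⟨by omega, rfl, rfl⟩ | apply Or.inr

theorem gridOne_active_iff {a b j : ℕ} {c : Fin (2 * a + 2 * b + 9)} : (gridOne a b).Active j c ↔
    (oneX b c < oneO a b c ∧ oneX b c < j ∧ j ≤ oneO a b c) ∨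
    (oneO a b c < oneX b c ∧ (j ≤ oneO a b c ∨ oneX b c < j)) := Iff.rfl

theorem gridTwo_cases (a b c : ℕ) :
    (c = 0 ∧ twoX c = 3 - c ∧ twoO a b c = 2 * a + 2 * b + 8) ∨
    (c = 1 ∧ twoX c = 3 - c ∧ twoO a b c = 2 * b + 6) ∨
    (c = 2 ∧ twoX c = 3 - c ∧ twoO a b c = 3) ∨
    (c = 3 ∧ twoX c = 3 - c ∧ twoO a b c = 2 * b + 5) ∨
    (c = 4 ∧ twoX c = c ∧ twoO a b c = 2 * a + 2 * b + 9) ∨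
    (c = 5 ∧ twoX c = c ∧ twoO a b c = 2) ∨
    ((6 ≤ c ∧ c ≤ 2 * b + 5) ∧ twoX c = c ∧ twoO a b c = c - 2) ∨
    (c = 2 * b + 6 ∧ twoX c = c ∧ twoO a b c = 1) ∨
    (c = 2 * b + 7 ∧ twoX c = c ∧ twoO a b c = 0) ∨
    (c = 2 * b + 8 ∧ twoX c = c ∧ twoO a b c = 2 * b + 4) ∨
    (2 * b + 9 ≤ c ∧ twoX c = c ∧ twoO a b c = c - 2) := by
  unfold twoX twoO
  (repeat' split) <;> first
    | (exfalso; omega)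
    | repeat first | exact Or.inl ⟨by omega, rfl, rfl⟩ | exact ⟨by omega, rfl, rfl⟩ | apply Or.inr

theorem gridTwo_active_iff {a b j : ℕ} {c : Fin (2 * a + 2 * b + 10)} : (gridTwo a b).Active j c ↔
    (twoX c < twoO a b c ∧ twoX c < j ∧ j ≤ twoO a b c) ∨
    (twoO a b c < twoX c ∧ (j ≤ twoO a b c ∨ twoX c < j)) := Iff.rfl

theorem countsActive_gridOne {a b j : ℕ} {F : ℕ → ℕ} (h0 : F 0 = 0) (h : ∀ c, c < 2 * a + 2 * b + 9 →
    (((oneX b c < oneO a b c ∧ oneX b c < j ∧ j ≤ oneO a b c) ∨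
    (oneO a b c < oneX b c ∧ (j ≤ oneO a b c ∨ oneX b c < j))) ∧ F (c + 1) = F c + 1) ∨
    (¬ ((oneX b c < oneO a b c ∧ oneX b c < j ∧ j ≤ oneO a b c) ∨
    (oneO a b c < oneX b c ∧ (j ≤ oneO a b c ∨ oneX b c < j))) ∧ F (c + 1) = F c)) :
    (gridOne a b).CountsActive j F :=
  ⟨h0, fun c => h c c.2⟩

theorem countsActive_gridTwo {a b j : ℕ} {F : ℕ → ℕ} (h0 : F 0 = 0) (h : ∀ c, c < 2 * a + 2 * b + 10 →
    (((twoX c < twoO a b c ∧ twoX c < j ∧ j ≤ twoO a b c) ∨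
    (twoO a b c < twoX c ∧ (j ≤ twoO a b c ∨ twoX c < j))) ∧ F (c + 1) = F c + 1) ∨
    (¬ ((twoX c < twoO a b c ∧ twoX c < j ∧ j ≤ twoO a b c) ∨
    (twoO a b c < twoX c ∧ (j ≤ twoO a b c ∨ twoX c < j))) ∧ F (c + 1) = F c)) :
    (gridTwo a b).CountsActive j F :=
  ⟨h0, fun c => h c c.2⟩

theorem strands_gridOne (a b : ℕ) : (gridOne a b).toBraid.strands = 2 * a + 2 * b + 5 := by
  have h : (gridOne a b).CountsActive 0 fun c => min c 1 + (min c (2 * b + 3) - 2) + (c - (2 * b + 6)) :=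
    countsActive_gridOne (by omega) fun c hc => by have := gridOne_cases a b c; omega
  rw [h.strands_eq]
  omega

set_option maxHeartbeats 400000 in
theorem rowsBelow_gridOne_low (a b : ℕ) : (gridOne a b).rowsBelow 5 =
    Br.asc 1 (2 * b + 1) * (Br.σ (2 * b + 2))⁻¹ * Br.asc 1 (2 * b + 2) * (Br.asc 1 (2 * b + 1))⁻¹ *
      (Br.σ 1)⁻¹ := by
  have c0 : (gridOne a b).CountsActive 0 fun c =>
      min c 1 + (min c (2 * b + 3) - 2) + (c - (2 * b + 6)) :=
    countsActive_gridOne (by omega) fun c hc => by have := gridOne_cases a b c; omega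
  have c1 : (gridOne a b).CountsActive 1 fun c =>
      (min c (2 * b + 3) - 2) + (min c (2 * b + 5) - (2 * b + 4)) + (c - (2 * b + 6)) :=
    countsActive_gridOne (by omega) fun c hc => by have := gridOne_cases a b c; omega
  have c2 : (gridOne a b).CountsActive 2 fun c =>
      (min c (2 * b + 5) - 2) + (c - (2 * b + 7)) :=
    countsActive_gridOne (by omega) fun c hc => by have := gridOne_cases a b c; omega
  have c3 : (gridOne a b).CountsActive 3 fun c =>
      (min c (2 * b + 6) - 3) + (c - (2 * b + 7)) :=
    countsActive_gridOne (by omega) fun c hc => by have := gridOne_cases a b c; omega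
  have c4 : (gridOne a b).CountsActive 4 fun c =>
      (min c 2 - 1) + (min c (2 * b + 4) - 3) + (min c (2 * b + 6) - (2 * b + 5)) + (c - (2 * b + 7)) :=
    countsActive_gridOne (by omega) fun c hc => by have := gridOne_cases a b c; omega
  have r0 := c0.mk_rowLetters_of_lt (by omega) (p := 0) (q := 2 * b + 4) (by omega) (by omega)
    (by have := gridOne_cases a b 0; change oneO a b 0 = _; omega)
    (by have := gridOne_cases a b (2 * b + 4); change oneX b (2 * b + 4) = _; omega) (by omega)
    (r := 1) (s := 2 * b + 1) (by omega) (by omega)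
  have r1 := c1.mk_rowLetters_of_gt (by omega) (p := 2 * b + 6) (q := 2 * b + 3) (by omega) (by omega)
    (by have := gridOne_cases a b (2 * b + 6); change oneO a b (2 * b + 6) = _; omega)
    (by have := gridOne_cases a b (2 * b + 3); change oneX b (2 * b + 3) = _; omega) (by omega)
    (r := 2 * b + 2) (s := 2 * b + 2) (by omega) (by omega)
  have r2 := c2.mk_rowLetters_of_lt (by omega) (p := 2) (q := 2 * b + 5) (by omega) (by omega)
    (by have := gridOne_cases a b 2; change oneO a b 2 = _; omega)
    (by have := gridOne_cases a b (2 * b + 5); change oneX b (2 * b + 5) = _; omega) (by omega)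
    (r := 1) (s := 2 * b + 2) (by omega) (by omega)
  have r3 := c3.mk_rowLetters_of_gt (by omega) (p := 2 * b + 4) (q := 1) (by omega) (by omega)
    (by have := gridOne_cases a b (2 * b + 4); change oneO a b (2 * b + 4) = _; omega)
    (by have := gridOne_cases a b 1; change oneX b 1 = _; omega) (by omega)
    (r := 1) (s := 2 * b + 1) (by omega) (by omega)
  have r4 := c4.mk_rowLetters_of_gt (by omega) (p := 3) (q := 0) (by omega) (by omega)
    (by have := gridOne_cases a b 3; change oneO a b 3 = _; omega)
    (by have := gridOne_cases a b 0; change oneX b 0 = _; omega) (by omega)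
    (r := 1) (s := 1) (by omega) (by omega)
  rw [rowsBelow_succ (by omega), rowsBelow_succ (by omega), rowsBelow_succ (by omega),
    rowsBelow_succ (by omega), rowsBelow_succ (by omega), rowsBelow_zero, r0, r1, r2, r3, r4, one_mul]
  simp only [Br.asc_self]

/-- In all other rows of the middle part no strand lies between the `X` and the `O`. -/
theorem rowsBelow_gridOne_middle (a b : ℕ) : (gridOne a b).rowsBelow (2 * a + 2 * b + 7) =
    (gridOne a b).rowsBelow 5 * (Br.σ (2 * b + 3))⁻¹ := by
  have c5 : (gridOne a b).CountsActive (2 * b + 5) fun c =>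
      min c (2 * b + 2) + (min c (2 * b + 6) - (2 * b + 5)) + (c - (2 * b + 7)) :=
    countsActive_gridOne (by omega) fun c hc => by have := gridOne_cases a b c; omega
  have r5 := c5.mk_rowLetters_of_gt (by omega) (p := 2 * b + 7) (q := 2 * b + 2) (by omega) (by omega)
    (by have := gridOne_cases a b (2 * b + 7); change oneO a b (2 * b + 7) = _; omega)
    (by have := gridOne_cases a b (2 * b + 2); change oneX b (2 * b + 2) = _; omega) (by omega)
    (r := 2 * b + 3) (s := 2 * b + 3) (by omega) (by omega)
  have t1 : ∀ j : Fin (2 * a + 2 * b + 9), 5 ≤ (j : ℕ) → (j : ℕ) < 2 * b + 5 →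
      Br.mk ((gridOne a b).rowLetters j) = 1 := by
    intro j h1 h2
    refine mk_rowLetters_eq_one (p := ⟨j - 1, by omega⟩) (q := ⟨j - 3, by omega⟩) (Fin.ext ?_) (Fin.ext ?_)
      fun c hc => ?_
    · have := gridOne_cases a b (j - 1); change oneO a b (j - 1) = _; omega
    · have := gridOne_cases a b (j - 3); change oneX b (j - 3) = _; omega
    · simp only [Fin.lt_def] at hc
      have := gridOne_cases a b c; rw [gridOne_active_iff]; omega
  have t2 : ∀ j : Fin (2 * a + 2 * b + 9), 2 * b + 6 ≤ (j : ℕ) → (j : ℕ) < 2 * a + 2 * b + 7 →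
      Br.mk ((gridOne a b).rowLetters j) = 1 := by
    intro j h1 h2
    refine mk_rowLetters_eq_one (p := ⟨j + 2, by omega⟩) (q := ⟨j, by omega⟩) (Fin.ext ?_) (Fin.ext ?_)
      fun c hc => ?_
    · have := gridOne_cases a b (j + 2); change oneO a b (j + 2) = _; omega
    · have := gridOne_cases a b j; change oneX b j = _; omega
    · simp only [Fin.lt_def] at hc
      have := gridOne_cases a b c; rw [gridOne_active_iff]; omega
  rw [rowsBelow_eq_of_trivial (m := 2 * b + 6) (by omega) (by omega) t2, rowsBelow_succ (by omega),
    rowsBelow_eq_of_trivial (m := 5) (by omega) (by omega) t1, r5, Br.asc_self]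

theorem mk_gridOne (a b : ℕ) : Br.mk (gridOne a b).toBraid.letters =
    Br.asc 1 (2 * b + 1) * (Br.σ (2 * b + 2))⁻¹ * Br.asc 1 (2 * b + 2) * (Br.asc 1 (2 * b + 1))⁻¹ *
      (Br.σ 1)⁻¹ * (Br.σ (2 * b + 3))⁻¹ * Br.asc 2 (2 * a + 2 * b + 4) *
      Br.asc (2 * b + 3) (2 * a + 2 * b + 4) := by
  have c6 : (gridOne a b).CountsActive (2 * a + 2 * b + 7) fun c =>
      min c (2 * b + 3) + (min c (2 * a + 2 * b + 7) - (2 * b + 5)) :=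
    countsActive_gridOne (by omega) fun c hc => by have := gridOne_cases a b c; omega
  have c7 : (gridOne a b).CountsActive (2 * a + 2 * b + 8) fun c =>
      min c 1 + (min c (2 * b + 3) - 2) + (min c (2 * a + 2 * b + 8) - (2 * b + 5)) :=
    countsActive_gridOne (by omega) fun c hc => by have := gridOne_cases a b c; omega
  have r6 := c6.mk_rowLetters_of_lt (by omega) (p := 1) (q := 2 * a + 2 * b + 7) (by omega) (by omega)
    (by have := gridOne_cases a b 1; change oneO a b 1 = _; omega)
    (by have := gridOne_cases a b (2 * a + 2 * b + 7); change oneX b (2 * a + 2 * b + 7) = _; omega) (by omega)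
    (r := 2) (s := 2 * a + 2 * b + 4) (by omega) (by omega)
  have r7 := c7.mk_rowLetters_of_lt (by omega) (p := 2 * b + 5) (q := 2 * a + 2 * b + 8) (by omega) (by omega)
    (by have := gridOne_cases a b (2 * b + 5); change oneO a b (2 * b + 5) = _; omega)
    (by have := gridOne_cases a b (2 * a + 2 * b + 8); change oneX b (2 * a + 2 * b + 8) = _; omega) (by omega)
    (r := 2 * b + 3) (s := 2 * a + 2 * b + 4) (by omega) (by omega)
  rw [mk_toBraid, rowsBelow_succ (by omega), rowsBelow_succ (by omega), rowsBelow_gridOne_middle,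
    rowsBelow_gridOne_low, r6, r7]

theorem strands_gridTwo (a b : ℕ) : (gridTwo a b).toBraid.strands = 2 * a + 2 * b + 5 := by
  have h : (gridTwo a b).CountsActive 0 fun c => c - 5 :=
    countsActive_gridTwo (by omega) fun c hc => by have := gridTwo_cases a b c; omega
  rw [h.strands_eq]
  omega

theorem rowsBelow_gridTwo_low (a b : ℕ) : (gridTwo a b).rowsBelow 4 =
    (Br.asc 1 (2 * b + 2))⁻¹ * (Br.asc 1 (2 * b + 2))⁻¹ * (Br.σ 2)⁻¹ * (Br.σ 1)⁻¹ * (Br.σ 1)⁻¹ := by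
  have c0 : (gridTwo a b).CountsActive 0 fun c =>
      c - 5 :=
    countsActive_gridTwo (by omega) fun c hc => by have := gridTwo_cases a b c; omega
  have c1 : (gridTwo a b).CountsActive 1 fun c =>
      (min c 4 - 3) + (min c (2 * b + 7) - 5) + (c - (2 * b + 8)) :=
    countsActive_gridTwo (by omega) fun c hc => by have := gridTwo_cases a b c; omega
  have c2 : (gridTwo a b).CountsActive 2 fun c =>
      (min c 4 - 2) + (min c (2 * b + 6) - 5) + (c - (2 * b + 8)) :=
    countsActive_gridTwo (by omega) fun c hc => by have := gridTwo_cases a b c; omega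
  have c3 : (gridTwo a b).CountsActive 3 fun c =>
      (min c 4 - 1) + (min c (2 * b + 6) - 6) + (c - (2 * b + 8)) :=
    countsActive_gridTwo (by omega) fun c hc => by have := gridTwo_cases a b c; omega
  have r0 := c0.mk_rowLetters_of_gt (by omega) (p := 2 * b + 7) (q := 3) (by omega) (by omega)
    (by have := gridTwo_cases a b (2 * b + 7); change twoO a b (2 * b + 7) = _; omega)
    (by have := gridTwo_cases a b 3; change twoX 3 = _; omega) (by omega)
    (r := 1) (s := 2 * b + 2) (by omega) (by omega)
  have r1 := c1.mk_rowLetters_of_gt (by omega) (p := 2 * b + 6) (q := 2) (by omega) (by omega)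
    (by have := gridTwo_cases a b (2 * b + 6); change twoO a b (2 * b + 6) = _; omega)
    (by have := gridTwo_cases a b 2; change twoX 2 = _; omega) (by omega)
    (r := 1) (s := 2 * b + 2) (by omega) (by omega)
  have r2 := c2.mk_rowLetters_of_gt (by omega) (p := 5) (q := 1) (by omega) (by omega)
    (by have := gridTwo_cases a b 5; change twoO a b 5 = _; omega)
    (by have := gridTwo_cases a b 1; change twoX 1 = _; omega) (by omega)
    (r := 1) (s := 2) (by omega) (by omega)
  have r3 := c3.mk_rowLetters_of_gt (by omega) (p := 2) (q := 0) (by omega) (by omega)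
    (by have := gridTwo_cases a b 2; change twoO a b 2 = _; omega)
    (by have := gridTwo_cases a b 0; change twoX 0 = _; omega) (by omega)
    (r := 1) (s := 1) (by omega) (by omega)
  have e : Br.asc 1 2 = Br.σ 1 * Br.σ 2 := by rw [Br.asc_succ (by omega), Br.asc_self]
  rw [rowsBelow_succ (by omega), rowsBelow_succ (by omega), rowsBelow_succ (by omega), rowsBelow_succ (by omega),
    rowsBelow_zero, r0, r1, r2, r3, one_mul, e]
  simp only [Br.asc_self, mul_inv_rev, mul_assoc]

/-- In all other rows of the middle part no strand lies between the `X` and the `O`. -/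
theorem rowsBelow_gridTwo_middle (a b : ℕ) : (gridTwo a b).rowsBelow (2 * a + 2 * b + 8) =
    (gridTwo a b).rowsBelow 4 * Br.asc 3 (2 * b + 3) * Br.asc 2 (2 * b + 3) := by
  have c4 : (gridTwo a b).CountsActive (2 * b + 5) fun c =>
      min c 2 + (min c (2 * b + 5) - 3) + (c - (2 * b + 9)) :=
    countsActive_gridTwo (by omega) fun c hc => by have := gridTwo_cases a b c; omega
  have c5 : (gridTwo a b).CountsActive (2 * b + 6) fun c =>
      min c 2 + (min c (2 * b + 6) - 4) + (c - (2 * b + 9)) :=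
    countsActive_gridTwo (by omega) fun c hc => by have := gridTwo_cases a b c; omega
  have r4 := c4.mk_rowLetters_of_lt (by omega) (p := 3) (q := 2 * b + 5) (by omega) (by omega)
    (by have := gridTwo_cases a b 3; change twoO a b 3 = _; omega)
    (by have := gridTwo_cases a b (2 * b + 5); change twoX (2 * b + 5) = _; omega) (by omega)
    (r := 3) (s := 2 * b + 3) (by omega) (by omega)
  have r5 := c5.mk_rowLetters_of_lt (by omega) (p := 1) (q := 2 * b + 6) (by omega) (by omega)
    (by have := gridTwo_cases a b 1; change twoO a b 1 = _; omega)
    (by have := gridTwo_cases a b (2 * b + 6); change twoX (2 * b + 6) = _; omega) (by omega)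
    (r := 2) (s := 2 * b + 3) (by omega) (by omega)
  have t1 : ∀ j : Fin (2 * a + 2 * b + 10), 4 ≤ (j : ℕ) → (j : ℕ) < 2 * b + 5 →
      Br.mk ((gridTwo a b).rowLetters j) = 1 := by
    intro j h1 h2
    rcases eq_or_ne (j : ℕ) (2 * b + 4) with h3 | h3
    · refine mk_rowLetters_eq_one (p := ⟨2 * b + 8, by omega⟩) (q := ⟨j, by omega⟩) (Fin.ext ?_) (Fin.ext ?_)
        fun c hc => ?_
      · have := gridTwo_cases a b (2 * b + 8); change twoO a b (2 * b + 8) = _; omega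
      · have := gridTwo_cases a b j; change twoX j = _; omega
      · simp only [Fin.lt_def] at hc
        have := gridTwo_cases a b c; rw [gridTwo_active_iff]; omega
    · refine mk_rowLetters_eq_one (p := ⟨j + 2, by omega⟩) (q := ⟨j, by omega⟩) (Fin.ext ?_) (Fin.ext ?_)
        fun c hc => ?_
      · have := gridTwo_cases a b (j + 2); change twoO a b (j + 2) = _; omega
      · have := gridTwo_cases a b j; change twoX j = _; omega
      · simp only [Fin.lt_def] at hc
        have := gridTwo_cases a b c; rw [gridTwo_active_iff]; omega
  have t2 : ∀ j : Fin (2 * a + 2 * b + 10), 2 * b + 7 ≤ (j : ℕ) → (j : ℕ) < 2 * a + 2 * b + 8 →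
      Br.mk ((gridTwo a b).rowLetters j) = 1 := by
    intro j h1 h2
    refine mk_rowLetters_eq_one (p := ⟨j + 2, by omega⟩) (q := ⟨j, by omega⟩) (Fin.ext ?_) (Fin.ext ?_)
      fun c hc => ?_
    · have := gridTwo_cases a b (j + 2); change twoO a b (j + 2) = _; omega
    · have := gridTwo_cases a b j; change twoX j = _; omega
    · simp only [Fin.lt_def] at hc
      have := gridTwo_cases a b c; rw [gridTwo_active_iff]; omega
  rw [rowsBelow_eq_of_trivial (m := 2 * b + 7) (by omega) (by omega) t2, rowsBelow_succ (by omega),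
    rowsBelow_succ (by omega), rowsBelow_eq_of_trivial (m := 4) (by omega) (by omega) t1, r4, r5]

theorem mk_gridTwo (a b : ℕ) : Br.mk (gridTwo a b).toBraid.letters =
    (Br.asc 1 (2 * b + 2))⁻¹ * (Br.asc 1 (2 * b + 2))⁻¹ * (Br.σ 2)⁻¹ * (Br.σ 1)⁻¹ * (Br.σ 1)⁻¹ *
      Br.asc 3 (2 * b + 3) * Br.asc 2 (2 * b + 3) * Br.asc 1 (2 * a + 2 * b + 4) *
      Br.asc 1 (2 * a + 2 * b + 4) := by
  have c6 : (gridTwo a b).CountsActive (2 * a + 2 * b + 8) fun c =>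
      min c 1 + (min c (2 * a + 2 * b + 8) - 4) :=
    countsActive_gridTwo (by omega) fun c hc => by have := gridTwo_cases a b c; omega
  have c7 : (gridTwo a b).CountsActive (2 * a + 2 * b + 9) fun c =>
      min c (2 * a + 2 * b + 9) - 4 :=
    countsActive_gridTwo (by omega) fun c hc => by have := gridTwo_cases a b c; omega
  have r6 := c6.mk_rowLetters_of_lt (by omega) (p := 0) (q := 2 * a + 2 * b + 8) (by omega) (by omega)
    (by have := gridTwo_cases a b 0; change twoO a b 0 = _; omega)
    (by have := gridTwo_cases a b (2 * a + 2 * b + 8); change twoX (2 * a + 2 * b + 8) = _; omega) (by omega)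
    (r := 1) (s := 2 * a + 2 * b + 4) (by omega) (by omega)
  have r7 := c7.mk_rowLetters_of_lt (by omega) (p := 4) (q := 2 * a + 2 * b + 9) (by omega) (by omega)
    (by have := gridTwo_cases a b 4; change twoO a b 4 = _; omega)
    (by have := gridTwo_cases a b (2 * a + 2 * b + 9); change twoX (2 * a + 2 * b + 9) = _; omega) (by omega)
    (r := 1) (s := 2 * a + 2 * b + 4) (by omega) (by omega)
  rw [mk_toBraid, rowsBelow_succ (by omega), rowsBelow_succ (by omega), rowsBelow_gridTwo_middle,
    rowsBelow_gridTwo_low, r6, r7]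

theorem mainTheorem5 (a b : ℕ) :
    RepresentSameTransverseKnot (gridOne a b).toBraid (braidOne a b) ∧
    RepresentSameTransverseKnot (gridTwo a b).toBraid (braidTwo a b) := by
  constructor
  · apply SameKnot.representSame
    rw [mk_gridOne, strands_gridOne]
    exact (SameKnot.inflatedBraidOne a b).symm
  · apply SameKnot.representSame
    rw [mk_gridTwo, strands_gridTwo]
    exact (SameKnot.inflatedBraidTwo a b).symm
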